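/- **Setting.** For $k_F\ge 0$ let $B_F=\{h\in\mathbb Z^3: |h|\le k_F\}$, $N=\# B_F$, $\hbar=N^{-1/3}$. Let $a_p,a_p^*$ ($p\in\mathbb Z^3$) be the fermionic annihilation and creation operators of the plane waves on the Fock space over $L^2(\mathbb T^3)\cong\ell^2(\mathbb Z^3)$, with vacuum $\Omega$. For $k\in\mathbb Z^3$ put $$\tilde b_k^*=\sum_{p\notin B_F,\,h\in B_F,\,p-h=k}a_p^*a_h^*,\qquad n_k=\|\tilde b_k^*\Omega\|,\qquad b_k^*=n_k^{-1}\tilde b_k^*\ (k\ne0),\qquad f(k)=\frac1{n_k^2}\sum_{p\notin B_F,\,h\in B_F,\,p-h=k}(p+h).$$ Let $\hat V:\mathbb Z^3\to\mathbb R$ be even with $\hat V(k)\ge 0$ for $k\neq 0$, and $$Q_N^{(0)}=\frac1{2N}\sum_{k\ne0}\hat V(k)\big(2\tilde b_k^*\tilde b_k+\tilde b_k^*\tilde b_{-k}^*+\tilde b_{-k}\tilde b_k\big),\qquad \mathbb H_0=\hbar^2\sum_{p\notin B_F}|p|^2a_p^*a_p-\hbar^2\sum_{h\in B_F}|h|^2a_h^*a_h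 .$$ For an even $\Xi:\mathbb Z^3\to\mathbb C$ let $T=\exp(B)$, where $B=\frac12\sum_{k\ne0}\Xi(k)b_k^*b_{-k}^*-\mathrm{h.c.}$, and define the error terms $\varepsilon_1$ and $\operatorname{Re}\varepsilon_2$ by $$\langle T\Omega,Q_N^{(0)}T\Omega\rangle=\frac1N\operatorname{Re}\sum_{k\neq0}\hat V(k)n_k^2\Big(\sinh^2|\Xi(k)|+\frac{\overline{\Xi(k)}}{|\Xi(k)|}\sinh|\Xi(k)|\cosh|\Xi(k)|\Big)+\varepsilon_1,$$ $$\langle T\Omega,\mathbb H_0T\Omega\rangle=\sum_{k\ne0}\hbar^2\,k\cdot f(k)\,\sinh^2|\Xi(k)|+2\operatorname{Re}\varepsilon_2$$ (terms with $\Xi(k)=0$ being read as $0$). Let $\Xi_0(k)=-\frac12\operatorname{artanh}(\beta_k/\alpha_k)$ for $k\ne 0$, where $\alpha_k,\beta_k$ are either (i) $\beta_k=\frac1N\hat V(k)n_k^2$, $\alpha_k=\hbar^2k\cdot f(k)+\beta_k$, or (ii) their leading orders $\beta_k=\hbar(\frac34\sqrt\pi)^{2/3}\hat V(k)|k|$,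 $\alpha_k=\hbar|k|\big(\frac4{3\sqrt\pi}\big)^{2/3}+\beta_k$. **Lemma (Collected Error Estimates).** Let $c=4\left(\frac{9\pi}{16}\right)^{2/3}$ and $$A_1=\sum_{k\ne0}|\log(1+c\hat V(k))|,\qquad A_2=\sum_{k\ne0}|\hat V(k)|\sqrt{1+c\hat V(k)},\qquad A_3=\sum_{k\ne0}|\hat V(k)|\sqrt{1+c\hat V(k)}\sqrt{|k|},$$ $$A_4=\sum_{k\ne0}|\log(1+c\hat V(k))|\sqrt{1+c\hat V(k)}\sqrt{|k|},\qquad A_5=\sum_{k\ne0,\ \hat V(k)\ne0}(1+c\hat V(k))^{1/4}\sqrt{|k|}.$$ There is a constant $C>0$ depending only on $A_1,\dots,A_5$ such that, whenever $A_1,\dots,A_5$ are finite, for every $k_F\ge0$ and for $\Xi=\Xi_0$ (in both versions (i) and (ii)), $$|\varepsilon_1+2\operatorname{Re}\varepsilon_2|\le \frac CN .$$ -/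

import Mathlib

noncomputable section

namespace RPA

/-- Momenta: the dual lattice `ℤ³` of the torus `𝕋³ = [0,2π]³`. -/
abbrev Momentum : Type := Fin 3 → ℤ

/-- The index set `ℤ³ ∖ {0}`. -/
abbrev NzMomentum : Type := {k : Momentum // k ≠ 0}

/-- The Euclidean length `|k|`. -/
def klen (k : Momentum) : ℝ := Real.sqrt (∑ i, (k i : ℝ) ^ 2)

/-! ### Fermionic Fock space over `L²(𝕋³) ≅ ℓ²(ℤ³)`, in the occupation number representation -/

/-- Fermionic Fock space over `ℓ²(ℤ³)`. The orthonormal basis vector indexed by a finite set `S` of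
momenta is the Slater determinant of the plane waves with momenta in `S`. -/
abbrev Fock : Type := lp (fun _ : Finset Momentum => ℂ) 2

/-- The vacuum `Ω`. -/
def vacuum : Fock := lp.single 2 (∅ : Finset Momentum) (1 : ℂ)

open scoped Classical in
/-- The fermionic (Jordan–Wigner) sign `(-1)^#{q ∈ S : q < p}`, momenta being ordered
lexicographically. -/
def jwSign (p : Momentum) (S : Finset Momentum) : ℂ :=
  (-1) ^ (S.filter fun q => toLex q < toLex p).card

lemma norm_jwSign (p : Momentum) (S : Finset Momentum) : ‖jwSign p S‖ = 1 := by
  simp [jwSign]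

open scoped Classical in
/-- Coefficients of `a_p ψ`. -/
def annihilateFun (p : Momentum) (ψ : Finset Momentum → ℂ) (S : Finset Momentum) : ℂ :=
  if p ∈ S then 0 else jwSign p S * ψ (insert p S)

lemma annihilate_sum_le (p : Momentum) (ψ : Fock) (s : Finset (Finset Momentum)) :
    ∑ S ∈ s, ‖annihilateFun p ψ S‖ ^ (2 : ENNReal).toReal ≤ ‖ψ‖ ^ (2 : ENNReal).toReal := by
  classical
  have h1 : ∑ S ∈ s, ‖annihilateFun p ψ S‖ ^ (2 : ENNReal).toReal
      = ∑ S ∈ s.filter (fun S => p ∉ S), ‖ψ (insert p S)‖ ^ (2 : ENNReal).toReal := by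
    rw [Finset.sum_filter]
    refine Finset.sum_congr rfl fun S _ => ?_
    by_cases h : p ∈ S
    · simp [annihilateFun, h]
    · simp [annihilateFun, h, norm_jwSign]
  have h2 : Set.InjOn (fun S : Finset Momentum => insert p S)
      (s.filter (fun S => p ∉ S) : Finset (Finset Momentum)) := by
    intro S hS S' hS' h
    simp only [Finset.coe_filter, Set.mem_ofPred_eq] at hS hS'
    have := congrArg (fun U : Finset Momentum => U.erase p) h
    simpa [Finset.erase_insert hS.2, Finset.erase_insert hS'.2] using this
  rw [h1, ← Finset.sum_image (f := fun U => ‖ψ U‖ ^ (2 : ENNReal).toReal) h2]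
  exact lp.sum_rpow_le_norm_rpow (by norm_num) ψ _

/-- The annihilation operator `a_p` of the plane wave with momentum `p`. -/
def annihilate (p : Momentum) : Fock →L[ℂ] Fock :=
  LinearMap.mkContinuous
    { toFun := fun ψ => ⟨annihilateFun p ψ, memℓp_gen' (annihilate_sum_le p ψ)⟩
      map_add' := by
        intro ψ φ
        ext S
        simp only [annihilateFun, lp.coeFn_add, Pi.add_apply]
        split_ifs <;> ring
      map_smul' := by
        intro c ψ
        ext S
        simp only [annihilateFun, lp.coeFn_smul, Pi.smul_apply, smul_eq_mul, RingHom.id_apply]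
        split_ifs <;> ring }
    1 (by
      intro ψ
      refine lp.norm_le_of_forall_sum_le (by norm_num) (by positivity) fun s => ?_
      rw [one_mul]
      exact annihilate_sum_le p ψ s)

/-- The creation operator `a*_p`. -/
def create (p : Momentum) : Fock →L[ℂ] Fock := ContinuousLinearMap.adjoint (annihilate p)

/-- The expectation value `⟨ψ, dΓ(A) ψ⟩` of the second quantization of a one-particle operator `A`
that is diagonal in the plane wave basis, with eigenvalue `e p` at momentum `p`. -/
def dGammaExpectation (e : Momentum → ℝ) (ψ : Fock) : ℝ :=
  ∑' S : Finset Momentum, (∑ p ∈ S, e p) * ‖ψ S‖ ^ 2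

/-! ### Fermi ball and particle-hole pair operators -/

/-- The Fermi ball `B_F = {h ∈ ℤ³ : |h| ≤ k_F}`. -/
def fermiBall (kF : ℝ) : Finset Momentum :=
  (Fintype.piFinset fun _ : Fin 3 => Finset.Icc (-⌊kF⌋) ⌊kF⌋).filter fun h => klen h ≤ kF

lemma mem_fermiBall (kF : ℝ) (h : Momentum) : h ∈ fermiBall kF ↔ klen h ≤ kF := by
  simp only [fermiBall, Finset.mem_filter, Fintype.mem_piFinset, Finset.mem_Icc,
    and_iff_right_iff_imp]
  intro hh i
  have h1 : |(h i : ℝ)| ≤ kF := by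
    refine le_trans ?_ hh
    rw [klen, ← Real.sqrt_sq_eq_abs]
    exact Real.sqrt_le_sqrt
      (Finset.single_le_sum (f := fun j => (h j : ℝ) ^ 2) (fun j _ => sq_nonneg _)
        (Finset.mem_univ i))
  have h2 := abs_le.mp h1
  refine ⟨?_, Int.le_floor.mpr h2.2⟩
  have h3 : -(h i) ≤ ⌊kF⌋ := Int.le_floor.mpr (by push_cast; linarith)
  linarith

/-- The particle number `N`, the number of lattice points in the Fermi ball. -/
def particleNumber (kF : ℝ) : ℕ := (fermiBall kF).card

/-- The semiclassical parameter `ħ = N^{-1/3}`. -/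
def hbar (kF : ℝ) : ℝ := (particleNumber kF : ℝ) ^ (-(1 / 3) : ℝ)

/-- The holes `h ∈ B_F` for which `h + k` lies outside of `B_F`; they enumerate the pairs
`(p, h) ∈ B_Fᶜ × B_F` with `p - h = k`. -/
def pairHoles (kF : ℝ) (k : Momentum) : Finset Momentum :=
  (fermiBall kF).filter fun h => h + k ∉ fermiBall kF

/-- The unnormalized pair creation operator `b̃*_k = ∑_{p ∈ B_Fᶜ, h ∈ B_F, p - h = k} a*_p a*_h`. -/
def pairCreateRaw (kF : ℝ) (k : Momentum) : Fock →L[ℂ] Fock :=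
  ∑ h ∈ pairHoles kF k, create (h + k) * create h

/-- The normalization constant `n_k = ‖b̃*_k Ω‖`. -/
def pairNorm (kF : ℝ) (k : Momentum) : ℝ := ‖pairCreateRaw kF k vacuum‖

/-- The collective pair creation operator `b*_k = n_k⁻¹ b̃*_k`. -/
def pairCreate (kF : ℝ) (k : Momentum) : Fock →L[ℂ] Fock :=
  ((pairNorm kF k : ℂ)⁻¹) • pairCreateRaw kF k

/-! ### The trial state -/

/-- `½ ∑_{k ≠ 0} Ξ(k) b*_k b*_{-k}`. -/
def bogCreationPart (kF : ℝ) (Ξ : Momentum → ℂ) : Fock →L[ℂ] Fock :=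
  (1 / 2 : ℂ) • ∑' k : NzMomentum, Ξ k • (pairCreate kF k * pairCreate kF (-(k : Momentum)))

/-- `B = ½ ∑_{k ≠ 0} Ξ(k) b*_k b*_{-k} - h.c.` -/
def bogGenerator (kF : ℝ) (Ξ : Momentum → ℂ) : Fock →L[ℂ] Fock :=
  bogCreationPart kF Ξ - ContinuousLinearMap.adjoint (bogCreationPart kF Ξ)

/-- The trial state `TΩ` with `T = exp(B)`. -/
def trialState (kF : ℝ) (Ξ : Momentum → ℂ) : Fock :=
  NormedSpace.exp (bogGenerator kF Ξ) vacuum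

/-! ### Energies and error terms -/

/-- `Q_N⁽⁰⁾ = (2N)⁻¹ ∑_{k ≠ 0} V̂(k) (2 b̃*_k b̃_k + b̃*_k b̃*_{-k} + b̃_{-k} b̃_k)`. -/
def interactionOp (V : Momentum → ℝ) (kF : ℝ) : Fock →L[ℂ] Fock :=
  (1 / (2 * (particleNumber kF : ℂ))) • ∑' k : NzMomentum, (V k : ℂ) •
    ((2 : ℂ) • (pairCreateRaw kF k * ContinuousLinearMap.adjoint (pairCreateRaw kF k))
      + pairCreateRaw kF k * pairCreateRaw kF (-(k : Momentum))
      + ContinuousLinearMap.adjoint (pairCreateRaw kF (-(k : Momentum)))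
        * ContinuousLinearMap.adjoint (pairCreateRaw kF k))

/-- Eigenvalues of the one-particle operator `u(-ħ²Δ)u - v̄(-ħ²Δ)v` on plane waves:
`ħ²|p|²` outside and `-ħ²|p|²` inside the Fermi ball. Its second quantization is `ℍ₀`. -/
def excitationEnergy (kF : ℝ) (p : Momentum) : ℝ :=
  if p ∈ fermiBall kF then -(hbar kF ^ 2 * klen p ^ 2) else hbar kF ^ 2 * klen p ^ 2

/-- `f(k) = n_k⁻² ∑_{p ∈ B_Fᶜ, h ∈ B_F, p = h + k} (p + h)`. -/
def fVec (kF : ℝ) (k : Momentum) : Fin 3 → ℝ :=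
  fun i => (pairNorm kF k ^ 2)⁻¹ * ∑ h ∈ pairHoles kF k, (((h + k) i : ℝ) + (h i : ℝ))

/-- `k · f(k)`. -/
def kDotF (kF : ℝ) (k : Momentum) : ℝ := ∑ i, (k i : ℝ) * fVec kF k i

/-- The bosonic main term of the interaction energy,
`N⁻¹ Re ∑_{k ≠ 0} V̂(k) n_k² (sinh²|Ξ(k)| + (conj Ξ(k) / |Ξ(k)|) sinh|Ξ(k)| cosh|Ξ(k)|)`. -/
def interactionMain (V : Momentum → ℝ) (kF : ℝ) (Ξ : Momentum → ℂ) : ℝ :=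
  (1 / (particleNumber kF : ℝ)) *
    (∑' k : NzMomentum, ((V k * pairNorm kF k ^ 2 : ℝ) : ℂ) *
      (((Real.sinh ‖Ξ k‖ ^ 2 : ℝ) : ℂ)
        + (starRingEnd ℂ (Ξ k) / (‖Ξ k‖ : ℂ))
          * ((Real.sinh ‖Ξ k‖ * Real.cosh ‖Ξ k‖ : ℝ) : ℂ))).re

/-- The bosonic main term of the kinetic energy, `∑_{k ≠ 0} ħ² k·f(k) sinh²|Ξ(k)|`. -/
def kineticMain (kF : ℝ) (Ξ : Momentum → ℂ) : ℝ :=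
  ∑' k : NzMomentum, hbar kF ^ 2 * kDotF kF k * Real.sinh ‖Ξ k‖ ^ 2

/-- `ε₁ = ⟨TΩ, Q_N⁽⁰⁾ TΩ⟩ - (bosonic main term)`. -/
def eps1 (V : Momentum → ℝ) (kF : ℝ) (Ξ : Momentum → ℂ) : ℂ :=
  inner ℂ (trialState kF Ξ) (interactionOp V kF (trialState kF Ξ))
    - (interactionMain V kF Ξ : ℂ)

/-- `ε₂`, determined up to its (irrelevant) imaginary part by
`⟨TΩ, ℍ₀ TΩ⟩ = (bosonic main term) + 2 Re ε₂`; here it is taken to be real. -/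
def eps2 (kF : ℝ) (Ξ : Momentum → ℂ) : ℂ :=
  (((dGammaExpectation (excitationEnergy kF) (trialState kF Ξ) - kineticMain kF Ξ) / 2 : ℝ) : ℂ)

/-! ### The optimal Bogoliubov kernel -/

/-- `Ξ₀(k) = -½ artanh(β_k / α_k)`. -/
def xiZero (α β : Momentum → ℝ) (k : Momentum) : ℂ :=
  ((-(1 / 2) * Real.artanh (β k / α k) : ℝ) : ℂ)

/-- `β_k = N⁻¹ V̂(k) n_k²`. -/
def beta (V : Momentum → ℝ) (kF : ℝ) (k : Momentum) : ℝ :=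
  (1 / (particleNumber kF : ℝ)) * V k * pairNorm kF k ^ 2

/-- `α_k = ħ² k·f(k) + N⁻¹ V̂(k) n_k²`. -/
def alpha (V : Momentum → ℝ) (kF : ℝ) (k : Momentum) : ℝ :=
  hbar kF ^ 2 * kDotF kF k + beta V kF k

/-- The leading order of `β_k`, namely `ħ (¾√π)^{2/3} V̂(k) |k|`. -/
def betaLead (V : Momentum → ℝ) (kF : ℝ) (k : Momentum) : ℝ :=
  hbar kF * ((3 / 4) * Real.sqrt Real.pi) ^ (2 / 3 : ℝ) * V k * klen k

/-- The leading order of `α_k`, namely `ħ |k| (4/(3√π))^{2/3}` plus the leading order of `β_k`. -/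
def alphaLead (V : Momentum → ℝ) (kF : ℝ) (k : Momentum) : ℝ :=
  hbar kF * klen k * (4 / (3 * Real.sqrt Real.pi)) ^ (2 / 3 : ℝ) + betaLead V kF k

/-! ### The sums `A₁, …, A₅` -/

/-- `c = 4 (9π/16)^{2/3}`. -/
def cConst : ℝ := 4 * (9 * Real.pi / 16) ^ (2 / 3 : ℝ)

/-- The summands of `A₁, …, A₅` at `k ≠ 0`. The sum `A₅` runs over the `k` with `V̂(k) ≠ 0`. -/
def aTerm (V : Momentum → ℝ) (i : Fin 5) (k : NzMomentum) : ℝ :=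
  match i with
  | 0 => |Real.log (1 + cConst * V k)|
  | 1 => |V k| * Real.sqrt (1 + cConst * V k)
  | 2 => |V k| * Real.sqrt (1 + cConst * V k) * Real.sqrt (klen k)
  | 3 => |Real.log (1 + cConst * V k)| * Real.sqrt (1 + cConst * V k) * Real.sqrt (klen k)
  | 4 => if V k = 0 then 0 else (1 + cConst * V k) ^ (1 / 4 : ℝ) * Real.sqrt (klen k)

/-- The sums `A₁, …, A₅` (indexed by `0, …, 4`). -/
def aSum (V : Momentum → ℝ) (i : Fin 5) : ℝ := ∑' k : NzMomentum, aTerm V i k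

end RPA

end

/-!
Finiteness of `A₅` forces the potential to have finite support: each term with `V̂(k) ≠ 0` is at
least `√|k| ≥ 1`. So `A₅` bounds the momenta `|k|` in the support `S`, `A₂` bounds `∑ V̂(k)`, and
the claim is that the pair operators `b_k`, `k ∈ S`, behave like bosons up to relative errors of
order `N^{-2/3}`, with constants that depend only on these two bounds.

*Lattice geometry.* `n_k²` is the number of holes that `k` lifts out of the Fermi ball. Each lattice
line in direction `k` leaves the ball once and meets it in at most `2 k_F + 1` points, which gives
`n_k² ≥ N^{2/3} / 6` (`rootN_sq_le`); decomposing `k` into unit steps gives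
`n_k² ≤ 108 |k| N^{2/3}` (`pairNorm_sq_le`). Telescoping `k · h` along these lines gives the exact
identity `n_k² k · f(k) = N |k|²` (`sum_klen_sq_sub`). Hence the quotients `β_k / (α_k - β_k)`, and
with them the kernel, are bounded by a multiple of `V̂(k)`, uniformly in `k_F`
(`exists_real_kernel`).

*Dynamics.* Let `ψ_t = exp (t B) Ω`. The commutators of pair operators are canonical up to one-body
operators of size `(n_k n_l)⁻¹` times the number operator (`pairLow_mul_star_pairLow`,
`norm_pairErr_le`), and the moments of the number operator in `ψ_t` are bounded by Grönwall's
inequality (`BogData.norm_wOp_flow_le`). Consequently `[b_k ± b*_{-k}, B] ψ_t` equals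
`± ξ(k) (b_k ± b*_{-k}) ψ_t` up to `O(N^{-2/3})`, and Duhamel's principle (`norm_flow_sub_le`) shows
that, in norm, `b_k ψ_t ≈ sinh (t ξ(k)) τ` and `b*_{-k} ψ_t ≈ cosh (t ξ(k)) τ` with the unit vector
`τ = exp (t B) b*_{-k} Ω`. The interaction energy is a combination of `‖b_k ψ_1‖²` and
`Re ⟨b*_{-k} ψ_1, b_k ψ_1⟩`, with weights `V̂(k) n_k² / N = O(N^{-1/3})`.

For the kinetic energy, `[b_k, ℍ₀]` is the pair operator whose weight is the excitation energy of the
pair. Its weight splits into the mean value `ħ² k · f(k) = O(N^{-1/3})`, which gives the derivative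
of the bosonic main term, and a weight of mean zero. The pair operator of a mean-zero weight
commutes with `B` up to the one-body errors and annihilates `Ω`, so that it nearly annihilates `ψ_t`
(`BogData.norm_pairLow_flow_le`), and integration over `t ∈ [0, 1]` gives
`BogData.abs_kinetic_sub_le`.
-/

noncomputable section

namespace RPA

/-! ### Creation and annihilation operators in the occupation number basis -/

lemma op_mul_apply (A B : Fock →L[ℂ] Fock) (ψ : Fock) : (A * B) ψ = A (B ψ) := rfl

lemma annihilate_apply (p : Momentum) (ψ : Fock) (S : Finset Momentum) :
    annihilate p ψ S = if p ∈ S then 0 else jwSign p S * ψ (insert p S) := by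
  simp only [annihilate, LinearMap.mkContinuous_apply, LinearMap.coe_mk, AddHom.coe_mk]
  simp only [annihilateFun]

lemma jwSign_mul_self (p : Momentum) (S : Finset Momentum) : jwSign p S * jwSign p S = 1 := by
  simp [jwSign, ← mul_pow]

lemma star_jwSign (p : Momentum) (S : Finset Momentum) :
    (starRingEnd ℂ) (jwSign p S) = jwSign p S := by
  simp [jwSign]

lemma jwSign_insert_of_not_lt {p q : Momentum} (S : Finset Momentum)
    (h : ¬ toLex q < toLex p) : jwSign p (insert q S) = jwSign p S := by
  simp only [jwSign]
  rw [Finset.filter_insert, if_neg h]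

lemma jwSign_insert_of_lt {p q : Momentum} {S : Finset Momentum}
    (h : toLex q < toLex p) (hq : q ∉ S) : jwSign p (insert q S) = - jwSign p S := by
  simp only [jwSign]
  rw [Finset.filter_insert, if_pos h, Finset.card_insert_of_notMem (by simp [hq]), pow_succ]
  ring

lemma jwSign_insert_self (p : Momentum) (S : Finset Momentum) :
    jwSign p (insert p S) = jwSign p S :=
  jwSign_insert_of_not_lt S (lt_irrefl _)

lemma jwSign_erase_self (p : Momentum) (S : Finset Momentum) :
    jwSign p (S.erase p) = jwSign p S := by
  by_cases h : p ∈ S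
  · rw [← jwSign_insert_self p (S.erase p), Finset.insert_erase h]
  · rw [Finset.erase_eq_of_notMem h]

/-- The sign change that makes operators of different modes anticommute. -/
lemma jwSign_mul_insert_comm {p q : Momentum} {S : Finset Momentum} (hpq : p ≠ q)
    (hp : p ∉ S) (hq : q ∉ S) :
    jwSign p S * jwSign q (insert p S) = - (jwSign q S * jwSign p (insert q S)) := by
  have hne : toLex p ≠ toLex q := fun h => hpq (toLex.injective h)
  rcases lt_or_gt_of_ne hne with h | h
  · rw [jwSign_insert_of_lt h hp, jwSign_insert_of_not_lt S (not_lt_of_gt h)]; ring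
  · rw [jwSign_insert_of_lt h hq, jwSign_insert_of_not_lt S (not_lt_of_gt h)]; ring

lemma annihilate_single (p : Momentum) (S : Finset Momentum) :
    annihilate p (lp.single 2 S (1 : ℂ))
      = if p ∈ S then jwSign p S • (lp.single 2 (S.erase p) (1 : ℂ) : Fock) else 0 := by
  ext U
  rw [annihilate_apply]
  split_ifs with h1 h2 h2
  · rw [lp.coeFn_smul, Pi.smul_apply, lp.single_apply_ne]
    · simp
    · rintro rfl; simp at h1
  · simp
  · rw [lp.coeFn_smul, Pi.smul_apply]
    by_cases hU : insert p U = S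
    · subst hU
      rw [Finset.erase_insert h1]
      simp [jwSign_insert_self]
    · rw [lp.single_apply_ne _ _ _ hU, lp.single_apply_ne]
      · simp
      · rintro rfl; exact hU (Finset.insert_erase h2)
  · rw [lp.single_apply_ne]
    · simp
    · rintro rfl; simp at h2

lemma apply_eq_inner_single (ψ : Fock) (S : Finset Momentum) :
    ψ S = inner ℂ (lp.single 2 S (1 : ℂ) : Fock) ψ := by
  rw [lp.inner_single_left]; simp

lemma create_apply (p : Momentum) (ψ : Fock) (S : Finset Momentum) :
    create p ψ S = if p ∈ S then jwSign p S * ψ (S.erase p) else 0 := by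
  rw [apply_eq_inner_single, create, ContinuousLinearMap.adjoint_inner_right, annihilate_single]
  split_ifs
  · rw [inner_smul_left, ← apply_eq_inner_single, star_jwSign]
  · simp

lemma annihilate_vacuum (p : Momentum) : annihilate p vacuum = 0 := by
  simp [vacuum, annihilate_single]

lemma annihilate_mul_annihilate (p q : Momentum) :
    annihilate p * annihilate q = - (annihilate q * annihilate p) := by
  ext ψ S
  simp only [op_mul_apply, neg_apply, lp.coeFn_neg,
    Pi.neg_apply, annihilate_apply, Finset.mem_insert]
  by_cases hpq : p = q
  · subst hpq; simp
  · by_cases hp : p ∈ S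
    · simp [hp]
    · by_cases hq : q ∈ S
      · simp [hq]
      · have := jwSign_mul_insert_comm hpq hp hq
        simp only [hp, hq, hpq, Ne.symm hpq, if_false, or_self]
        rw [Finset.insert_comm q p, ← mul_assoc, ← mul_assoc, this]
        ring

lemma annihilate_mul_create_of_ne {p q : Momentum} (hpq : p ≠ q) :
    annihilate p * create q = - (create q * annihilate p) := by
  ext ψ S
  simp only [op_mul_apply, neg_apply, lp.coeFn_neg,
    Pi.neg_apply, annihilate_apply, create_apply, Finset.mem_insert, Finset.mem_erase]
  by_cases hp : p ∈ S
  · simp [hp, hpq]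
  · by_cases hq : q ∈ S
    · simp only [hp, hq, Ne.symm hpq, if_false, if_true, and_false, or_true]
      obtain ⟨U, hU, rfl⟩ : ∃ U, q ∉ U ∧ insert q U = S :=
        ⟨S.erase q, by simp, Finset.insert_erase hq⟩
      have hpU : p ∉ U := fun h => hp (Finset.mem_insert_of_mem h)
      have := jwSign_mul_insert_comm hpq hpU hU
      rw [Finset.insert_comm p q, Finset.erase_insert hU, Finset.erase_insert (by simp [hU, Ne.symm hpq]),
        ← mul_assoc, ← mul_assoc, jwSign_insert_self, jwSign_insert_self]
      have h3 := jwSign_mul_self p U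
      have h4 := jwSign_mul_self q U
      have h5 := jwSign_mul_self p (insert q U)
      have h6 := jwSign_mul_self q (insert p U)
      -- all four signs square to one, so the exchange relation can be solved for either product
      have : jwSign p (insert q U) * jwSign q (insert p U) = - (jwSign q U * jwSign p U) := by
        linear_combination (jwSign p (insert q U) * jwSign p U) * this
          + (- jwSign p (insert q U) * jwSign q (insert p U)) * h3
          + (- jwSign q U * jwSign p U) * h5
      rw [this]; ring
    · simp [hq, Ne.symm hpq]

lemma annihilate_mul_create_self (p : Momentum) :
    annihilate p * create p = 1 - create p * annihilate p := by
  ext ψ S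
  simp only [op_mul_apply, sub_apply, lp.coeFn_sub,
    Pi.sub_apply, annihilate_apply, create_apply, one_apply_eq_self]
  by_cases hp : p ∈ S
  · simp [hp, jwSign_erase_self, ← mul_assoc, jwSign_mul_self]
  · simp [hp, jwSign_insert_self, ← mul_assoc, jwSign_mul_self]

lemma annihilate_mul_create (p q : Momentum) :
    annihilate p * create q = (if p = q then 1 else 0) - create q * annihilate p := by
  split_ifs with h
  · subst h; exact annihilate_mul_create_self p
  · rw [annihilate_mul_create_of_ne h, zero_sub]

lemma create_mul_annihilate_apply (p : Momentum) (ψ : Fock) (S : Finset Momentum) :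
    (create p * annihilate p) ψ S = if p ∈ S then ψ S else 0 := by
  simp only [op_mul_apply, annihilate_apply, create_apply]
  split_ifs with h h1
  · simp at h1
  · rw [jwSign_erase_self, ← mul_assoc, jwSign_mul_self, Finset.insert_erase h, one_mul]
  · rfl

/-! ### Operators that are diagonal in the occupation number basis -/

lemma diag_sum_le (P : Finset Momentum) (f : Finset Momentum → ℝ) (ψ : Fock)
    (s : Finset (Finset Momentum)) :
    ∑ S ∈ s, ‖(f (S ∩ P) : ℂ) * ψ S‖ ^ (2 : ENNReal).toReal
      ≤ ((∑ U ∈ P.powerset, |f U|) * ‖ψ‖) ^ (2 : ENNReal).toReal := by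
  have hC : 0 ≤ ∑ U ∈ P.powerset, |f U| := Finset.sum_nonneg fun _ _ => abs_nonneg _
  rw [Real.mul_rpow hC (norm_nonneg _)]
  refine le_trans (Finset.sum_le_sum (g := fun S => (∑ U ∈ P.powerset, |f U|) ^ (2 : ENNReal).toReal
    * ‖ψ S‖ ^ (2 : ENNReal).toReal) fun S _ => ?_) ?_
  · rw [← Real.mul_rpow hC (norm_nonneg _)]
    refine Real.rpow_le_rpow (norm_nonneg _) ?_ (by norm_num)
    rw [norm_mul]
    refine mul_le_mul_of_nonneg_right ?_ (norm_nonneg _)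
    rw [Complex.norm_real]
    exact Finset.single_le_sum (f := fun U => |f U|) (fun _ _ => abs_nonneg _)
      (Finset.mem_powerset.2 Finset.inter_subset_right)
  · rw [← Finset.mul_sum]
    exact mul_le_mul_of_nonneg_left (lp.sum_rpow_le_norm_rpow (by norm_num) ψ _)
      (Real.rpow_nonneg hC _)

/-- The diagonal operator that multiplies the Slater determinant with momenta `S` by `f (S ∩ P)`.
As only the modes in the finite set `P` are observed, it is bounded for every `f`. -/
def diagOp (P : Finset Momentum) (f : Finset Momentum → ℝ) : Fock →L[ℂ] Fock :=
  LinearMap.mkContinuous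
    { toFun := fun ψ => ⟨fun S => (f (S ∩ P) : ℂ) * ψ S, memℓp_gen' (diag_sum_le P f ψ)⟩
      map_add' := by
        intro ψ φ
        ext S
        simp only [lp.coeFn_add, Pi.add_apply]
        ring
      map_smul' := by
        intro c ψ
        ext S
        simp only [lp.coeFn_smul, Pi.smul_apply, smul_eq_mul, RingHom.id_apply]
        ring }
    (∑ U ∈ P.powerset, |f U|) (by
      intro ψ
      refine lp.norm_le_of_forall_sum_le (by norm_num)
        (mul_nonneg (Finset.sum_nonneg fun _ _ => abs_nonneg _) (norm_nonneg _)) fun s => ?_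
      exact diag_sum_le P f ψ s)

lemma diagOp_apply (P : Finset Momentum) (f : Finset Momentum → ℝ) (ψ : Fock)
    (S : Finset Momentum) : diagOp P f ψ S = (f (S ∩ P) : ℂ) * ψ S := rfl

lemma diagOp_mul (P : Finset Momentum) (f g : Finset Momentum → ℝ) :
    diagOp P f * diagOp P g = diagOp P (fun U => f U * g U) := by
  ext ψ S
  simp only [op_mul_apply, diagOp_apply]
  push_cast; ring

lemma diagOp_sub (P : Finset Momentum) (f g : Finset Momentum → ℝ) :
    diagOp P f - diagOp P g = diagOp P (fun U => f U - g U) := by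
  ext ψ S
  simp only [sub_apply, lp.coeFn_sub, Pi.sub_apply, diagOp_apply]
  push_cast; ring

lemma diagOp_one (P : Finset Momentum) : diagOp P (fun _ => 1) = 1 := by
  ext ψ S
  simp [diagOp_apply]

lemma diagOp_vacuum (P : Finset Momentum) (f : Finset Momentum → ℝ) :
    diagOp P f vacuum = (f ∅ : ℂ) • vacuum := by
  ext S
  rw [diagOp_apply, lp.coeFn_smul, Pi.smul_apply, vacuum]
  by_cases h : S = ∅
  · subst h; simp
  · rw [lp.single_apply_ne _ _ _ h]; simp

lemma adjoint_diagOp (P : Finset Momentum) (f : Finset Momentum → ℝ) :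
    ContinuousLinearMap.adjoint (diagOp P f) = diagOp P f := by
  symm
  rw [ContinuousLinearMap.eq_adjoint_iff]
  intro x y
  rw [lp.inner_eq_tsum, lp.inner_eq_tsum]
  refine tsum_congr fun S => ?_
  simp only [diagOp_apply, RCLike.inner_apply, map_mul, Complex.conj_ofReal]
  ring

lemma norm_diagOp_le {P : Finset Momentum} {f g : Finset Momentum → ℝ}
    (h : ∀ U ⊆ P, |f U| ≤ |g U|) (φ : Fock) : ‖diagOp P f φ‖ ≤ ‖diagOp P g φ‖ := by
  refine lp.norm_mono (by norm_num) fun S => ?_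
  rw [diagOp_apply, diagOp_apply, norm_mul, norm_mul, Complex.norm_real, Complex.norm_real]
  exact mul_le_mul_of_nonneg_right (h _ Finset.inter_subset_right) (norm_nonneg _)

lemma annihilate_mul_diagOp {P : Finset Momentum} {p : Momentum} (hp : p ∈ P)
    {f g : Finset Momentum → ℝ} (h : ∀ U ⊆ P, p ∉ U → f (insert p U) = g U) :
    annihilate p * diagOp P f = diagOp P g * annihilate p := by
  ext ψ S
  simp only [op_mul_apply, annihilate_apply, diagOp_apply]
  split_ifs with hS
  · simp
  · rw [Finset.insert_inter_of_mem hp, h _ Finset.inter_subset_right (by simp [hS])]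
    ring

/-- The number operator of the modes in `P` is the sum of the `a*_p a_p`. -/
lemma diagOp_card_eq_sum (P : Finset Momentum) :
    diagOp P (fun U => (U.card : ℝ)) = ∑ p ∈ P, create p * annihilate p := by
  ext ψ S
  rw [sum_apply, lp.coeFn_sum, Finset.sum_apply, diagOp_apply]
  simp only [create_mul_annihilate_apply]
  rw [Finset.sum_ite, Finset.sum_const_zero, add_zero, Finset.sum_const, nsmul_eq_mul,
    Finset.filter_mem_eq_inter, Finset.inter_comm]
  simp

lemma inner_create_right (p : Momentum) (x y : Fock) :
    inner ℂ x (create p y) = inner ℂ (annihilate p x) y := by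
  rw [create, ContinuousLinearMap.adjoint_inner_right]

lemma sum_norm_annihilate_sq (P : Finset Momentum) (φ : Fock) :
    ∑ p ∈ P, ‖annihilate p φ‖ ^ 2 = ‖diagOp P (fun U => √(U.card : ℝ)) φ‖ ^ 2 := by
  have h1 : ((∑ p ∈ P, ‖annihilate p φ‖ ^ 2 : ℝ) : ℂ)
      = inner ℂ φ (diagOp P (fun U => (U.card : ℝ)) φ) := by
    rw [diagOp_card_eq_sum, sum_apply, inner_sum]
    push_cast
    refine Finset.sum_congr rfl fun p _ => ?_
    change _ = inner ℂ φ (create p (annihilate p φ))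
    rw [inner_create_right, inner_self_eq_norm_sq_to_K]
    simp
  have h2 : diagOp P (fun U => (U.card : ℝ))
      = diagOp P (fun U => √(U.card : ℝ)) * diagOp P (fun U => √(U.card : ℝ)) := by
    rw [diagOp_mul]
    congr 1
    ext U
    exact (Real.mul_self_sqrt (Nat.cast_nonneg _)).symm
  have h3 : inner ℂ φ (diagOp P (fun U => (U.card : ℝ)) φ)
      = ((‖diagOp P (fun U => √(U.card : ℝ)) φ‖ ^ 2 : ℝ) : ℂ) := by
    rw [h2, op_mul_apply, ← ContinuousLinearMap.adjoint_inner_left,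
      adjoint_diagOp, inner_self_eq_norm_sq_to_K]
    simp
  exact_mod_cast h1.trans h3

/-! ### Functions of the number operator -/

/-- The function `f` of the number operator of the modes in `P`. -/
def numOp (P : Finset Momentum) (f : ℕ → ℝ) : Fock →L[ℂ] Fock := diagOp P fun U => f U.card

lemma numOp_mul (P : Finset Momentum) (f g : ℕ → ℝ) :
    numOp P f * numOp P g = numOp P (fun n => f n * g n) := diagOp_mul _ _ _

lemma numOp_numOp (P : Finset Momentum) (f g : ℕ → ℝ) (φ : Fock) :
    numOp P f (numOp P g φ) = numOp P (fun n => f n * g n) φ := by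
  rw [← numOp_mul, op_mul_apply]

lemma numOp_sub (P : Finset Momentum) (f g : ℕ → ℝ) :
    numOp P f - numOp P g = numOp P (fun n => f n - g n) := diagOp_sub _ _ _

lemma adjoint_numOp (P : Finset Momentum) (f : ℕ → ℝ) :
    ContinuousLinearMap.adjoint (numOp P f) = numOp P f := adjoint_diagOp _ _

lemma norm_numOp_le {P : Finset Momentum} {f g : ℕ → ℝ} (h : ∀ n, |f n| ≤ |g n|) (φ : Fock) :
    ‖numOp P f φ‖ ≤ ‖numOp P g φ‖ := norm_diagOp_le (fun _ _ => h _) φ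

lemma norm_numOp_le_const {P : Finset Momentum} {f : ℕ → ℝ} {c : ℝ} (h : ∀ n, |f n| ≤ c)
    (φ : Fock) : ‖numOp P f φ‖ ≤ c * ‖φ‖ := by
  have hc : 0 ≤ c := (abs_nonneg _).trans (h 0)
  have h1 : numOp P (fun _ => c) φ = (c : ℂ) • φ := by
    ext S
    rw [numOp, diagOp_apply, lp.coeFn_smul, Pi.smul_apply, smul_eq_mul]
  calc ‖numOp P f φ‖ ≤ ‖numOp P (fun _ => c) φ‖ :=
        norm_numOp_le (fun n => by rw [abs_of_nonneg hc]; exact h n) φ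
    _ = c * ‖φ‖ := by rw [h1, norm_smul, Complex.norm_real, Real.norm_of_nonneg hc]

lemma norm_numOp_le_mul {P : Finset Momentum} {f g : ℕ → ℝ} {c : ℝ}
    (h : ∀ n, |f n| ≤ c * |g n|) (φ : Fock) : ‖numOp P f φ‖ ≤ |c| * ‖numOp P g φ‖ := by
  have h1 : numOp P (fun n => c * g n) φ = numOp P (fun _ => c) (numOp P g φ) := by
    rw [numOp_numOp]
  calc ‖numOp P f φ‖ ≤ ‖numOp P (fun n => c * g n) φ‖ :=
        norm_numOp_le (fun n => (h n).trans (by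
          rw [abs_mul]; exact mul_le_mul_of_nonneg_right (le_abs_self c) (abs_nonneg _))) φ
    _ ≤ |c| * ‖numOp P g φ‖ := by rw [h1]; exact norm_numOp_le_const (fun _ => le_rfl) _

lemma annihilate_mul_numOp {P : Finset Momentum} {p : Momentum} (hp : p ∈ P) (f : ℕ → ℝ) :
    annihilate p * numOp P f = numOp P (fun n => f (n + 1)) * annihilate p :=
  annihilate_mul_diagOp hp fun U _ hU => by rw [Finset.card_insert_of_notMem hU]

lemma numOp_mul_create {P : Finset Momentum} {p : Momentum} (hp : p ∈ P) (f : ℕ → ℝ) :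
    numOp P f * create p = create p * numOp P (fun n => f (n + 1)) := by
  have h := congrArg star (annihilate_mul_numOp hp f)
  simp only [star_mul, ContinuousLinearMap.star_eq_adjoint, adjoint_numOp] at h
  exact h

lemma numOp_mul_hop {P : Finset Momentum} {p q : Momentum} (hp : p ∈ P) (hq : q ∈ P)
    (f : ℕ → ℝ) :
    numOp P f * (create q * annihilate p) = create q * annihilate p * numOp P f := by
  rw [← mul_assoc, numOp_mul_create hq, mul_assoc, ← annihilate_mul_numOp hp, mul_assoc]

/-- A one-body operator that maps modes injectively to modes, with coefficients bounded by `G`,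
is bounded by `G` times the number operator. -/
lemma norm_sum_hop_le {ι : Type*} {P : Finset Momentum} (I : Finset ι) (p q : ι → Momentum)
    (g : ι → ℝ) {G : ℝ} (hp : Set.InjOn p I) (hq : Set.InjOn q I) (hpP : ∀ i ∈ I, p i ∈ P)
    (hqP : ∀ i ∈ I, q i ∈ P) (hg : ∀ i ∈ I, |g i| ≤ G) (hG : 0 ≤ G) (φ : Fock) :
    ‖(∑ i ∈ I, (g i : ℂ) • (create (q i) * annihilate (p i))) φ‖
      ≤ G * ‖numOp P (fun n => (n : ℝ) + 1) φ‖ := by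
  set E : Fock →L[ℂ] Fock := ∑ i ∈ I, (g i : ℂ) • (create (q i) * annihilate (p i)) with hE
  have hcomm : ∀ f : ℕ → ℝ, numOp P f * E = E * numOp P f := by
    intro f
    rw [hE, Finset.mul_sum, Finset.sum_mul]
    refine Finset.sum_congr rfl fun i hi => ?_
    rw [mul_smul_comm, smul_mul_assoc, numOp_mul_hop (hpP i hi) (hqP i hi)]
  have hsum : ∀ (r : ι → Momentum), Set.InjOn r I → (∀ i ∈ I, r i ∈ P) → ∀ χ : Fock,
      √(∑ i ∈ I, ‖annihilate (r i) χ‖ ^ 2) ≤ ‖numOp P (fun n => √(n : ℝ)) χ‖ := by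
    intro r hr hrP χ
    refine Real.sqrt_le_iff.2 ⟨norm_nonneg _, ?_⟩
    rw [numOp, ← sum_norm_annihilate_sq, ← Finset.sum_image (f := fun p => ‖annihilate p χ‖ ^ 2) hr]
    exact Finset.sum_le_sum_of_subset_of_nonneg (Finset.image_subset_iff.2 hrP)
      fun _ _ _ => sq_nonneg _
  have hform : ∀ χ φ : Fock, ‖inner ℂ χ (E φ)‖
      ≤ G * (‖numOp P (fun n => √(n : ℝ)) χ‖ * ‖numOp P (fun n => √(n : ℝ)) φ‖) := by
    intro χ φ
    rw [hE, sum_apply, inner_sum]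
    calc ‖∑ i ∈ I, inner ℂ χ (((g i : ℂ) • (create (q i) * annihilate (p i))) φ)‖
        ≤ ∑ i ∈ I, G * (‖annihilate (q i) χ‖ * ‖annihilate (p i) φ‖) := by
          refine norm_sum_le_of_le _ fun i hi => ?_
          change ‖inner ℂ χ ((g i : ℂ) • create (q i) (annihilate (p i) φ))‖ ≤ _
          rw [inner_smul_right, inner_create_right, norm_mul, Complex.norm_real]
          exact mul_le_mul (hg i hi) (norm_inner_le_norm _ _) (norm_nonneg _) hG
      _ ≤ _ := by
          rw [← Finset.mul_sum]
          refine mul_le_mul_of_nonneg_left ?_ hG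
          refine (Real.sum_mul_le_sqrt_mul_sqrt _ _ _).trans ?_
          exact mul_le_mul (hsum q hq hqP χ) (hsum p hp hpP φ) (Real.sqrt_nonneg _)
            (norm_nonneg _)
  -- `E` preserves the particle number, so a factor `(n + 1)^{-1/2}` can be put on either side
  obtain ⟨s, hs⟩ : ∃ s : ℕ → ℝ, s = fun n : ℕ => (√((n : ℝ) + 1))⁻¹ := ⟨_, rfl⟩
  have hb : ∀ χ : Fock, ‖numOp P (fun n => √(n : ℝ)) (numOp P s χ)‖ ≤ ‖χ‖ := fun χ => by
    rw [numOp_numOp]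
    refine (norm_numOp_le_const (c := 1) (fun n => ?_) χ).trans (one_mul _).le
    rw [hs, abs_of_nonneg (by positivity), ← div_eq_mul_inv]
    exact div_le_one_of_le₀ (Real.sqrt_le_sqrt (by linarith)) (Real.sqrt_nonneg _)
  have hss : numOp P (fun n => ((n : ℝ) + 1)⁻¹) = numOp P s * numOp P s := by
    rw [numOp_mul, hs]
    congr 1
    ext n
    rw [← mul_inv, Real.mul_self_sqrt (by positivity)]
  have hE1 : ∀ φ : Fock, ‖E (numOp P (fun n => ((n : ℝ) + 1)⁻¹) φ)‖ ≤ G * ‖φ‖ := by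
    intro φ
    have h1 : E (numOp P (fun n => ((n : ℝ) + 1)⁻¹) φ) = numOp P s (E (numOp P s φ)) := by
      rw [hss, ← op_mul_apply, ← mul_assoc, ← hcomm]
      rfl
    rw [h1]
    obtain ⟨v, hv⟩ : ∃ v, v = numOp P s (E (numOp P s φ)) := ⟨_, rfl⟩
    rw [← hv]
    have h4 : ‖inner ℂ (numOp P s v) (E (numOp P s φ))‖ = ‖v‖ ^ 2 := by
      have : inner ℂ (numOp P s v) (E (numOp P s φ)) = inner ℂ v v := by
        nth_rw 1 [← adjoint_numOp]
        rw [ContinuousLinearMap.adjoint_inner_left, ← hv]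
      rw [this, inner_self_eq_norm_sq_to_K]
      simp
    have h3 : ‖v‖ ^ 2 ≤ G * (‖v‖ * ‖φ‖) := by
      rw [← h4]
      refine (hform _ _).trans (mul_le_mul_of_nonneg_left ?_ hG)
      exact mul_le_mul (hb v) (hb φ) (norm_nonneg _) (norm_nonneg _)
    by_cases hv0 : ‖v‖ = 0
    · rw [hv0]; positivity
    · have : 0 < ‖v‖ := lt_of_le_of_ne (norm_nonneg _) (Ne.symm hv0)
      refine le_of_mul_le_mul_left ?_ this
      linarith
  have h5 : φ = numOp P (fun n => ((n : ℝ) + 1)⁻¹) (numOp P (fun n => (n : ℝ) + 1) φ) := by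
    rw [numOp_numOp]
    have : (fun n : ℕ => ((n : ℝ) + 1)⁻¹ * ((n : ℝ) + 1)) = fun _ => 1 := by
      ext n; exact inv_mul_cancel₀ (by positivity)
    rw [this, numOp, diagOp_one, one_apply_eq_self]
  calc ‖E φ‖ = ‖E (numOp P (fun n => ((n : ℝ) + 1)⁻¹) (numOp P (fun n => (n : ℝ) + 1) φ))‖ := by
        rw [← h5]
    _ ≤ _ := hE1 _

/-! ### Pair operators -/

/-- The pair annihilation operator `∑_h g(h) a_h a_{h+k}` with weight `g`, where `h` runs over the
holes that can be lifted out of the Fermi ball by `k`. -/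
def pairLow (kF : ℝ) (k : Momentum) (g : Momentum → ℝ) : Fock →L[ℂ] Fock :=
  ∑ h ∈ pairHoles kF k, (g h : ℂ) • (annihilate h * annihilate (h + k))

/-- All modes that enter the pair operators with momentum `k` lie in `P`. -/
def Covers (P : Finset Momentum) (kF : ℝ) (k : Momentum) : Prop :=
  ∀ h ∈ pairHoles kF k, h ∈ P ∧ h + k ∈ P

lemma mem_pairHoles {kF : ℝ} {k h : Momentum} :
    h ∈ pairHoles kF k ↔ h ∈ fermiBall kF ∧ h + k ∉ fermiBall kF := Finset.mem_filter

lemma star_annihilate (p : Momentum) : star (annihilate p) = create p := rfl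

lemma star_pairLow (kF : ℝ) (k : Momentum) (g : Momentum → ℝ) :
    star (pairLow kF k g)
      = ∑ h ∈ pairHoles kF k, (g h : ℂ) • (create (h + k) * create h) := by
  rw [pairLow, star_sum]
  refine Finset.sum_congr rfl fun h _ => ?_
  rw [star_smul, star_mul, star_annihilate, star_annihilate]
  simp

lemma star_pairCreateRaw (kF : ℝ) (k : Momentum) :
    star (pairLow kF k 1) = pairCreateRaw kF k := by
  rw [star_pairLow, pairCreateRaw]
  simp

lemma pairLow_vacuum (kF : ℝ) (k : Momentum) (g : Momentum → ℝ) :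
    pairLow kF k g vacuum = 0 := by
  rw [pairLow, sum_apply]
  refine Finset.sum_eq_zero fun h _ => ?_
  change (g h : ℂ) • annihilate h (annihilate (h + k) vacuum) = 0
  rw [annihilate_vacuum]; simp

lemma annihilate_pair_comm (p q r s : Momentum) :
    (annihilate p * annihilate q) * (annihilate r * annihilate s)
      = (annihilate r * annihilate s) * (annihilate p * annihilate q) := by
  calc (annihilate p * annihilate q) * (annihilate r * annihilate s)
      = annihilate p * (annihilate q * annihilate r) * annihilate s := by noncomm_ring
    _ = - (annihilate p * annihilate r * (annihilate q * annihilate s)) := by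
        rw [annihilate_mul_annihilate q r]; noncomm_ring
    _ = annihilate r * annihilate p * (annihilate q * annihilate s) := by
        rw [annihilate_mul_annihilate p r]; noncomm_ring
    _ = - (annihilate r * (annihilate p * annihilate s) * annihilate q) := by
        rw [annihilate_mul_annihilate q s]; noncomm_ring
    _ = (annihilate r * annihilate s) * (annihilate p * annihilate q) := by
        rw [annihilate_mul_annihilate p s]; noncomm_ring

lemma pairLow_comm (kF : ℝ) (k l : Momentum) (g g' : Momentum → ℝ) :
    pairLow kF k g * pairLow kF l g' = pairLow kF l g' * pairLow kF k g := by
  simp only [pairLow, Finset.sum_mul_sum]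
  rw [Finset.sum_comm]
  refine Finset.sum_congr rfl fun h _ => Finset.sum_congr rfl fun h' _ => ?_
  rw [smul_mul_smul_comm, smul_mul_smul_comm, annihilate_pair_comm, mul_comm (g' h : ℂ)]

/-- The canonical anticommutation relations, for the commutator of two pairs. -/
lemma pair_mul_pair {h p h' p' : Momentum} (h1 : h ≠ p') (h2 : p ≠ h') :
    (annihilate h * annihilate p) * (create p' * create h')
      = (create p' * create h') * (annihilate h * annihilate p)
        + ((if p = p' then 1 else 0) * (if h = h' then 1 else 0)
          - ((if p = p' then 1 else 0) * (create h' * annihilate h)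
            + (if h = h' then 1 else 0) * (create p' * annihilate p))) := by
  have e1 := annihilate_mul_create p p'
  have e2 := annihilate_mul_create h h'
  have e3 := annihilate_mul_create_of_ne h1
  have e4 := annihilate_mul_create_of_ne h2
  set δ : Fock →L[ℂ] Fock := if p = p' then 1 else 0 with hδ
  set η : Fock →L[ℂ] Fock := if h = h' then 1 else 0 with hη
  have cδ : ∀ X : Fock →L[ℂ] Fock, X * δ = δ * X := fun X => by
    rw [hδ]; split_ifs <;> simp
  have cη : ∀ X : Fock →L[ℂ] Fock, X * η = η * X := fun X => by
    rw [hη]; split_ifs <;> simp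
  calc (annihilate h * annihilate p) * (create p' * create h')
      = annihilate h * (annihilate p * create p') * create h' := by noncomm_ring
    _ = (annihilate h * δ) * create h'
        - (annihilate h * create p') * (annihilate p * create h') := by
        rw [e1]; noncomm_ring
    _ = δ * (annihilate h * create h')
        - create p' * (annihilate h * create h') * annihilate p := by
        rw [e3, e4, cδ]; noncomm_ring
    _ = δ * η - δ * (create h' * annihilate h) - (create p' * η) * annihilate p
        + create p' * create h' * (annihilate h * annihilate p) := by
        rw [e2]; noncomm_ring
    _ = _ := by rw [cη (create p')]; noncomm_ring

/-- The one-body operator by which the pair operators fail to satisfy the canonical commutation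
relations: in the first sum the particles of the two pairs coincide and a hole is moved, in the
second one the holes coincide and a particle is moved. -/
def pairErr (kF : ℝ) (k l : Momentum) (g g' : Momentum → ℝ) : Fock →L[ℂ] Fock :=
  (∑ h ∈ (pairHoles kF k).filter (fun h => h + k - l ∈ pairHoles kF l),
      ((g h * g' (h + k - l) : ℝ) : ℂ) • (create (h + k - l) * annihilate h))
    + ∑ h ∈ (pairHoles kF k).filter (fun h => h ∈ pairHoles kF l),
      ((g h * g' h : ℝ) : ℂ) • (create (h + l) * annihilate (h + k))

/-- The approximate canonical commutation relations of the pair operators. -/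
lemma pairLow_mul_star_pairLow (kF : ℝ) (k l : Momentum) (g g' : Momentum → ℝ) :
    pairLow kF k g * star (pairLow kF l g')
      = star (pairLow kF l g') * pairLow kF k g
        + ((if k = l then ((∑ h ∈ pairHoles kF k, g h * g' h : ℝ) : ℂ) else 0) • 1
          - pairErr kF k l g g') := by
  have key : ∀ h ∈ pairHoles kF k, ∀ h' ∈ pairHoles kF l,
      (((g h : ℂ) • (annihilate h * annihilate (h + k)))
        * ((g' h' : ℂ) • (create (h' + l) * create h')) : Fock →L[ℂ] Fock)
      = ((g' h' : ℂ) • (create (h' + l) * create h'))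
          * ((g h : ℂ) • (annihilate h * annihilate (h + k)))
        + ((if h = h' then (if k = l then ((g h * g' h : ℝ) : ℂ) else 0) • 1 else 0)
        - ((if h + k - l = h' then
              ((g h * g' (h + k - l) : ℝ) : ℂ) • (create (h + k - l) * annihilate h) else 0)
          + (if h = h' then
              ((g h * g' h : ℝ) : ℂ) • (create (h + l) * annihilate (h + k)) else 0))) := by
    intro h hh h' hh'
    rw [mem_pairHoles] at hh hh'
    have h1 : h ≠ h' + l := by rintro rfl; exact hh'.2 hh.1
    have h2 : h + k ≠ h' := by rintro rfl; exact hh.2 hh'.1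
    rw [smul_mul_smul_comm, pair_mul_pair h1 h2, smul_mul_smul_comm, smul_add,
      mul_comm (g' h' : ℂ)]
    congr 1
    have e : (h + k - l = h') ↔ (h + k = h' + l) := sub_eq_iff_eq_add
    by_cases hA : h = h'
    · subst hA
      by_cases hB : k = l
      · subst hB
        simp [smul_sub, smul_add]
      · have : h + k - l ≠ h := by
          intro hc; rw [e] at hc; exact hB (add_left_cancel hc)
        simp [hB, this]
    · by_cases hB : h + k = h' + l
      · have : h + k - l = h' := e.2 hB
        simp [hA, hB]
      · have : h + k - l ≠ h' := fun hc => hB (e.1 hc)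
        simp [hA, hB, this]
  rw [star_pairLow]
  simp only [pairLow]
  rw [Finset.sum_mul_sum, Finset.sum_mul_sum,
    Finset.sum_congr rfl fun h hh => Finset.sum_congr rfl fun h' hh' => key h hh h' hh']
  simp only [Finset.sum_add_distrib, Finset.sum_sub_distrib, Finset.sum_ite_eq]
  rw [Finset.sum_comm]
  congr 1
  rw [pairErr, Finset.sum_filter, Finset.sum_filter]
  congr 1
  by_cases hkl : k = l
  · subst hkl
    rw [if_pos rfl]
    push_cast
    rw [Finset.sum_smul]
    refine Finset.sum_congr rfl fun h hh => ?_
    simp [hh]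
  · simp [hkl]

lemma pairErr_vacuum (kF : ℝ) (k l : Momentum) (g g' : Momentum → ℝ) :
    pairErr kF k l g g' vacuum = 0 := by
  rw [pairErr, add_apply, sum_apply, sum_apply]
  have : ∀ (c : ℂ) (p q : Momentum), (c • (create q * annihilate p)) vacuum = 0 := by
    intro c p q
    change c • create q (annihilate p vacuum) = 0
    rw [annihilate_vacuum]; simp
  simp [this]

lemma pairNorm_sq (kF : ℝ) (k : Momentum) :
    pairNorm kF k ^ 2 = (pairHoles kF k).card := by
  have h1 : inner ℂ (pairCreateRaw kF k vacuum) (pairCreateRaw kF k vacuum)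
      = ((pairHoles kF k).card : ℂ) := by
    rw [← star_pairCreateRaw, ContinuousLinearMap.star_eq_adjoint,
      ContinuousLinearMap.adjoint_inner_left, ← op_mul_apply,
      ← ContinuousLinearMap.star_eq_adjoint, pairLow_mul_star_pairLow, add_apply, sub_apply,
      op_mul_apply, pairLow_vacuum, pairErr_vacuum]
    simp only [if_true, Pi.one_apply, mul_one, Finset.sum_const, nsmul_eq_mul, map_zero, zero_add,
      sub_zero, smul_apply, one_apply_eq_self, inner_smul_right, Complex.ofReal_natCast]
    rw [vacuum, inner_self_eq_norm_sq_to_K, lp.norm_single (by norm_num)]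
    simp
  rw [inner_self_eq_norm_sq_to_K] at h1
  rw [pairNorm]
  have h2 : ((‖pairCreateRaw kF k vacuum‖ ^ 2 : ℝ) : ℂ) = (((pairHoles kF k).card : ℝ) : ℂ) := by
    push_cast; exact h1
  exact_mod_cast h2

/-! ### Pair operators and the number operator -/

lemma numOp_mul_pairErr {P : Finset Momentum} {kF : ℝ} {k l : Momentum} (hk : Covers P kF k)
    (hl : Covers P kF l) (g g' : Momentum → ℝ) (f : ℕ → ℝ) :
    numOp P f * pairErr kF k l g g' = pairErr kF k l g g' * numOp P f := by
  rw [pairErr, mul_add, add_mul, Finset.mul_sum, Finset.mul_sum, Finset.sum_mul, Finset.sum_mul]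
  congr 1 <;> refine Finset.sum_congr rfl fun h hh => ?_
  · rw [Finset.mem_filter] at hh
    rw [mul_smul_comm, smul_mul_assoc, numOp_mul_hop (hk h hh.1).1 (hl _ hh.2).1]
  · rw [Finset.mem_filter] at hh
    rw [mul_smul_comm, smul_mul_assoc, numOp_mul_hop (hk h hh.1).2 (hl _ hh.2).2]

lemma norm_pairErr_le {P : Finset Momentum} {kF : ℝ} {k l : Momentum} (hk : Covers P kF k)
    (hl : Covers P kF l) {g g' : Momentum → ℝ} {G G' : ℝ} (hg : ∀ h ∈ pairHoles kF k, |g h| ≤ G)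
    (hg' : ∀ h ∈ pairHoles kF l, |g' h| ≤ G') (hG : 0 ≤ G) (hG' : 0 ≤ G') (φ : Fock) :
    ‖pairErr kF k l g g' φ‖ ≤ 2 * G * G' * ‖numOp P (fun n => (n : ℝ) + 1) φ‖ := by
  rw [pairErr, add_apply]
  have e1 := norm_sum_hop_le (P := P)
    ((pairHoles kF k).filter (fun h => h + k - l ∈ pairHoles kF l)) (fun h => h)
    (fun h => h + k - l) (fun h => g h * g' (h + k - l)) (G := G * G')
    (fun _ _ _ _ h => h) (fun a _ b _ h => by simpa using h)
    (fun h hh => (hk h (Finset.mem_filter.1 hh).1).1)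
    (fun h hh => (hl _ (Finset.mem_filter.1 hh).2).1)
    (fun h hh => by
      rw [abs_mul]
      exact mul_le_mul (hg h (Finset.mem_filter.1 hh).1) (hg' _ (Finset.mem_filter.1 hh).2)
        (abs_nonneg _) hG) (mul_nonneg hG hG') φ
  have e2 := norm_sum_hop_le (P := P)
    ((pairHoles kF k).filter (fun h => h ∈ pairHoles kF l)) (fun h => h + k)
    (fun h => h + l) (fun h => g h * g' h) (G := G * G')
    (fun a _ b _ h => by simpa using h) (fun a _ b _ h => by simpa using h)
    (fun h hh => (hk h (Finset.mem_filter.1 hh).1).2)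
    (fun h hh => (hl _ (Finset.mem_filter.1 hh).2).2)
    (fun h hh => by
      rw [abs_mul]
      exact mul_le_mul (hg h (Finset.mem_filter.1 hh).1) (hg' _ (Finset.mem_filter.1 hh).2)
        (abs_nonneg _) hG) (mul_nonneg hG hG') φ
  refine (norm_add_le _ _).trans ((add_le_add e1 e2).trans (le_of_eq (by ring)))

lemma pairLow_mul_numOp {P : Finset Momentum} {kF : ℝ} {k : Momentum} (hk : Covers P kF k)
    (g : Momentum → ℝ) (f : ℕ → ℝ) :
    pairLow kF k g * numOp P f = numOp P (fun n => f (n + 2)) * pairLow kF k g := by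
  rw [pairLow, Finset.sum_mul, Finset.mul_sum]
  refine Finset.sum_congr rfl fun h hh => ?_
  rw [smul_mul_assoc, mul_smul_comm, mul_assoc, annihilate_mul_numOp (hk h hh).2, ← mul_assoc,
    annihilate_mul_numOp (hk h hh).1, mul_assoc]

lemma numOp_mul_star_pairLow {P : Finset Momentum} {kF : ℝ} {k : Momentum} (hk : Covers P kF k)
    (g : Momentum → ℝ) (f : ℕ → ℝ) :
    numOp P f * star (pairLow kF k g) = star (pairLow kF k g) * numOp P (fun n => f (n + 2)) := by
  have h := congrArg star (pairLow_mul_numOp hk g f)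
  have e : ∀ f, star (numOp P f) = numOp P f := adjoint_numOp P
  rw [star_mul, star_mul, e, e] at h
  exact h

lemma norm_annihilate_le (p : Momentum) (φ : Fock) : ‖annihilate p φ‖ ≤ ‖φ‖ := by
  have := (annihilate p).le_of_opNorm_le (LinearMap.mkContinuous_norm_le _ zero_le_one _) φ
  simpa using this

lemma norm_pairLow_le {P : Finset Momentum} {kF : ℝ} {k : Momentum} (hk : Covers P kF k)
    {g : Momentum → ℝ} {G : ℝ} (hg : ∀ h ∈ pairHoles kF k, |g h| ≤ G) (hG : 0 ≤ G) (φ : Fock) :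
    ‖pairLow kF k g φ‖ ≤ G * pairNorm kF k * ‖numOp P (fun n => √(n : ℝ)) φ‖ := by
  have hn : pairNorm kF k = √((pairHoles kF k).card : ℝ) := by
    rw [← pairNorm_sq, Real.sqrt_sq (show 0 ≤ pairNorm kF k from norm_nonneg _)]
  rw [pairLow, sum_apply]
  calc ‖∑ h ∈ pairHoles kF k, ((g h : ℂ) • (annihilate h * annihilate (h + k))) φ‖
      ≤ ∑ h ∈ pairHoles kF k, G * (1 * ‖annihilate (h + k) φ‖) := by
        refine norm_sum_le_of_le _ fun h hh => ?_
        change ‖(g h : ℂ) • annihilate h (annihilate (h + k) φ)‖ ≤ _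
        rw [norm_smul, Complex.norm_real, one_mul]
        exact mul_le_mul (hg h hh) (norm_annihilate_le _ _) (norm_nonneg _) hG
    _ ≤ G * (pairNorm kF k * ‖numOp P (fun n => √(n : ℝ)) φ‖) := by
        rw [← Finset.mul_sum]
        refine mul_le_mul_of_nonneg_left ?_ hG
        refine (Real.sum_mul_le_sqrt_mul_sqrt _ _ _).trans ?_
        rw [hn]
        refine mul_le_mul (by simp) ?_ (Real.sqrt_nonneg _) (Real.sqrt_nonneg _)
        refine Real.sqrt_le_iff.2 ⟨norm_nonneg _, ?_⟩
        rw [numOp, ← sum_norm_annihilate_sq, ← Finset.sum_image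
          (s := pairHoles kF k) (g := fun h => h + k) (f := fun p => ‖annihilate p φ‖ ^ 2)
          (fun a _ b _ h => by simpa using h)]
        exact Finset.sum_le_sum_of_subset_of_nonneg
          (Finset.image_subset_iff.2 fun h hh => (hk h hh).2) fun _ _ _ => sq_nonneg _
    _ = _ := by ring

lemma norm_star_pairLow_le {P : Finset Momentum} {kF : ℝ} {k : Momentum} (hk : Covers P kF k)
    {g : Momentum → ℝ} {G : ℝ} (hg : ∀ h ∈ pairHoles kF k, |g h| ≤ G) (hG : 0 ≤ G) (φ : Fock) :
    ‖star (pairLow kF k g) φ‖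
      ≤ G * pairNorm kF k * ‖numOp P (fun n => √((n : ℝ) + 3)) φ‖ := by
  have hc : 0 ≤ G * pairNorm kF k := mul_nonneg hG (norm_nonneg _)
  have h1 : ‖pairLow kF k g * numOp P (fun n => (√((n : ℝ) + 1))⁻¹)‖ ≤ G * pairNorm kF k := by
    refine ContinuousLinearMap.opNorm_le_bound _ hc fun φ => ?_
    rw [op_mul_apply]
    refine (norm_pairLow_le hk hg hG _).trans (mul_le_mul_of_nonneg_left ?_ hc)
    rw [numOp_numOp]
    refine (norm_numOp_le_const (c := 1) (fun n => ?_) φ).trans (one_mul _).le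
    rw [abs_of_nonneg (by positivity), ← div_eq_mul_inv]
    exact div_le_one_of_le₀ (Real.sqrt_le_sqrt (by linarith)) (Real.sqrt_nonneg _)
  rw [← norm_star, star_mul, ContinuousLinearMap.star_eq_adjoint (numOp P _), adjoint_numOp,
    numOp_mul_star_pairLow hk] at h1
  have h2 : φ = numOp P (fun n => (√(((n + 2 : ℕ) : ℝ) + 1))⁻¹)
      (numOp P (fun n => √((n : ℝ) + 3)) φ) := by
    rw [numOp_numOp]
    have : (fun n : ℕ => (√(((n + 2 : ℕ) : ℝ) + 1))⁻¹ * √((n : ℝ) + 3)) = fun _ => 1 := by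
      ext n
      have : ((n + 2 : ℕ) : ℝ) + 1 = (n : ℝ) + 3 := by push_cast; ring
      rw [this]
      exact inv_mul_cancel₀ (by positivity)
    rw [this, numOp, diagOp_one, one_apply_eq_self]
  calc ‖star (pairLow kF k g) φ‖
      = ‖(star (pairLow kF k g) * numOp P (fun n => (√(((n + 2 : ℕ) : ℝ) + 1))⁻¹))
          (numOp P (fun n => √((n : ℝ) + 3)) φ)‖ := by rw [op_mul_apply, ← h2]
    _ ≤ _ := ContinuousLinearMap.le_of_opNorm_le _ h1 _

/-! ### Weighted norms -/

/-- The `j`-th power of the square root of one plus the number operator. -/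
def wOp (P : Finset Momentum) (j : ℕ) : Fock →L[ℂ] Fock := numOp P fun n => √((n : ℝ) + 1) ^ j

lemma one_le_sqrt_succ (n : ℕ) : 1 ≤ √((n : ℝ) + 1) := by
  rw [Real.one_le_sqrt]; linarith [n.cast_nonneg (α := ℝ)]

lemma wOp_zero (P : Finset Momentum) : wOp P 0 = 1 := by
  simp only [wOp, pow_zero]; exact diagOp_one P

lemma norm_wOp_mono {P : Finset Momentum} {i j : ℕ} (h : i ≤ j) (φ : Fock) :
    ‖wOp P i φ‖ ≤ ‖wOp P j φ‖ := by
  refine norm_numOp_le (fun n => ?_) φ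
  rw [abs_of_nonneg (by positivity), abs_of_nonneg (by positivity)]
  exact pow_le_pow_right₀ (one_le_sqrt_succ n) h

lemma norm_wOp_pairErr_le {P : Finset Momentum} {kF : ℝ} {k l : Momentum} (hk : Covers P kF k)
    (hl : Covers P kF l) {g g' : Momentum → ℝ} {G G' : ℝ} (hg : ∀ h ∈ pairHoles kF k, |g h| ≤ G)
    (hg' : ∀ h ∈ pairHoles kF l, |g' h| ≤ G') (hG : 0 ≤ G) (hG' : 0 ≤ G') (j : ℕ) (φ : Fock) :
    ‖wOp P j (pairErr kF k l g g' φ)‖ ≤ 2 * G * G' * ‖wOp P (j + 2) φ‖ := by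
  rw [wOp, ← op_mul_apply, numOp_mul_pairErr hk hl, op_mul_apply]
  refine (norm_pairErr_le hk hl hg hg' hG hG' _).trans (le_of_eq ?_)
  rw [numOp_numOp, wOp]
  congr 4
  ext n
  rw [pow_add, Real.sq_sqrt (by positivity), mul_comm]

/-- The truncated subtraction is harmless: a pair operator annihilates the states with fewer than
two particles in `P`, and the weight is only tested where `n` is the particle number before the
annihilation. -/
lemma norm_numOp_pairLow_le {P : Finset Momentum} {kF : ℝ} {k : Momentum} (hk : Covers P kF k)
    {g : Momentum → ℝ} {G : ℝ} (hg : ∀ h ∈ pairHoles kF k, |g h| ≤ G) (hG : 0 ≤ G)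
    (f : ℕ → ℝ) (φ : Fock) :
    ‖numOp P f (pairLow kF k g φ)‖
      ≤ G * pairNorm kF k * ‖numOp P (fun n => √(n : ℝ) * f (n - 2)) φ‖ := by
  have := pairLow_mul_numOp hk g (fun n => f (n - 2))
  simp only [Nat.add_sub_cancel] at this
  rw [← op_mul_apply, ← this, op_mul_apply]
  refine (norm_pairLow_le hk hg hG _).trans (le_of_eq ?_)
  rw [numOp_numOp]

lemma norm_wOp_pairLow_le {P : Finset Momentum} {kF : ℝ} {k : Momentum} (hk : Covers P kF k)
    {g : Momentum → ℝ} {G : ℝ} (hg : ∀ h ∈ pairHoles kF k, |g h| ≤ G) (hG : 0 ≤ G) (j : ℕ)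
    (φ : Fock) :
    ‖wOp P j (pairLow kF k g φ)‖ ≤ G * pairNorm kF k * ‖wOp P (j + 1) φ‖ := by
  refine (norm_numOp_pairLow_le hk hg hG _ φ).trans
    (mul_le_mul_of_nonneg_left (norm_numOp_le (fun n => ?_) φ) (mul_nonneg hG (norm_nonneg _)))
  rw [abs_of_nonneg (by positivity), abs_of_nonneg (by positivity), pow_succ, mul_comm]
  refine mul_le_mul (pow_le_pow_left₀ (Real.sqrt_nonneg _) (Real.sqrt_le_sqrt ?_) j)
    (Real.sqrt_le_sqrt (by linarith)) (Real.sqrt_nonneg _) (by positivity)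
  have : ((n - 2 : ℕ) : ℝ) ≤ n := by exact_mod_cast Nat.sub_le n 2
  linarith

lemma norm_wOp_star_pairLow_le {P : Finset Momentum} {kF : ℝ} {k : Momentum}
    (hk : Covers P kF k) {g : Momentum → ℝ} {G : ℝ} (hg : ∀ h ∈ pairHoles kF k, |g h| ≤ G)
    (hG : 0 ≤ G) (j : ℕ) (φ : Fock) :
    ‖wOp P j (star (pairLow kF k g) φ)‖
      ≤ G * pairNorm kF k * (2 ^ (j + 1) * ‖wOp P (j + 1) φ‖) := by
  rw [wOp, ← op_mul_apply, numOp_mul_star_pairLow hk, op_mul_apply]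
  refine (norm_star_pairLow_le hk hg hG _).trans
    (mul_le_mul_of_nonneg_left ?_ (mul_nonneg hG (norm_nonneg _)))
  rw [numOp_numOp]
  have h2 : |(2 : ℝ) ^ (j + 1)| = 2 ^ (j + 1) := abs_of_nonneg (by positivity)
  rw [← h2]
  refine norm_numOp_le_mul (fun n => ?_) φ
  rw [abs_of_nonneg (by positivity), abs_of_nonneg (by positivity), ← mul_pow, pow_succ, mul_comm]
  have h3 : √((n : ℝ) + 3) ≤ 2 * √((n : ℝ) + 1) := by
    rw [Real.sqrt_le_left (by positivity), mul_pow, Real.sq_sqrt (by positivity)]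
    linarith [n.cast_nonneg (α := ℝ)]
  refine mul_le_mul (pow_le_pow_left₀ (Real.sqrt_nonneg _) ?_ j) h3 (Real.sqrt_nonneg _)
    (by positivity)
  have : ((n + 2 : ℕ) : ℝ) + 1 = (n : ℝ) + 3 := by push_cast; ring
  rwa [this]

/-! ### Unitary flows with a bounded skew-adjoint generator -/

section Flow

variable {H : Type*} [NormedAddCommGroup H] [InnerProductSpace ℂ H] [CompleteSpace H]

/-- The one-parameter group `exp (t B)`. -/
def flow (B : H →L[ℂ] H) (t : ℝ) : H →L[ℂ] H := NormedSpace.exp ((t : ℂ) • B)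

lemma flow_zero (B : H →L[ℂ] H) : flow B 0 = 1 := by simp [flow, NormedSpace.exp_zero]

lemma flow_one (B : H →L[ℂ] H) : flow B 1 = NormedSpace.exp B := by simp [flow]

lemma hasDerivAt_flow (B : H →L[ℂ] H) (t : ℝ) : HasDerivAt (flow B) (flow B t * B) t := by
  have h := (hasDerivAt_exp_smul_const (𝕂 := ℂ) B (t : ℂ)).scomp t
    (hasDerivAt_id t).ofReal_comp
  exact h.congr_deriv (by simp; rfl)

lemma hasDerivAt_flow' (B : H →L[ℂ] H) (t : ℝ) : HasDerivAt (flow B) (B * flow B t) t := by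
  have h := (hasDerivAt_exp_smul_const' (𝕂 := ℂ) B (t : ℂ)).scomp t
    (hasDerivAt_id t).ofReal_comp
  exact h.congr_deriv (by simp; rfl)

lemma star_flow {B : H →L[ℂ] H} (hB : star B = -B) (t : ℝ) : star (flow B t) = flow B (-t) := by
  rw [flow, NormedSpace.star_exp, star_smul, hB, flow]
  simp

lemma flow_neg_mul_flow (B : H →L[ℂ] H) (t : ℝ) : flow B (-t) * flow B t = 1 := by
  have h : Commute ((-t : ℂ) • B) ((t : ℂ) • B) :=
    ((Commute.refl B).smul_left _).smul_right _
  let +nondep : NormedAlgebra ℚ (H →L[ℂ] H) := .restrictScalars ℚ ℂ _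
  rw [flow, flow, Complex.ofReal_neg, ← NormedSpace.exp_add_of_commute h, ← add_smul,
    neg_add_cancel, zero_smul, NormedSpace.exp_zero]

lemma flow_mul_flow_neg (B : H →L[ℂ] H) (t : ℝ) : flow B t * flow B (-t) = 1 := by
  have := flow_neg_mul_flow B (-t)
  rwa [neg_neg] at this

lemma norm_flow_apply {B : H →L[ℂ] H} (hB : star B = -B) (t : ℝ) (v : H) :
    ‖flow B t v‖ = ‖v‖ := by
  have h : inner ℂ (flow B t v) (flow B t v) = inner ℂ v v := by
    rw [← ContinuousLinearMap.adjoint_inner_right, ← ContinuousLinearMap.star_eq_adjoint,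
      star_flow hB]
    change inner ℂ v ((flow B (-t) * flow B t) v) = _
    rw [flow_neg_mul_flow, one_apply_eq_self]
  rw [inner_self_eq_norm_sq_to_K, inner_self_eq_norm_sq_to_K] at h
  have h2 : ‖flow B t v‖ ^ 2 = ‖v‖ ^ 2 := by exact_mod_cast h
  exact (pow_left_inj₀ (norm_nonneg _) (norm_nonneg _) two_ne_zero).1 h2

/-- Heisenberg's equation of motion. -/
lemma hasDerivAt_heisenberg (B O : H →L[ℂ] H) (v : H) (t : ℝ) :
    HasDerivAt (fun s => flow B (-s) (O (flow B s v)))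
      (flow B (-t) ((O * B - B * O) (flow B t v))) t := by
  have h1 : HasDerivAt (fun s : ℝ => flow B (-s)) (-(flow B (-t) * B)) t := by
    have := (hasDerivAt_flow B (-t)).scomp t (hasDerivAt_neg t)
    exact this.congr_deriv (neg_one_smul ℝ _)
  have h2 : HasDerivAt (fun s => flow B (-s) * (O * flow B s))
      (-(flow B (-t) * B) * (O * flow B t) + flow B (-t) * (O * (B * flow B t))) t :=
    h1.mul ((hasDerivAt_flow' B t).const_mul O)
  have h3 := (ContinuousLinearMap.apply ℂ H v).restrictScalars ℝ |>.hasFDerivAt.comp_hasDerivAt t h2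
  refine h3.congr_deriv ?_
  change (-(flow B (-t) * B) * (O * flow B t) + flow B (-t) * (O * (B * flow B t))) v
    = (flow B (-t) * ((O * B - B * O) * flow B t)) v
  congr 1
  noncomm_ring

/-- If the commutator with the generator is bounded relative to `O`, then `‖O ψ_t‖` grows at most
exponentially. -/
lemma norm_flow_le_of_comm_le {B O : H →L[ℂ] H} (hB : star B = -B) {v : H} {C : ℝ}
    (hC : 0 ≤ C)
    (h : ∀ φ, ‖(O * B - B * O) φ‖ ≤ C * ‖O φ‖) {t : ℝ} (ht0 : 0 ≤ t) (ht1 : t ≤ 1) :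
    ‖O (flow B t v)‖ ≤ ‖O v‖ * Real.exp C := by
  have key := norm_le_gronwallBound_of_norm_deriv_right_le
    (f := fun s => flow B (-s) (O (flow B s v)))
    (f' := fun s => flow B (-s) ((O * B - B * O) (flow B s v)))
    (δ := ‖O v‖) (K := C) (ε := 0) (a := 0) (b := 1)
    (fun s _ => (hasDerivAt_heisenberg B O v s).continuousAt.continuousWithinAt)
    (fun s _ => (hasDerivAt_heisenberg B O v s).hasDerivWithinAt)
    (by simp [flow_zero])
    (fun s _ => by
      rw [norm_flow_apply hB, norm_flow_apply hB, add_zero]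
      exact h _) t ⟨ht0, ht1⟩
  rw [norm_flow_apply hB, gronwallBound_ε0, sub_zero] at key
  refine key.trans (mul_le_mul_of_nonneg_left (Real.exp_le_exp.2 ?_) (norm_nonneg _))
  nlinarith

/-- Duhamel's principle: if `[O, B] ψ_t` equals `μ O ψ_t` up to an error `r`, then `O ψ_t` is
`exp (μ t)` times the transported vector `O v`, up to an error of order `r`. -/
lemma norm_flow_sub_le {B O : H →L[ℂ] H} (hB : star B = -B) {v : H} {μ r m : ℝ} (hμ : |μ| ≤ m)
    (h : ∀ s, 0 ≤ s → s ≤ 1 → ‖(O * B - B * O - (μ : ℂ) • O) (flow B s v)‖ ≤ r)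
    {t : ℝ} (ht0 : 0 ≤ t) (ht1 : t ≤ 1) :
    ‖O (flow B t v) - (Real.exp (t * μ) : ℂ) • flow B t (O v)‖ ≤ Real.exp (2 * m) * r := by
  have hr : 0 ≤ r := (norm_nonneg _).trans (h 0 le_rfl zero_le_one)
  have hm : 0 ≤ m := (abs_nonneg _).trans hμ
  have hexp : ∀ s : ℝ, HasDerivAt (fun s : ℝ => Real.exp (-(s * μ)))
      (-μ * Real.exp (-(s * μ))) s := by
    intro s
    have := (((hasDerivAt_id s).mul_const μ).neg).exp
    refine this.congr_deriv ?_
    simp; ring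
  have hd : ∀ s : ℝ, HasDerivAt
      (fun s => Real.exp (-(s * μ)) • flow B (-s) (O (flow B s v)))
      (Real.exp (-(s * μ)) • flow B (-s) ((O * B - B * O - (μ : ℂ) • O) (flow B s v))) s := by
    intro s
    refine ((hexp s).smul (hasDerivAt_heisenberg B O v s)).congr_deriv ?_
    have : (O * B - B * O - (μ : ℂ) • O) (flow B s v)
        = (O * B - B * O) (flow B s v) - (μ : ℂ) • O (flow B s v) := rfl
    rw [this, map_sub, map_smul, smul_sub, Complex.coe_smul, smul_smul, neg_mul, neg_smul,
      mul_comm μ]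
    abel
  have hbd : ∀ s : ℝ, 0 ≤ s → s ≤ 1 → ∀ c : ℝ, |c| ≤ m → Real.exp (s * c) ≤ Real.exp m := by
    intro s hs0 hs1 c hc
    refine Real.exp_le_exp.2 ?_
    have := (le_abs_self c).trans hc
    nlinarith
  have key := norm_image_sub_le_of_norm_deriv_le_segment_01' (C := Real.exp m * r)
    (f := fun s => Real.exp (-(s * t * μ)) • flow B (-(s * t)) (O (flow B (s * t) v)))
    (f' := fun s => t • (Real.exp (-(s * t * μ)) • flow B (-(s * t))
      ((O * B - B * O - (μ : ℂ) • O) (flow B (s * t) v))))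
    (fun s _ => by
      have h1 : HasDerivAt (fun s : ℝ => s * t) t s := by
        simpa using (hasDerivAt_id s).mul_const t
      exact ((hd (s * t)).scomp s h1).hasDerivWithinAt)
    (fun s hs => by
      have hs0 : 0 ≤ s * t := mul_nonneg hs.1 ht0
      have hs1 : s * t ≤ 1 := mul_le_one₀ hs.2.le ht0 ht1
      rw [norm_smul, norm_smul, norm_flow_apply hB, Real.norm_of_nonneg ht0,
        Real.norm_of_nonneg (Real.exp_pos _).le]
      have e1 := hbd (s * t) hs0 hs1 (-μ) (by rwa [abs_neg])
      rw [mul_neg] at e1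
      calc t * _ ≤ 1 * (Real.exp m * r) :=
            mul_le_mul ht1 (mul_le_mul e1 (h _ hs0 hs1) (norm_nonneg _) (Real.exp_pos _).le)
              (by positivity) zero_le_one
        _ = _ := one_mul _)
  simp only [one_mul, zero_mul, neg_zero, Real.exp_zero, one_smul, flow_zero,
    one_apply_eq_self] at key
  have e2 : O (flow B t v) - (Real.exp (t * μ) : ℂ) • flow B t (O v)
      = (Real.exp (t * μ) : ℂ) • flow B t
        (Real.exp (-(t * μ)) • flow B (-t) (O (flow B t v)) - O v) := by
    have e3 : flow B t (flow B (-t) (O (flow B t v))) = O (flow B t v) := by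
      change (flow B t * flow B (-t)) (O (flow B t v)) = _
      rw [flow_mul_flow_neg, one_apply_eq_self]
    rw [map_sub, smul_sub, ← Complex.coe_smul, map_smul, e3, smul_smul, ← Complex.ofReal_mul,
      ← Real.exp_add, add_neg_cancel, Real.exp_zero, Complex.ofReal_one, one_smul]
  rw [e2, norm_smul, norm_flow_apply hB, Complex.norm_real, Real.norm_of_nonneg (Real.exp_pos _).le]
  calc _ ≤ Real.exp m * (Real.exp m * r) :=
        mul_le_mul (hbd t ht0 ht1 μ hμ) key (norm_nonneg _) (Real.exp_pos _).le
    _ = _ := by rw [← mul_assoc, ← Real.exp_add, two_mul]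

lemma flow_commute {B O : H →L[ℂ] H} (h : Commute O B) (t : ℝ) (v : H) :
    O (flow B t v) = flow B t (O v) := by
  have h1 : Commute O (flow B t) := by
    let +nondep : NormedAlgebra ℚ (H →L[ℂ] H) := .restrictScalars ℚ ℂ _
    exact (h.smul_right (t : ℂ)).exp_right
  exact congrArg (fun T : H →L[ℂ] H => T v) h1.eq

end Flow

/-! ### The Bogoliubov generator -/

/-- The normalized pair annihilation operator `b_k`. -/
def bLow (kF : ℝ) (k : Momentum) : Fock →L[ℂ] Fock :=
  pairLow kF k fun _ => (pairNorm kF k)⁻¹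

lemma star_bLow (kF : ℝ) (k : Momentum) : star (bLow kF k) = pairCreate kF k := by
  rw [bLow, star_pairLow, pairCreate, pairCreateRaw, Finset.smul_sum]
  simp

lemma abs_inv_pairNorm (kF : ℝ) (k : Momentum) : |(pairNorm kF k)⁻¹| = (pairNorm kF k)⁻¹ :=
  abs_of_nonneg (inv_nonneg.2 (norm_nonneg _))

lemma inv_pairNorm_mul_le (kF : ℝ) (k : Momentum) : (pairNorm kF k)⁻¹ * pairNorm kF k ≤ 1 :=
  inv_mul_le_one

lemma norm_wOp_bLow_le {P : Finset Momentum} {kF : ℝ} {k : Momentum} (hk : Covers P kF k)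
    (j : ℕ) (φ : Fock) : ‖wOp P j (bLow kF k φ)‖ ≤ ‖wOp P (j + 1) φ‖ :=
  (norm_wOp_pairLow_le hk (fun _ _ => (abs_inv_pairNorm kF k).le)
    (inv_nonneg.2 (norm_nonneg _)) j φ).trans
    (mul_le_of_le_one_left (norm_nonneg _) (inv_pairNorm_mul_le kF k))

lemma norm_wOp_star_bLow_le {P : Finset Momentum} {kF : ℝ} {k : Momentum} (hk : Covers P kF k)
    (j : ℕ) (φ : Fock) :
    ‖wOp P j (star (bLow kF k) φ)‖ ≤ 2 ^ (j + 1) * ‖wOp P (j + 1) φ‖ :=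
  (norm_wOp_star_pairLow_le hk (fun _ _ => (abs_inv_pairNorm kF k).le)
    (inv_nonneg.2 (norm_nonneg _)) j φ).trans
    (mul_le_of_le_one_left (by positivity) (inv_pairNorm_mul_le kF k))

lemma norm_bLow_le {P : Finset Momentum} {kF : ℝ} {k : Momentum} (hk : Covers P kF k)
    (φ : Fock) : ‖bLow kF k φ‖ ≤ ‖wOp P 1 φ‖ := by
  simpa [wOp_zero] using norm_wOp_bLow_le hk 0 φ

lemma norm_star_bLow_le {P : Finset Momentum} {kF : ℝ} {k : Momentum} (hk : Covers P kF k)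
    (φ : Fock) : ‖star (bLow kF k) φ‖ ≤ 2 * ‖wOp P 1 φ‖ := by
  simpa [wOp_zero] using norm_wOp_star_bLow_le hk 0 φ

/-- `½ ∑_{k ∈ S} ξ(k) b*_k b*_{-k}`, for a real kernel `ξ` supported in the finite set `S`. -/
def creationPart (kF : ℝ) (S : Finset Momentum) (ξ : Momentum → ℝ) : Fock →L[ℂ] Fock :=
  (1 / 2 : ℂ) • ∑ k ∈ S, (ξ k : ℂ) • (star (bLow kF k) * star (bLow kF (-k)))

/-- The skew-adjoint generator of the Bogoliubov transformation. -/
def gen (kF : ℝ) (S : Finset Momentum) (ξ : Momentum → ℝ) : Fock →L[ℂ] Fock :=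
  creationPart kF S ξ - star (creationPart kF S ξ)

lemma star_gen (kF : ℝ) (S : Finset Momentum) (ξ : Momentum → ℝ) :
    star (gen kF S ξ) = - gen kF S ξ := by
  rw [gen, star_sub, star_star, neg_sub]

lemma star_creationPart (kF : ℝ) (S : Finset Momentum) (ξ : Momentum → ℝ) :
    star (creationPart kF S ξ)
      = (1 / 2 : ℂ) • ∑ k ∈ S, (ξ k : ℂ) • (bLow kF (-k) * bLow kF k) := by
  rw [creationPart, star_smul, star_sum]
  congr 1
  · simp
  · refine Finset.sum_congr rfl fun k _ => ?_
    rw [star_smul, star_mul, star_star, star_star]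
    simp

/-- The data of a Bogoliubov kernel: the even real kernel `ξ` lives on the finite symmetric set `S`
of momenta and has `ℓ¹` norm at most `X`, the pairs with momenta in `S` use only modes in `P`, and
`n_k⁻¹ ≤ ν` on `S`. -/
structure BogData (kF : ℝ) (S P : Finset Momentum) (ξ : Momentum → ℝ) (X ν : ℝ) : Prop where
  neg_mem : ∀ k ∈ S, -k ∈ S
  even : ∀ k, ξ (-k) = ξ k
  covers : ∀ k ∈ S, Covers P kF k
  sum_le : ∑ k ∈ S, |ξ k| ≤ X
  pos : ∀ k ∈ S, 0 < pairNorm kF k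
  inv_le : ∀ k ∈ S, (pairNorm kF k)⁻¹ ≤ ν

lemma sqrt_succ_pow_four (n : ℕ) : √((n : ℝ) + 1) ^ 4 = ((n : ℝ) + 1) ^ 2 := by
  rw [show (4 : ℕ) = 2 * 2 from rfl, pow_mul, Real.sq_sqrt (by positivity)]

lemma wOp_vacuum (j : ℕ) : wOp P j vacuum = vacuum := by
  rw [wOp, numOp, diagOp_vacuum]
  simp

lemma norm_vacuum : ‖vacuum‖ = 1 := by
  rw [vacuum, lp.norm_single (by norm_num)]; simp

/-- The error in the bosonic commutator of a pair operator with the generator. -/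
def genErr (kF : ℝ) (S : Finset Momentum) (ξ : Momentum → ℝ) (k : Momentum)
    (g : Momentum → ℝ) : Fock →L[ℂ] Fock :=
  (1 / 2 : ℂ) • ∑ l ∈ S, (ξ l : ℂ) •
    (pairErr kF k l g (fun _ => (pairNorm kF l)⁻¹) * star (bLow kF (-l))
      + star (bLow kF l) * pairErr kF k (-l) g (fun _ => (pairNorm kF (-l))⁻¹))

lemma star_pairErr (kF : ℝ) (k l : Momentum) (g g' : Momentum → ℝ) :
    star (pairErr kF k l g g') = pairErr kF l k g' g := by
  have h1 := congrArg star (pairLow_mul_star_pairLow kF k l g g')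
  have h2 := pairLow_mul_star_pairLow kF l k g' g
  rw [star_mul, star_star, h2, star_add, star_mul, star_star, star_sub, star_smul, star_one] at h1
  have h3 := add_left_cancel h1
  have h4 : star (if k = l then ((∑ h ∈ pairHoles kF k, g h * g' h : ℝ) : ℂ) else 0)
      = if l = k then ((∑ h ∈ pairHoles kF l, g' h * g h : ℝ) : ℂ) else 0 := by
    by_cases hkl : k = l
    · subst hkl
      simp [mul_comm]
    · simp [hkl, Ne.symm hkl]
  rw [h4] at h3
  exact (sub_right_inj.1 h3).symm

namespace BogData

variable {kF : ℝ} {S P : Finset Momentum} {ξ : Momentum → ℝ} {X ν : ℝ}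

lemma X_nonneg (h : BogData kF S P ξ X ν) : 0 ≤ X :=
  (Finset.sum_nonneg fun _ _ => abs_nonneg _).trans h.sum_le

lemma abs_le (h : BogData kF S P ξ X ν) {k : Momentum} (hk : k ∈ S) : |ξ k| ≤ X :=
  (Finset.single_le_sum (f := fun k => |ξ k|) (fun _ _ => abs_nonneg _) hk).trans h.sum_le

lemma norm_half_sum_le (h : BogData kF S P ξ X ν) (F : Momentum → Fock →L[ℂ] Fock) (φ : Fock)
    {c : ℝ} (hc : 0 ≤ c) (hF : ∀ k ∈ S, ‖F k φ‖ ≤ c) :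
    ‖((1 / 2 : ℂ) • ∑ k ∈ S, (ξ k : ℂ) • F k) φ‖ ≤ 1 / 2 * (X * c) := by
  rw [smul_apply, sum_apply, norm_smul]
  have e : ‖(1 / 2 : ℂ)‖ = 1 / 2 := by simp
  rw [e]
  refine mul_le_mul_of_nonneg_left ?_ (by norm_num)
  calc ‖∑ k ∈ S, ((ξ k : ℂ) • F k) φ‖ ≤ ∑ k ∈ S, |ξ k| * c := by
        refine norm_sum_le_of_le _ fun k hk => ?_
        rw [smul_apply, norm_smul, Complex.norm_real]
        exact mul_le_mul_of_nonneg_left (hF k hk) (norm_nonneg _)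
    _ ≤ X * c := by
        rw [← Finset.sum_mul]; exact mul_le_mul_of_nonneg_right h.sum_le hc

lemma norm_creationPart_le (h : BogData kF S P ξ X ν) (φ : Fock) :
    ‖creationPart kF S ξ φ‖ ≤ 4 * X * ‖wOp P 2 φ‖ := by
  refine (h.norm_half_sum_le _ φ (c := 8 * ‖wOp P 2 φ‖) (by positivity) fun k hk => ?_).trans
    (le_of_eq (by ring))
  rw [op_mul_apply]
  refine (norm_star_bLow_le (h.covers k hk) _).trans ?_
  have := norm_wOp_star_bLow_le (h.covers _ (h.neg_mem k hk)) 1 φ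
  norm_num at this ⊢
  linarith

lemma norm_star_creationPart_le (h : BogData kF S P ξ X ν) (φ : Fock) :
    ‖star (creationPart kF S ξ) φ‖ ≤ 1 / 2 * X * ‖wOp P 2 φ‖ := by
  rw [star_creationPart]
  refine (h.norm_half_sum_le _ φ (c := ‖wOp P 2 φ‖) (by positivity) fun k hk => ?_).trans
    (le_of_eq (by ring))
  rw [op_mul_apply]
  exact (norm_bLow_le (h.covers _ (h.neg_mem k hk)) _).trans
    (norm_wOp_bLow_le (h.covers k hk) 1 φ)

lemma numOp_mul_creationPart (h : BogData kF S P ξ X ν) (f : ℕ → ℝ) :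
    numOp P f * creationPart kF S ξ = creationPart kF S ξ * numOp P (fun n => f (n + 4)) := by
  rw [creationPart, mul_smul_comm, smul_mul_assoc, Finset.mul_sum, Finset.sum_mul]
  congr 1
  refine Finset.sum_congr rfl fun k hk => ?_
  rw [mul_smul_comm, smul_mul_assoc, ← mul_assoc, bLow, numOp_mul_star_pairLow (h.covers k hk),
    mul_assoc, bLow, numOp_mul_star_pairLow (h.covers _ (h.neg_mem k hk)), ← mul_assoc]

lemma star_creationPart_mul_numOp (h : BogData kF S P ξ X ν) (f : ℕ → ℝ) :
    star (creationPart kF S ξ) * numOp P f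
      = numOp P (fun n => f (n + 4)) * star (creationPart kF S ξ) := by
  have h1 := congrArg star (h.numOp_mul_creationPart f)
  have e : ∀ f, star (numOp P f) = numOp P f := adjoint_numOp P
  rw [star_mul, star_mul, e, e] at h1
  exact h1

/-- The commutator of the squared number operator with the generator is of the same order as the
squared number operator. -/
lemma norm_comm_wOp_gen_le (h : BogData kF S P ξ X ν) (φ : Fock) :
    ‖(wOp P 4 * gen kF S ξ - gen kF S ξ * wOp P 4) φ‖ ≤ 108 * X * ‖wOp P 4 φ‖ := by
  set w : ℕ → ℝ := fun n => √((n : ℝ) + 1) ^ 4 with hw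
  set A := creationPart kF S ξ with hA
  -- `A` raises the particle number by four; the weight is moved to the right of `A` and of `star A`
  -- (truncated subtraction: `star A` only sees states with at least four particles)
  have e1 : wOp P 4 * gen kF S ξ - gen kF S ξ * wOp P 4
      = A * numOp P (fun n => w (n + 4) - w n)
        + star A * numOp P (fun n => w (n - 4 + 4) - w (n - 4)) := by
    have h1 : wOp P 4 = numOp P w := rfl
    have h2 := h.numOp_mul_creationPart w
    have h3 := h.star_creationPart_mul_numOp w
    have h4 := h.star_creationPart_mul_numOp (fun n => w (n - 4 + 4) - w (n - 4))
    simp only [Nat.add_sub_cancel] at h4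
    rw [h1, h4, ← numOp_sub, gen, mul_sub, sub_mul, h2, h3, mul_sub, sub_mul]
    abel
  have hX := h.X_nonneg
  have e2 : ‖A (numOp P (fun n => w (n + 4) - w n) φ)‖ ≤ 4 * X * (24 * ‖wOp P 4 φ‖) := by
    refine (h.norm_creationPart_le _).trans (mul_le_mul_of_nonneg_left ?_ (by positivity))
    rw [wOp, numOp_numOp]
    refine (norm_numOp_le_mul (g := w) (c := 24) (fun n => ?_) φ).trans (by
      rw [abs_of_pos (by norm_num : (0 : ℝ) < 24)]; rfl)
    have hn : (0 : ℝ) ≤ n := n.cast_nonneg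
    simp only [hw]
    rw [sqrt_succ_pow_four, sqrt_succ_pow_four, Real.sq_sqrt (by positivity)]
    push_cast
    rw [abs_of_nonneg (by nlinarith), abs_of_nonneg (by positivity)]
    nlinarith
  have e3 : ‖star A (numOp P (fun n => w (n - 4 + 4) - w (n - 4)) φ)‖
      ≤ 1 / 2 * X * (24 * ‖wOp P 4 φ‖) := by
    refine (h.norm_star_creationPart_le _).trans (mul_le_mul_of_nonneg_left ?_ (by positivity))
    rw [wOp, numOp_numOp]
    refine (norm_numOp_le_mul (g := w) (c := 24) (fun n => ?_) φ).trans (by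
      rw [abs_of_pos (by norm_num : (0 : ℝ) < 24)]; rfl)
    simp only [hw]
    rw [sqrt_succ_pow_four, sqrt_succ_pow_four, sqrt_succ_pow_four, Real.sq_sqrt (by positivity)]
    rcases le_total 4 n with hn | hn
    · obtain ⟨m, rfl⟩ := Nat.exists_eq_add_of_le' hn
      rw [Nat.add_sub_cancel]
      have hm : (0 : ℝ) ≤ m := m.cast_nonneg
      push_cast
      rw [abs_of_nonneg (by nlinarith), abs_of_nonneg (by positivity)]
      nlinarith
    · rw [Nat.sub_eq_zero_of_le hn]
      interval_cases n <;> norm_num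
  rw [e1, add_apply, op_mul_apply, op_mul_apply]
  refine (norm_add_le _ _).trans ((add_le_add e2 e3).trans (le_of_eq (by ring)))

/-- The moments of the number operator in the interpolating trial states are bounded
uniformly in the Fermi momentum. -/
lemma norm_wOp_flow_le (h : BogData kF S P ξ X ν) {j : ℕ} (hj : j ≤ 4) {t : ℝ} (ht0 : 0 ≤ t)
    (ht1 : t ≤ 1) : ‖wOp P j (flow (gen kF S ξ) t vacuum)‖ ≤ Real.exp (108 * X) := by
  refine (norm_wOp_mono hj _).trans ?_
  have h1 := norm_flow_le_of_comm_le (star_gen kF S ξ) (v := vacuum) (O := wOp P 4)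
    (mul_nonneg (by norm_num) h.X_nonneg) h.norm_comm_wOp_gen_le ht0 ht1
  rwa [wOp_vacuum, norm_vacuum, one_mul] at h1

/-! ### Commutators of pair operators with the generator -/

lemma pairLow_comm_gen (h : BogData kF S P ξ X ν) {k : Momentum} (hk : k ∈ S)
    (g : Momentum → ℝ) :
    pairLow kF k g * gen kF S ξ - gen kF S ξ * pairLow kF k g
      = ((ξ k * ((∑ h ∈ pairHoles kF k, g h) * (pairNorm kF k)⁻¹) : ℝ) : ℂ)
          • star (bLow kF (-k)) - genErr kF S ξ k g := by
  set O := pairLow kF k g with hO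
  set κ : ℝ := (∑ h ∈ pairHoles kF k, g h) * (pairNorm kF k)⁻¹ with hκ
  have hcr : ∀ l, O * star (bLow kF l) = star (bLow kF l) * O
      + ((if k = l then (κ : ℂ) else 0) • 1
        - pairErr kF k l g (fun _ => (pairNorm kF l)⁻¹)) := by
    intro l
    rw [hO, bLow, pairLow_mul_star_pairLow]
    congr 3
    split_ifs with hkl
    · subst hkl; rw [hκ, Finset.sum_mul]
    · rfl
  have hstar : O * star (creationPart kF S ξ) = star (creationPart kF S ξ) * O := by
    rw [star_creationPart, mul_smul_comm, smul_mul_assoc, Finset.mul_sum, Finset.sum_mul]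
    congr 1
    refine Finset.sum_congr rfl fun l _ => ?_
    rw [mul_smul_comm, smul_mul_assoc, ← mul_assoc, hO, bLow, bLow, pairLow_comm, mul_assoc,
      pairLow_comm kF k, mul_assoc]
  have hmain : O * creationPart kF S ξ = creationPart kF S ξ * O
      + (((ξ k * κ : ℝ) : ℂ) • star (bLow kF (-k)) - genErr kF S ξ k g) := by
    have hterm : ∀ l ∈ S, O * ((ξ l : ℂ) • (star (bLow kF l) * star (bLow kF (-l))))
        = (ξ l : ℂ) • (star (bLow kF l) * star (bLow kF (-l))) * O
          + (((if k = l then ((ξ k * κ : ℝ) : ℂ) • star (bLow kF (-k)) else 0)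
            + (if -k = l then ((ξ k * κ : ℝ) : ℂ) • star (bLow kF (-k)) else 0))
            - (ξ l : ℂ) • (pairErr kF k l g (fun _ => (pairNorm kF l)⁻¹) * star (bLow kF (-l))
      + star (bLow kF l) * pairErr kF k (-l) g (fun _ => (pairNorm kF (-l))⁻¹))) := by
      intro l _
      have e1 : (ξ l : ℂ) • (((if k = l then (κ : ℂ) else 0) • (1 : Fock →L[ℂ] Fock))
          * star (bLow kF (-l)))
          = if k = l then ((ξ k * κ : ℝ) : ℂ) • star (bLow kF (-k)) else 0 := by
        split_ifs with hkl
        · subst hkl; rw [smul_mul_assoc, one_mul, smul_smul]; push_cast; rfl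
        · simp
      have e2 : (ξ l : ℂ) • (star (bLow kF l)
          * ((if k = -l then (κ : ℂ) else 0) • (1 : Fock →L[ℂ] Fock)))
          = if -k = l then ((ξ k * κ : ℝ) : ℂ) • star (bLow kF (-k)) else 0 := by
        have hiff : k = -l ↔ -k = l := by rw [eq_comm, neg_eq_iff_eq_neg, eq_comm]
        simp only [hiff]
        split_ifs with hkl
        · subst hkl; rw [h.even, mul_smul_comm, mul_one, smul_smul]; push_cast; rfl
        · simp
      rw [← e1, ← e2, mul_smul_comm, ← mul_assoc, hcr l, add_mul, mul_assoc, hcr (-l), sub_mul,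
        mul_add, mul_sub]
      simp only [smul_add, smul_sub, smul_mul_assoc, mul_assoc]
      abel
    rw [genErr, creationPart, mul_smul_comm, Finset.mul_sum, Finset.sum_congr rfl hterm,
      Finset.sum_add_distrib, Finset.sum_sub_distrib, Finset.sum_add_distrib, smul_add, smul_sub,
      smul_mul_assoc, Finset.sum_mul]
    congr 2
    rw [Finset.sum_ite_eq, Finset.sum_ite_eq, if_pos hk, if_pos (h.neg_mem k hk), ← two_smul ℂ,
      smul_smul]
    norm_num
  rw [gen, mul_sub, sub_mul, hmain, hstar]
  abel

lemma norm_genErr_le (h : BogData kF S P ξ X ν) {k : Momentum} (hk : k ∈ S)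
    {g : Momentum → ℝ} {G : ℝ} (hg : ∀ h ∈ pairHoles kF k, |g h| ≤ G) (hG : 0 ≤ G) (φ : Fock) :
    ‖genErr kF S ξ k g φ‖ ≤ 10 * (G * ν) * X * ‖wOp P 3 φ‖ := by
  have hle : ∀ l ∈ S, 2 * G * (pairNorm kF l)⁻¹ ≤ 2 * G * ν := fun l hl =>
    mul_le_mul_of_nonneg_left (h.inv_le l hl) (by positivity)
  have hν : 0 ≤ ν := (inv_nonneg.2 (norm_nonneg _)).trans (h.inv_le k hk)
  have hE : ∀ l ∈ S, ∀ (j : ℕ) (φ : Fock),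
      ‖wOp P j (pairErr kF k l g (fun _ => (pairNorm kF l)⁻¹) φ)‖
        ≤ 2 * G * ν * ‖wOp P (j + 2) φ‖ := fun l hl j φ =>
    (norm_wOp_pairErr_le (h.covers k hk) (h.covers l hl) hg
      (fun _ _ => (abs_inv_pairNorm kF l).le) hG (inv_nonneg.2 (norm_nonneg _)) j φ).trans
      (mul_le_mul_of_nonneg_right (hle l hl) (norm_nonneg _))
  refine (h.norm_half_sum_le _ φ (c := 20 * (G * ν) * ‖wOp P 3 φ‖) (by positivity)
    fun l hl => ?_).trans (le_of_eq (by ring))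
  have hl' := h.neg_mem l hl
  rw [add_apply, op_mul_apply, op_mul_apply]
  -- `E b*` costs a factor `8` for moving the weight past `b*`, and `b* E` a factor `2`
  have e1 : ‖pairErr kF k l g (fun _ => (pairNorm kF l)⁻¹) (star (bLow kF (-l)) φ)‖
      ≤ 2 * G * ν * (2 ^ 3 * ‖wOp P 3 φ‖) := by
    have := hE l hl 0 (star (bLow kF (-l)) φ)
    rw [wOp_zero, one_apply_eq_self] at this
    exact this.trans (mul_le_mul_of_nonneg_left (norm_wOp_star_bLow_le (h.covers _ hl') 2 φ)
      (by positivity))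
  have e2 : ‖star (bLow kF l) (pairErr kF k (-l) g (fun _ => (pairNorm kF (-l))⁻¹) φ)‖
      ≤ 2 * (2 * G * ν * ‖wOp P 3 φ‖) :=
    (norm_star_bLow_le (h.covers l hl) _).trans
      (mul_le_mul_of_nonneg_left (hE (-l) hl' 1 φ) (by norm_num))
  refine (norm_add_le _ _).trans ((add_le_add e1 e2).trans (le_of_eq (by ring)))

lemma norm_star_genErr_le (h : BogData kF S P ξ X ν) {k : Momentum} (hk : k ∈ S) (φ : Fock) :
    ‖star (genErr kF S ξ k (fun _ => (pairNorm kF k)⁻¹)) φ‖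
      ≤ 10 * (ν * ν) * X * ‖wOp P 3 φ‖ := by
  have hν : 0 ≤ ν := (inv_nonneg.2 (norm_nonneg _)).trans (h.inv_le k hk)
  have hX := h.X_nonneg
  have e : star (genErr kF S ξ k (fun _ => (pairNorm kF k)⁻¹))
      = (1 / 2 : ℂ) • ∑ l ∈ S, (ξ l : ℂ) •
        (bLow kF (-l) * pairErr kF l k (fun _ => (pairNorm kF l)⁻¹) (fun _ => (pairNorm kF k)⁻¹)
          + pairErr kF (-l) k (fun _ => (pairNorm kF (-l))⁻¹) (fun _ => (pairNorm kF k)⁻¹)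
            * bLow kF l) := by
    rw [genErr, star_smul, star_sum]
    congr 1
    · simp
    · refine Finset.sum_congr rfl fun l _ => ?_
      rw [star_smul, star_add, star_mul, star_mul, star_star, star_star, star_pairErr,
        star_pairErr]
      simp
  have hE : ∀ l ∈ S, ∀ (j : ℕ) (φ : Fock),
      ‖wOp P j (pairErr kF l k (fun _ => (pairNorm kF l)⁻¹) (fun _ => (pairNorm kF k)⁻¹) φ)‖
        ≤ 2 * ν * ν * ‖wOp P (j + 2) φ‖ := fun l hl j φ =>
    (norm_wOp_pairErr_le (h.covers l hl) (h.covers k hk)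
      (fun _ _ => (abs_inv_pairNorm kF l).le.trans (h.inv_le l hl))
      (fun _ _ => (abs_inv_pairNorm kF k).le.trans (h.inv_le k hk)) hν hν j φ)
  rw [e]
  refine (h.norm_half_sum_le _ φ (c := 4 * (ν * ν) * ‖wOp P 3 φ‖) (by positivity)
    fun l hl => ?_).trans ?_
  · have hl' := h.neg_mem l hl
    rw [add_apply, op_mul_apply, op_mul_apply]
    have e1 := (norm_bLow_le (h.covers _ hl') _).trans (hE l hl 1 φ)
    have e2 := hE (-l) hl' 0 (bLow kF l φ)
    rw [wOp_zero, one_apply_eq_self] at e2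
    have e3 := e2.trans (mul_le_mul_of_nonneg_left (norm_wOp_bLow_le (h.covers l hl) 2 φ)
      (by positivity))
    refine (norm_add_le _ _).trans ((add_le_add e1 e3).trans (le_of_eq (by ring)))
  · have : 0 ≤ ν * ν * X * ‖wOp P 3 φ‖ := by positivity
    nlinarith

end BogData

/-- The size of the error made by treating the pair operators as bosons. -/
def dynErr (X ν : ℝ) : ℝ := Real.exp (2 * X) * (20 * (ν * ν) * X * Real.exp (108 * X))

lemma abs_re_inner_sub_le {x y τ : Fock} {a b K δ : ℝ} (hτ : ‖τ‖ = 1)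
    (hx : ‖x - (a : ℂ) • τ‖ ≤ δ) (hy : ‖y - (b : ℂ) • τ‖ ≤ δ) (hxK : ‖x‖ ≤ 2 * K)
    (hb : |b| ≤ K) : |(inner ℂ x y).re - a * b| ≤ 3 * K * δ := by
  have hδ : 0 ≤ δ := (norm_nonneg _).trans hx
  have hK : 0 ≤ K := (abs_nonneg _).trans hb
  have e1 : inner ℂ x y - ((a * b : ℝ) : ℂ)
      = inner ℂ x (y - (b : ℂ) • τ) + inner ℂ (x - (a : ℂ) • τ) ((b : ℂ) • τ) := by
    rw [inner_sub_right, inner_sub_left, inner_smul_left, inner_smul_right, inner_smul_right,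
      inner_self_eq_norm_sq_to_K, hτ, Complex.conj_ofReal]
    push_cast
    ring
  have e2 : (inner ℂ x y).re - a * b = (inner ℂ x y - ((a * b : ℝ) : ℂ)).re := by
    rw [Complex.sub_re, Complex.ofReal_re]
  rw [e2]
  refine (Complex.abs_re_le_norm _).trans ?_
  rw [e1]
  refine (norm_add_le _ _).trans ?_
  have b1 : ‖inner ℂ x (y - (b : ℂ) • τ)‖ ≤ 2 * K * δ :=
    (norm_inner_le_norm _ _).trans (mul_le_mul hxK hy (norm_nonneg _) (by positivity))
  have b2 : ‖inner ℂ (x - (a : ℂ) • τ) ((b : ℂ) • τ)‖ ≤ δ * K := by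
    refine (norm_inner_le_norm _ _).trans (mul_le_mul hx ?_ (norm_nonneg _) hδ)
    rw [norm_smul, hτ, mul_one, Complex.norm_real]
    exact hb
  linarith

namespace BogData

variable {kF : ℝ} {S P : Finset Momentum} {ξ : Momentum → ℝ} {X ν : ℝ}

/-! ### The pair operators on the trial state -/

lemma bLow_comm_gen (h : BogData kF S P ξ X ν) {k : Momentum} (hk : k ∈ S) :
    bLow kF k * gen kF S ξ - gen kF S ξ * bLow kF k
      = (ξ k : ℂ) • star (bLow kF (-k)) - genErr kF S ξ k (fun _ => (pairNorm kF k)⁻¹) := by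
  have h1 := h.pairLow_comm_gen hk (fun _ => (pairNorm kF k)⁻¹)
  have hn := (h.pos k hk).ne'
  rw [Finset.sum_const, nsmul_eq_mul, ← pairNorm_sq,
    show ξ k * (pairNorm kF k ^ 2 * (pairNorm kF k)⁻¹ * (pairNorm kF k)⁻¹) = ξ k by
      field_simp] at h1
  exact h1

lemma star_bLow_comm_gen (h : BogData kF S P ξ X ν) {k : Momentum} (hk : k ∈ S) :
    star (bLow kF (-k)) * gen kF S ξ - gen kF S ξ * star (bLow kF (-k))
      = (ξ k : ℂ) • bLow kF k
        - star (genErr kF S ξ (-k) (fun _ => (pairNorm kF (-k))⁻¹)) := by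
  have h1 := congrArg star (h.bLow_comm_gen (h.neg_mem k hk))
  rw [star_sub, star_mul, star_mul, star_gen, star_sub, star_smul, neg_neg, star_star,
    h.even] at h1
  rw [show star (ξ k : ℂ) = (ξ k : ℂ) by simp] at h1
  rw [← h1]
  noncomm_ring

lemma norm_star_bLow_vacuum (h : BogData kF S P ξ X ν) {k : Momentum} (hk : k ∈ S) :
    ‖star (bLow kF k) vacuum‖ = 1 := by
  have hp := h.pos k hk
  rw [star_bLow, pairCreate, smul_apply, norm_smul, norm_inv, Complex.norm_real,
    Real.norm_of_nonneg hp.le]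
  exact inv_mul_cancel₀ hp.ne'

/-- The combinations `b_k ± b*_{-k}` diagonalize the bosonic dynamics. -/
lemma norm_quadrature_sub_le (h : BogData kF S P ξ X ν) {k : Momentum} (hk : k ∈ S) {σ : ℝ}
    (hσ : σ * σ = 1) {t : ℝ} (ht0 : 0 ≤ t) (ht1 : t ≤ 1) :
    ‖(bLow kF k + (σ : ℂ) • star (bLow kF (-k))) (flow (gen kF S ξ) t vacuum)
      - (Real.exp (t * (σ * ξ k)) : ℂ) • (σ : ℂ) •
        flow (gen kF S ξ) t (star (bLow kF (-k)) vacuum)‖ ≤ dynErr X ν := by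
  have hσ1 : |σ| = 1 := by
    rw [← abs_mul_abs_self] at hσ
    nlinarith [abs_nonneg σ]
  have hν : 0 ≤ ν := (inv_nonneg.2 (norm_nonneg _)).trans (h.inv_le k hk)
  set B := gen kF S ξ with hB
  set O := bLow kF k + (σ : ℂ) • star (bLow kF (-k)) with hO
  have hcomm : O * B - B * O - ((σ * ξ k : ℝ) : ℂ) • O
      = - genErr kF S ξ k (fun _ => (pairNorm kF k)⁻¹)
        - (σ : ℂ) • star (genErr kF S ξ (-k) (fun _ => (pairNorm kF (-k))⁻¹)) := by
    have e1 := h.bLow_comm_gen hk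
    have e2 := h.star_bLow_comm_gen hk
    have e3 : O * B - B * O = (bLow kF k * B - B * bLow kF k)
        + (σ : ℂ) • (star (bLow kF (-k)) * B - B * star (bLow kF (-k))) := by
      rw [hO, add_mul, mul_add, smul_mul_assoc, mul_smul_comm, smul_sub]
      abel
    have e4 : ((σ * ξ k : ℝ) : ℂ) * (σ : ℂ) = (ξ k : ℂ) := by
      rw [← Complex.ofReal_mul]
      congr 1
      linear_combination ξ k * hσ
    rw [e3, e1, e2, hO, smul_add, smul_sub, smul_smul, smul_smul, e4, ← Complex.ofReal_mul]
    abel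
  have key := norm_flow_sub_le (star_gen kF S ξ) (O := O) (v := vacuum) (μ := σ * ξ k)
    (r := 20 * (ν * ν) * X * Real.exp (108 * X)) (m := X)
    (by rw [abs_mul, hσ1, one_mul]; exact h.abs_le hk) (fun s hs0 hs1 => by
      rw [← hB, hcomm, sub_apply, neg_apply, smul_apply]
      have b1 := h.norm_genErr_le hk (g := fun _ => (pairNorm kF k)⁻¹)
        (fun _ _ => (abs_inv_pairNorm kF k).le.trans (h.inv_le k hk)) hν (flow B s vacuum)
      have b2 := h.norm_star_genErr_le (h.neg_mem k hk) (flow B s vacuum)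
      have b3 := mul_le_mul_of_nonneg_left (h.norm_wOp_flow_le (j := 3) (by norm_num) hs0 hs1)
        (show 0 ≤ 10 * (ν * ν) * X by have := h.X_nonneg; positivity)
      refine (norm_sub_le _ _).trans ?_
      rw [norm_neg, norm_smul, Complex.norm_real, Real.norm_eq_abs, hσ1, one_mul]
      linarith) ht0 ht1
  rw [← hB] at key
  have hv : O vacuum = (σ : ℂ) • star (bLow kF (-k)) vacuum := by
    rw [hO, add_apply, smul_apply, bLow, pairLow_vacuum, zero_add]
  rw [hv, map_smul] at key
  exact key

lemma norm_bLow_flow_sub_le (h : BogData kF S P ξ X ν) {k : Momentum} (hk : k ∈ S) {t : ℝ}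
    (ht0 : 0 ≤ t) (ht1 : t ≤ 1) :
    ‖bLow kF k (flow (gen kF S ξ) t vacuum)
      - (Real.sinh (t * ξ k) : ℂ) • flow (gen kF S ξ) t (star (bLow kF (-k)) vacuum)‖
      ≤ dynErr X ν := by
  have e1 := h.norm_quadrature_sub_le hk (σ := 1) (by norm_num) ht0 ht1
  have e2 := h.norm_quadrature_sub_le hk (σ := -1) (by norm_num) ht0 ht1
  set ψ := flow (gen kF S ξ) t vacuum
  set τ := flow (gen kF S ξ) t (star (bLow kF (-k)) vacuum)
  set u := (bLow kF k + ((1 : ℝ) : ℂ) • star (bLow kF (-k))) ψ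
      - (Real.exp (t * (1 * ξ k)) : ℂ) • ((1 : ℝ) : ℂ) • τ with hu
  set v := (bLow kF k + ((-1 : ℝ) : ℂ) • star (bLow kF (-k))) ψ
      - (Real.exp (t * (-1 * ξ k)) : ℂ) • ((-1 : ℝ) : ℂ) • τ with hv
  -- `b_k` is half the sum of the two quadratures
  have e3 : bLow kF k ψ - (Real.sinh (t * ξ k) : ℂ) • τ = (1 / 2 : ℂ) • (u + v) := by
    rw [hu, hv, add_apply, add_apply, smul_apply, smul_apply, Real.sinh_eq, one_mul,
      show t * (-1 * ξ k) = -(t * ξ k) by ring]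
    push_cast
    module
  rw [e3, norm_smul, show ‖(1 / 2 : ℂ)‖ = 1 / 2 by simp]
  linarith [norm_add_le u v]

lemma norm_star_bLow_flow_sub_le (h : BogData kF S P ξ X ν) {k : Momentum} (hk : k ∈ S) {t : ℝ}
    (ht0 : 0 ≤ t) (ht1 : t ≤ 1) :
    ‖star (bLow kF (-k)) (flow (gen kF S ξ) t vacuum)
      - (Real.cosh (t * ξ k) : ℂ) • flow (gen kF S ξ) t (star (bLow kF (-k)) vacuum)‖
      ≤ dynErr X ν := by
  have e1 := h.norm_quadrature_sub_le hk (σ := 1) (by norm_num) ht0 ht1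
  have e2 := h.norm_quadrature_sub_le hk (σ := -1) (by norm_num) ht0 ht1
  set ψ := flow (gen kF S ξ) t vacuum
  set τ := flow (gen kF S ξ) t (star (bLow kF (-k)) vacuum)
  set u := (bLow kF k + ((1 : ℝ) : ℂ) • star (bLow kF (-k))) ψ
      - (Real.exp (t * (1 * ξ k)) : ℂ) • ((1 : ℝ) : ℂ) • τ with hu
  set v := (bLow kF k + ((-1 : ℝ) : ℂ) • star (bLow kF (-k))) ψ
      - (Real.exp (t * (-1 * ξ k)) : ℂ) • ((-1 : ℝ) : ℂ) • τ with hv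
  -- `b*_{-k}` is half the difference of the two quadratures
  have e3 : star (bLow kF (-k)) ψ - (Real.cosh (t * ξ k) : ℂ) • τ = (1 / 2 : ℂ) • (u - v) := by
    rw [hu, hv, add_apply, add_apply, smul_apply, smul_apply, Real.cosh_eq, one_mul,
      show t * (-1 * ξ k) = -(t * ξ k) by ring]
    push_cast
    module
  rw [e3, norm_smul, show ‖(1 / 2 : ℂ)‖ = 1 / 2 by simp]
  linarith [norm_sub_le u v]

/-- A pair operator whose weight is orthogonal to the constant weight of `b_k` almost
annihilates the trial state. -/
lemma norm_pairLow_flow_le (h : BogData kF S P ξ X ν) {k : Momentum} (hk : k ∈ S)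
    {g : Momentum → ℝ} {G : ℝ} (hg : ∀ h ∈ pairHoles kF k, |g h| ≤ G) (hG : 0 ≤ G)
    (hsum : ∑ h ∈ pairHoles kF k, g h = 0) {t : ℝ} (ht0 : 0 ≤ t) (ht1 : t ≤ 1) :
    ‖pairLow kF k g (flow (gen kF S ξ) t vacuum)‖
      ≤ 10 * (G * ν) * X * Real.exp (108 * X) := by
  have hν : 0 ≤ ν := (inv_nonneg.2 (norm_nonneg _)).trans (h.inv_le k hk)
  have key := norm_flow_sub_le (star_gen kF S ξ) (O := pairLow kF k g) (v := vacuum) (μ := 0)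
    (r := 10 * (G * ν) * X * Real.exp (108 * X)) (m := 0) (by simp) (fun s hs0 hs1 => by
      rw [h.pairLow_comm_gen hk, hsum]
      simp only [zero_mul, mul_zero, Complex.ofReal_zero, zero_smul, zero_sub, sub_zero]
      rw [neg_apply, norm_neg]
      exact (h.norm_genErr_le hk hg hG _).trans (mul_le_mul_of_nonneg_left
        (h.norm_wOp_flow_le (j := 3) (by norm_num) hs0 hs1)
        (by have := h.X_nonneg; positivity))) ht0 ht1
  rw [pairLow_vacuum, map_zero, smul_zero, sub_zero, mul_zero, Real.exp_zero, one_mul] at key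
  exact key

lemma dynErr_nonneg (h : BogData kF S P ξ X ν) : 0 ≤ dynErr X ν := by
  have := h.X_nonneg
  have := mul_self_nonneg ν
  unfold dynErr
  positivity

lemma abs_sinh_le (h : BogData kF S P ξ X ν) {k : Momentum} (hk : k ∈ S) {t : ℝ}
    (ht0 : 0 ≤ t) (ht1 : t ≤ 1) : |Real.sinh (t * ξ k)| ≤ Real.exp (108 * X) := by
  have hX := h.X_nonneg
  have h1 : |t * ξ k| ≤ 108 * X := by
    rw [abs_mul, abs_of_nonneg ht0]
    have := h.abs_le hk
    nlinarith [abs_nonneg (ξ k)]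
  rw [Real.abs_sinh, Real.sinh_eq]
  have h2 := Real.exp_le_exp.2 h1
  have h3 := Real.exp_pos (-|t * ξ k|)
  have h4 := Real.exp_pos (108 * X)
  linarith

lemma norm_star_bLow_flow_le (h : BogData kF S P ξ X ν) {k : Momentum} (hk : k ∈ S) {t : ℝ}
    (ht0 : 0 ≤ t) (ht1 : t ≤ 1) :
    ‖star (bLow kF (-k)) (flow (gen kF S ξ) t vacuum)‖ ≤ 2 * Real.exp (108 * X) :=
  (norm_star_bLow_le (h.covers _ (h.neg_mem k hk)) _).trans
    (mul_le_mul_of_nonneg_left (h.norm_wOp_flow_le (by norm_num) ht0 ht1) (by norm_num))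

lemma norm_flow_star_bLow_vacuum (h : BogData kF S P ξ X ν) {k : Momentum} (hk : k ∈ S) (t : ℝ) :
    ‖flow (gen kF S ξ) t (star (bLow kF (-k)) vacuum)‖ = 1 := by
  rw [norm_flow_apply (star_gen kF S ξ), h.norm_star_bLow_vacuum (h.neg_mem k hk)]

/-- The anomalous pair density of the interpolating trial states. -/
lemma abs_re_inner_star_bLow_bLow_sub_le (h : BogData kF S P ξ X ν) {k : Momentum} (hk : k ∈ S)
    {t : ℝ} (ht0 : 0 ≤ t) (ht1 : t ≤ 1) :
    |(inner ℂ (star (bLow kF (-k)) (flow (gen kF S ξ) t vacuum))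
        (bLow kF k (flow (gen kF S ξ) t vacuum))).re
        - Real.cosh (t * ξ k) * Real.sinh (t * ξ k)|
      ≤ 3 * Real.exp (108 * X) * dynErr X ν :=
  abs_re_inner_sub_le (h.norm_flow_star_bLow_vacuum hk t)
    (h.norm_star_bLow_flow_sub_le hk ht0 ht1) (h.norm_bLow_flow_sub_le hk ht0 ht1)
    (h.norm_star_bLow_flow_le hk ht0 ht1) (h.abs_sinh_le hk ht0 ht1)

/-- The pair density of the interpolating trial states. -/
lemma abs_norm_bLow_sq_sub_le (h : BogData kF S P ξ X ν) {k : Momentum} (hk : k ∈ S)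
    {t : ℝ} (ht0 : 0 ≤ t) (ht1 : t ≤ 1) :
    |‖bLow kF k (flow (gen kF S ξ) t vacuum)‖ ^ 2 - Real.sinh (t * ξ k) ^ 2|
      ≤ 3 * Real.exp (108 * X) * dynErr X ν := by
  have h1 := abs_re_inner_sub_le (h.norm_flow_star_bLow_vacuum hk t)
    (h.norm_bLow_flow_sub_le hk ht0 ht1) (h.norm_bLow_flow_sub_le hk ht0 ht1)
    (((norm_bLow_le (h.covers _ hk) _).trans (h.norm_wOp_flow_le (by norm_num) ht0 ht1)).trans
      (by linarith [Real.exp_pos (108 * X)])) (h.abs_sinh_le hk ht0 ht1)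
  have h2 : (inner ℂ (bLow kF k (flow (gen kF S ξ) t vacuum))
        (bLow kF k (flow (gen kF S ξ) t vacuum))).re
        = ‖bLow kF k (flow (gen kF S ξ) t vacuum)‖ ^ 2 :=
    inner_self_eq_norm_sq (𝕜 := ℂ) _
  rw [h2] at h1
  rwa [pow_two (Real.sinh _)]

end BogData

/-! ### The kinetic energy -/

/-- The second quantization of the one-particle operator with eigenvalues `e`, restricted to the
modes in `P`. -/
def kineticOp (P : Finset Momentum) (e : Momentum → ℝ) : Fock →L[ℂ] Fock :=
  diagOp P fun U => ∑ p ∈ U, e p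

lemma annihilate_mul_kineticOp {P : Finset Momentum} {p : Momentum} (hp : p ∈ P)
    (e : Momentum → ℝ) :
    annihilate p * kineticOp P e = kineticOp P e * annihilate p + (e p : ℂ) • annihilate p := by
  have h1 := annihilate_mul_diagOp hp (f := fun U => ∑ p ∈ U, e p)
    (g := fun U => (∑ p ∈ U, e p) + e p) (fun U _ hU => by
      rw [Finset.sum_insert hU, add_comm])
  have h2 : diagOp P (fun U => (∑ p ∈ U, e p) + e p) = kineticOp P e + (e p : ℂ) • 1 := by
    ext ψ T
    rw [kineticOp, add_apply, smul_apply, lp.coeFn_add, Pi.add_apply, lp.coeFn_smul, Pi.smul_apply,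
      diagOp_apply, diagOp_apply, one_apply_eq_self, smul_eq_mul]
    push_cast
    ring
  rw [kineticOp, h1, h2, add_mul, smul_mul_assoc, one_mul, kineticOp]

lemma pairLow_mul_kineticOp {P : Finset Momentum} {kF : ℝ} {k : Momentum} (hk : Covers P kF k)
    (e g : Momentum → ℝ) :
    pairLow kF k g * kineticOp P e = kineticOp P e * pairLow kF k g
      + pairLow kF k fun h => g h * (e (h + k) + e h) := by
  rw [pairLow, pairLow, Finset.sum_mul, Finset.mul_sum, ← Finset.sum_add_distrib]
  refine Finset.sum_congr rfl fun h hh => ?_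
  have e1 := annihilate_mul_kineticOp (hk h hh).1 e
  have e2 := annihilate_mul_kineticOp (hk h hh).2 e
  rw [smul_mul_assoc, mul_assoc, e2, mul_add, ← mul_assoc, e1, add_mul, mul_smul_comm,
    smul_mul_assoc, mul_smul_comm, mul_assoc]
  push_cast
  module

lemma kineticOp_vacuum (P : Finset Momentum) (e : Momentum → ℝ) :
    kineticOp P e vacuum = 0 := by
  rw [kineticOp, diagOp_vacuum]; simp

lemma star_kineticOp (P : Finset Momentum) (e : Momentum → ℝ) :
    star (kineticOp P e) = kineticOp P e := adjoint_diagOp _ _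

lemma pairLow_sub (kF : ℝ) (k : Momentum) (g g' : Momentum → ℝ) :
    pairLow kF k g - pairLow kF k g' = pairLow kF k fun h => g h - g' h := by
  rw [pairLow, pairLow, pairLow, ← Finset.sum_sub_distrib]
  refine Finset.sum_congr rfl fun h _ => ?_
  rw [← sub_smul, Complex.ofReal_sub]

/-- The mean excitation energy of the pairs with momentum `k`. -/
def meanGap (kF : ℝ) (e : Momentum → ℝ) (k : Momentum) : ℝ :=
  (pairNorm kF k ^ 2)⁻¹ * ∑ h ∈ pairHoles kF k, (e (h + k) + e h)

/-- The pair annihilation operator weighted with the excitation energies, which is the commutator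
of `b_k` with the kinetic energy. -/
def gapLow (kF : ℝ) (e : Momentum → ℝ) (k : Momentum) : Fock →L[ℂ] Fock :=
  pairLow kF k fun h => (pairNorm kF k)⁻¹ * (e (h + k) + e h)

/-- The error in the kinetic energy, per unit of `∑ |ξ|`. -/
def kinErr (X ν κ G : ℝ) : ℝ :=
  2 * (κ * (3 * Real.exp (108 * X) * dynErr X ν)
    + 2 * Real.exp (108 * X) * (10 * (G * ν) * X * Real.exp (108 * X)))

namespace BogData

variable {kF : ℝ} {S P : Finset Momentum} {ξ : Momentum → ℝ} {X ν : ℝ}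

lemma re_inner_kinetic_comm (h : BogData kF S P ξ X ν) (e : Momentum → ℝ) (ψ : Fock) :
    (inner ℂ ψ ((kineticOp P e * gen kF S ξ - gen kF S ξ * kineticOp P e) ψ)).re
      = ∑ l ∈ S, 2 * ξ l * (inner ℂ (star (bLow kF (-l)) ψ) (gapLow kF e l ψ)).re := by
  set C : Fock →L[ℂ] Fock := (1 / 2 : ℂ) • ∑ l ∈ S, (ξ l : ℂ) •
    (bLow kF (-l) * gapLow kF e l + bLow kF l * gapLow kF e (-l)) with hC
  have e1 : star (creationPart kF S ξ) * kineticOp P e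
      = kineticOp P e * star (creationPart kF S ξ) + C := by
    rw [star_creationPart, smul_mul_assoc, mul_smul_comm, hC, ← smul_add, Finset.sum_mul,
      Finset.mul_sum, ← Finset.sum_add_distrib]
    congr 1
    refine Finset.sum_congr rfl fun l hl => ?_
    rw [smul_mul_assoc, mul_smul_comm, ← smul_add]
    congr 1
    have b1 : bLow kF l * kineticOp P e = kineticOp P e * bLow kF l + gapLow kF e l :=
      pairLow_mul_kineticOp (h.covers l hl) e _
    have b2 : bLow kF (-l) * kineticOp P e = kineticOp P e * bLow kF (-l) + gapLow kF e (-l) :=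
      pairLow_mul_kineticOp (h.covers _ (h.neg_mem l hl)) e _
    have b3 : gapLow kF e (-l) * bLow kF l = bLow kF l * gapLow kF e (-l) := pairLow_comm _ _ _ _ _
    rw [mul_assoc, b1, mul_add, ← mul_assoc, b2, add_mul, b3, mul_assoc]
    abel
  have e2 : kineticOp P e * creationPart kF S ξ
      = creationPart kF S ξ * kineticOp P e + star C := by
    have := congrArg star e1
    rw [star_mul, star_star, star_kineticOp, star_add, star_mul, star_star, star_kineticOp] at this
    exact this
  have e3 : kineticOp P e * gen kF S ξ - gen kF S ξ * kineticOp P e = C + star C := by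
    rw [gen, mul_sub, sub_mul, e1, e2]
    abel
  have e4 : inner ℂ ψ (star C ψ) = (starRingEnd ℂ) (inner ℂ ψ (C ψ)) := by
    rw [ContinuousLinearMap.star_eq_adjoint, ContinuousLinearMap.adjoint_inner_right,
      inner_conj_symm]
  have e5 : inner ℂ ψ (C ψ) = (1 / 2 : ℂ) * ∑ l ∈ S, (ξ l : ℂ) *
      (inner ℂ (star (bLow kF (-l)) ψ) (gapLow kF e l ψ)
        + inner ℂ (star (bLow kF l) ψ) (gapLow kF e (-l) ψ)) := by
    rw [hC, smul_apply, inner_smul_right, sum_apply, inner_sum]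
    congr 1
    refine Finset.sum_congr rfl fun l _ => ?_
    rw [smul_apply, inner_smul_right, add_apply, op_mul_apply, op_mul_apply, inner_add_right,
      ContinuousLinearMap.star_eq_adjoint, ContinuousLinearMap.adjoint_inner_left,
      ContinuousLinearMap.star_eq_adjoint, ContinuousLinearMap.adjoint_inner_left]
  have e6 : ∑ l ∈ S, ξ l * (inner ℂ (star (bLow kF l) ψ) (gapLow kF e (-l) ψ)).re
      = ∑ l ∈ S, ξ l * (inner ℂ (star (bLow kF (-l)) ψ) (gapLow kF e l ψ)).re := by
    refine Finset.sum_nbij' (fun l => -l) (fun l => -l) h.neg_mem h.neg_mem (by simp) (by simp)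
      fun l _ => ?_
    rw [neg_neg, h.even]
  rw [e3, add_apply, inner_add_right, e4, Complex.add_re, Complex.conj_re, ← two_mul, e5,
    show (1 / 2 : ℂ) = ((1 / 2 : ℝ) : ℂ) by push_cast; rfl, Complex.re_ofReal_mul, Complex.re_sum]
  simp only [Complex.re_ofReal_mul, Complex.add_re, mul_add, Finset.sum_add_distrib]
  rw [e6]
  have e7 : ∑ l ∈ S, 2 * ξ l * (inner ℂ (star (bLow kF (-l)) ψ) (gapLow kF e l ψ)).re
      = 2 * ∑ l ∈ S, ξ l * (inner ℂ (star (bLow kF (-l)) ψ) (gapLow kF e l ψ)).re := by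
    rw [Finset.mul_sum]
    exact Finset.sum_congr rfl fun _ _ => by ring
  rw [e7]
  ring

lemma abs_gap_sub_le (h : BogData kF S P ξ X ν) {e : Momentum → ℝ} {κ G : ℝ}
    (hκ : ∀ l ∈ S, |meanGap kF e l| ≤ κ) (hG0 : 0 ≤ G)
    (hG : ∀ l ∈ S, ∀ p ∈ pairHoles kF l,
      |(pairNorm kF l)⁻¹ * (e (p + l) + e p) - meanGap kF e l * (pairNorm kF l)⁻¹| ≤ G)
    {l : Momentum} (hl : l ∈ S) {t : ℝ} (ht0 : 0 ≤ t) (ht1 : t ≤ 1) :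
    |(inner ℂ (star (bLow kF (-l)) (flow (gen kF S ξ) t vacuum))
        (gapLow kF e l (flow (gen kF S ξ) t vacuum))).re
        - meanGap kF e l * (Real.cosh (t * ξ l) * Real.sinh (t * ξ l))|
      ≤ kinErr X ν κ G / 2 := by
  set ψ := flow (gen kF S ξ) t vacuum with hψ
  set κl := meanGap kF e l with hκl
  have hpos := h.pos l hl
  set d := pairLow kF l (fun p => (pairNorm kF l)⁻¹ * (e (p + l) + e p) - κl * (pairNorm kF l)⁻¹)
    with hd
  -- the weight splits into its mean and a part orthogonal to the constants
  have hgap : gapLow kF e l ψ = (κl : ℂ) • bLow kF l ψ + d ψ := by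
    have : gapLow kF e l - (κl : ℂ) • bLow kF l = d := by
      have : (κl : ℂ) • bLow kF l = pairLow kF l (fun _ => κl * (pairNorm kF l)⁻¹) := by
        rw [bLow, pairLow, pairLow, Finset.smul_sum]
        refine Finset.sum_congr rfl fun p _ => ?_
        rw [smul_smul, Complex.ofReal_mul]
      rw [this, gapLow, pairLow_sub]
    rw [← this, sub_apply, smul_apply]
    abel
  have hsum : ∑ p ∈ pairHoles kF l,
      ((pairNorm kF l)⁻¹ * (e (p + l) + e p) - κl * (pairNorm kF l)⁻¹) = 0 := by
    rw [Finset.sum_sub_distrib, ← Finset.mul_sum, Finset.sum_const, nsmul_eq_mul, ← pairNorm_sq,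
      hκl, meanGap]
    field_simp
    ring
  have hdn := h.norm_pairLow_flow_le hl (hG l hl) hG0 hsum ht0 ht1
  rw [← hd, ← hψ] at hdn
  have hx := h.norm_star_bLow_flow_le hl ht0 ht1
  have hy := h.abs_re_inner_star_bLow_bLow_sub_le hl ht0 ht1
  rw [← hψ] at hx hy
  rw [hgap, inner_add_right, inner_smul_right, Complex.add_re, Complex.re_ofReal_mul]
  have b1 : |(inner ℂ (star (bLow kF (-l)) ψ) (d ψ)).re|
      ≤ 2 * Real.exp (108 * X) * (10 * (G * ν) * X * Real.exp (108 * X)) :=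
    (Complex.abs_re_le_norm _).trans ((norm_inner_le_norm _ _).trans
      (mul_le_mul hx hdn (norm_nonneg _) (by positivity)))
  have b2 : |κl * ((inner ℂ (star (bLow kF (-l)) ψ) (bLow kF l ψ)).re
      - Real.cosh (t * ξ l) * Real.sinh (t * ξ l))| ≤ κ * (3 * Real.exp (108 * X) * dynErr X ν) := by
    rw [abs_mul]
    exact mul_le_mul (hκ l hl) hy (abs_nonneg _) ((abs_nonneg _).trans (hκ l hl))
  have b3 := abs_add_le (κl * ((inner ℂ (star (bLow kF (-l)) ψ) (bLow kF l ψ)).re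
      - Real.cosh (t * ξ l) * Real.sinh (t * ξ l))) ((inner ℂ (star (bLow kF (-l)) ψ) (d ψ)).re)
  have b4 : κl * ((inner ℂ (star (bLow kF (-l)) ψ) (bLow kF l ψ)).re
      - Real.cosh (t * ξ l) * Real.sinh (t * ξ l)) + (inner ℂ (star (bLow kF (-l)) ψ) (d ψ)).re
      = κl * (inner ℂ (star (bLow kF (-l)) ψ) (bLow kF l ψ)).re
      + (inner ℂ (star (bLow kF (-l)) ψ) (d ψ)).re
      - κl * (Real.cosh (t * ξ l) * Real.sinh (t * ξ l)) := by ring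
  rw [b4] at b3
  unfold kinErr
  linarith

/-- The kinetic energy of the trial state. -/
lemma abs_kinetic_sub_le (h : BogData kF S P ξ X ν) {e : Momentum → ℝ} {κ G : ℝ}
    (hκ : ∀ l ∈ S, |meanGap kF e l| ≤ κ) (hκ0 : 0 ≤ κ) (hν : 0 ≤ ν) (hG0 : 0 ≤ G)
    (hG : ∀ l ∈ S, ∀ p ∈ pairHoles kF l,
      |(pairNorm kF l)⁻¹ * (e (p + l) + e p) - meanGap kF e l * (pairNorm kF l)⁻¹| ≤ G) :
    |(inner ℂ (flow (gen kF S ξ) 1 vacuum) (kineticOp P e (flow (gen kF S ξ) 1 vacuum))).re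
        - ∑ l ∈ S, meanGap kF e l * Real.sinh (ξ l) ^ 2| ≤ X * kinErr X ν κ G := by
  set B := gen kF S ξ with hB
  set H := kineticOp P e with hH
  have hin : ∀ (t : ℝ) (O : Fock →L[ℂ] Fock),
      inner ℂ vacuum (flow B (-t) (O (flow B t vacuum)))
        = inner ℂ (flow B t vacuum) (O (flow B t vacuum)) := by
    intro t O
    rw [← star_flow (star_gen kF S ξ), ContinuousLinearMap.star_eq_adjoint,
      ContinuousLinearMap.adjoint_inner_right]
  have hderiv : ∀ t : ℝ, HasDerivAt (fun t => (inner ℂ (flow B t vacuum) (H (flow B t vacuum))).re)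
      (∑ l ∈ S, 2 * ξ l * (inner ℂ (star (bLow kF (-l)) (flow B t vacuum))
        (gapLow kF e l (flow B t vacuum))).re) t := by
    intro t
    have h1 := hasDerivAt_heisenberg B H vacuum t
    have h2 := ((Complex.reCLM.comp ((innerSL ℂ vacuum).restrictScalars ℝ)).hasFDerivAt).comp_hasDerivAt
      t h1
    have h3 : (∑ l ∈ S, 2 * ξ l * (inner ℂ (star (bLow kF (-l)) (flow B t vacuum))
        (gapLow kF e l (flow B t vacuum))).re)
        = (Complex.reCLM.comp ((innerSL ℂ vacuum).restrictScalars ℝ))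
          (flow B (-t) ((H * B - B * H) (flow B t vacuum))) := by
      rw [← h.re_inner_kinetic_comm e, ← hin]
      rfl
    rw [h3]
    refine h2.congr_of_eventuallyEq (Filter.Eventually.of_forall fun s => ?_)
    change _ = (inner ℂ vacuum (flow B (-s) (H (flow B s vacuum)))).re
    rw [hin]
  have hmain : ∀ t : ℝ, HasDerivAt (fun t => ∑ l ∈ S, meanGap kF e l * Real.sinh (t * ξ l) ^ 2)
      (∑ l ∈ S, 2 * ξ l * (meanGap kF e l * (Real.cosh (t * ξ l) * Real.sinh (t * ξ l)))) t := by
    intro t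
    refine HasDerivAt.fun_sum fun l _ => ?_
    have h1 : HasDerivAt (fun t : ℝ => t * ξ l) (ξ l) t := by
      simpa using (hasDerivAt_id t).mul_const (ξ l)
    refine ((h1.sinh.pow 2).const_mul (meanGap kF e l)).congr_deriv ?_
    simp
    ring
  have key := norm_image_sub_le_of_norm_deriv_le_segment_01' (C := X * kinErr X ν κ G)
    (fun t _ => ((hderiv t).sub (hmain t)).hasDerivWithinAt) (fun t ht => by
      rw [← Finset.sum_sub_distrib]
      have hb : 0 ≤ kinErr X ν κ G := by
        have := h.X_nonneg
        have := h.dynErr_nonneg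
        unfold kinErr
        positivity
      calc _ ≤ ∑ l ∈ S, |ξ l| * kinErr X ν κ G := by
            refine norm_sum_le_of_le _ fun l hl => ?_
            rw [← mul_sub, Real.norm_eq_abs, abs_mul, abs_mul, abs_of_pos (zero_lt_two' ℝ)]
            have := h.abs_gap_sub_le hκ hG0 hG hl ht.1 ht.2.le
            nlinarith [abs_nonneg (ξ l)]
        _ ≤ X * kinErr X ν κ G := by
            rw [← Finset.sum_mul]
            exact mul_le_mul_of_nonneg_right h.sum_le hb)
  simp only [Pi.sub_apply, flow_zero, one_apply_eq_self, hH, kineticOp_vacuum, inner_zero_right,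
    Complex.zero_re, one_mul, zero_mul, Real.sinh_zero, ne_eq, OfNat.ofNat_ne_zero,
    not_false_eq_true, zero_pow, mul_zero, Finset.sum_const_zero, sub_zero] at key
  exact key

end BogData

/-! ### The energies of the trial state -/

/-- Sums over nonzero momenta reduce to finite sums over the support. -/
lemma tsum_nzMomentum {M : Type*} [AddCommMonoid M] [TopologicalSpace M] (F : Momentum → M)
    {S : Finset Momentum} (hS0 : (0 : Momentum) ∉ S) (hF : ∀ k, k ≠ 0 → k ∉ S → F k = 0) :
    ∑' k : NzMomentum, F k = ∑ k ∈ S, F k := by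
  rw [tsum_eq_sum (s := S.subtype (fun k => k ≠ 0)) (fun k hk => hF k k.2 fun h => hk (by
    simpa using h))]
  exact Finset.sum_subtype_of_mem F fun k hk h => hS0 (h ▸ hk)

lemma bogGenerator_eq_gen {kF : ℝ} {S : Finset Momentum} {ξ : Momentum → ℝ} {Ξ : Momentum → ℂ}
    (hS0 : (0 : Momentum) ∉ S) (hΞ : ∀ k, Ξ k = ξ k) (hξ : ∀ k, k ≠ 0 → k ∉ S → ξ k = 0) :
    bogGenerator kF Ξ = gen kF S ξ := by
  have h1 : bogCreationPart kF Ξ = creationPart kF S ξ := by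
    rw [bogCreationPart, creationPart,
      tsum_nzMomentum (fun k => Ξ k • (pairCreate kF k * pairCreate kF (-k))) hS0
        (fun k hk hkS => by rw [hΞ, hξ k hk hkS]; simp)]
    simp only [star_bLow, hΞ]
  rw [bogGenerator, gen, h1]
  rfl

lemma trialState_eq_flow {kF : ℝ} {S : Finset Momentum} {ξ : Momentum → ℝ} {Ξ : Momentum → ℂ}
    (hS0 : (0 : Momentum) ∉ S) (hΞ : ∀ k, Ξ k = ξ k) (hξ : ∀ k, k ≠ 0 → k ∉ S → ξ k = 0) :
    trialState kF Ξ = flow (gen kF S ξ) 1 vacuum := by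
  rw [trialState, bogGenerator_eq_gen hS0 hΞ hξ, flow_one]

lemma annihilate_commute_pairLow {kF : ℝ} {k q : Momentum}
    (g : Momentum → ℝ) : Commute (annihilate q) (pairLow kF k g) := by
  refine Commute.sum_right _ _ _ fun h _ => Commute.smul_right ?_ _
  change annihilate q * (annihilate h * annihilate (h + k))
    = annihilate h * annihilate (h + k) * annihilate q
  rw [← mul_assoc, annihilate_mul_annihilate q h, mul_assoc, annihilate_mul_annihilate (h + k) q]
  noncomm_ring

lemma annihilate_commute_star_pairLow {P : Finset Momentum} {kF : ℝ} {k q : Momentum}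
    (hk : Covers P kF k) (hq : q ∉ P) (g : Momentum → ℝ) :
    Commute (annihilate q) (star (pairLow kF k g)) := by
  rw [star_pairLow]
  refine Commute.sum_right _ _ _ fun h hh => Commute.smul_right ?_ _
  have h1 : q ≠ h := fun e => hq (e ▸ (hk h hh).1)
  have h2 : q ≠ h + k := fun e => hq (e ▸ (hk h hh).2)
  change annihilate q * (create (h + k) * create h) = create (h + k) * create h * annihilate q
  have e := annihilate_mul_create_of_ne h1
  rw [← mul_assoc, annihilate_mul_create_of_ne h2, neg_mul, mul_assoc, e]
  noncomm_ring

namespace BogData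

variable {kF : ℝ} {S P : Finset Momentum} {ξ : Momentum → ℝ} {X ν : ℝ}

lemma annihilate_commute_gen (h : BogData kF S P ξ X ν) {q : Momentum} (hq : q ∉ P) :
    Commute (annihilate q) (gen kF S ξ) := by
  rw [gen]
  refine Commute.sub_right ?_ ?_
  · refine Commute.smul_right (Commute.sum_right _ _ _ fun k hk => Commute.smul_right ?_ _) _
    exact (annihilate_commute_star_pairLow (h.covers k hk) hq _).mul_right
      (annihilate_commute_star_pairLow (h.covers _ (h.neg_mem k hk)) hq _)
  · rw [star_creationPart]
    refine Commute.smul_right (Commute.sum_right _ _ _ fun k hk => Commute.smul_right ?_ _) _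
    exact (annihilate_commute_pairLow _).mul_right
      (annihilate_commute_pairLow _)

/-- The modes outside of `P` remain empty. -/
lemma flow_apply_eq_zero (h : BogData kF S P ξ X ν) (t : ℝ) {T : Finset Momentum}
    (hT : ¬ T ⊆ P) : flow (gen kF S ξ) t vacuum T = 0 := by
  obtain ⟨q, hqT, hqP⟩ := Finset.not_subset.1 hT
  have h1 := flow_commute (h.annihilate_commute_gen hqP) t vacuum
  rw [annihilate_vacuum, map_zero] at h1
  have h2 : annihilate q (flow (gen kF S ξ) t vacuum) (T.erase q) = 0 := by rw [h1]; rfl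
  rw [annihilate_apply, if_neg (Finset.notMem_erase _ _), Finset.insert_erase hqT] at h2
  refine (mul_eq_zero.1 h2).resolve_left fun h3 => ?_
  have := norm_jwSign q (T.erase q)
  rw [h3] at this
  simp at this

lemma dGammaExpectation_flow (h : BogData kF S P ξ X ν) (e : Momentum → ℝ) (t : ℝ) :
    dGammaExpectation e (flow (gen kF S ξ) t vacuum)
      = (inner ℂ (flow (gen kF S ξ) t vacuum)
          (kineticOp P e (flow (gen kF S ξ) t vacuum))).re := by
  have h1 := (lp.hasSum_inner (flow (gen kF S ξ) t vacuum)
    (kineticOp P e (flow (gen kF S ξ) t vacuum))).mapL Complex.reCLM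
  refine (tsum_congr fun T => ?_).trans h1.tsum_eq
  by_cases hT : T ⊆ P
  · rw [kineticOp, diagOp_apply, Finset.inter_eq_left.2 hT]
    generalize flow (gen kF S ξ) t vacuum T = z
    change _ = (((∑ p ∈ T, e p : ℝ) : ℂ) * z * (starRingEnd ℂ) z).re
    rw [mul_assoc, Complex.mul_conj, Complex.re_ofReal_mul, Complex.ofReal_re,
      Complex.normSq_eq_norm_sq]
  · rw [kineticOp, diagOp_apply, h.flow_apply_eq_zero t hT]
    simp

end BogData

lemma pairHoles_neg (kF : ℝ) (k : Momentum) :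
    pairHoles kF (-k) = (pairHoles kF k).image fun h => -h := by
  have hneg : ∀ p, -p ∈ fermiBall kF ↔ p ∈ fermiBall kF := fun p => by
    rw [mem_fermiBall, mem_fermiBall]
    simp [klen]
  ext h
  rw [Finset.mem_image, mem_pairHoles]
  constructor
  · rintro ⟨h1, h2⟩
    refine ⟨-h, mem_pairHoles.2 ⟨(hneg _).2 h1, fun h3 => h2 ?_⟩, neg_neg h⟩
    rw [← hneg]
    convert h3 using 1
    abel
  · rintro ⟨p, hp, rfl⟩
    rw [mem_pairHoles] at hp
    refine ⟨(hneg _).2 hp.1, fun h3 => hp.2 ?_⟩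
    rw [← hneg]
    convert h3 using 1
    abel

lemma pairNorm_neg (kF : ℝ) (k : Momentum) : pairNorm kF (-k) = pairNorm kF k := by
  refine (pow_left_inj₀ (show 0 ≤ pairNorm kF (-k) from norm_nonneg _)
    (show 0 ≤ pairNorm kF k from norm_nonneg _) two_ne_zero).1 ?_
  rw [pairNorm_sq, pairNorm_sq, pairHoles_neg, Finset.card_image_of_injective _ neg_injective]

lemma pairCreateRaw_eq_smul {kF : ℝ} {k : Momentum} (hk : 0 < pairNorm kF k) :
    pairCreateRaw kF k = (pairNorm kF k : ℂ) • star (bLow kF k) := by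
  have : (pairNorm kF k : ℂ) ≠ 0 := by exact_mod_cast hk.ne'
  rw [star_bLow, pairCreate, smul_smul, mul_inv_cancel₀ this, one_smul]

/-- The expectation value of the interaction in terms of the pair density and the anomalous pair
density. -/
lemma inner_interactionOp {kF : ℝ} {S : Finset Momentum} {V : Momentum → ℝ}
    (hS0 : (0 : Momentum) ∉ S) (hneg : ∀ k ∈ S, -k ∈ S) (hpos : ∀ k ∈ S, 0 < pairNorm kF k)
    (hV : ∀ k, k ≠ 0 → k ∉ S → V k = 0) (ψ : Fock) :
    inner ℂ ψ (interactionOp V kF ψ)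
      = (((1 / (particleNumber kF : ℝ)) * ∑ k ∈ S, V k * pairNorm kF k ^ 2
        * (‖bLow kF k ψ‖ ^ 2 + (inner ℂ (star (bLow kF (-k)) ψ) (bLow kF k ψ)).re) : ℝ) : ℂ) := by
  rw [interactionOp, tsum_nzMomentum (fun k => (V k : ℂ) •
    ((2 : ℂ) • (pairCreateRaw kF k * ContinuousLinearMap.adjoint (pairCreateRaw kF k))
      + pairCreateRaw kF k * pairCreateRaw kF (-k)
      + ContinuousLinearMap.adjoint (pairCreateRaw kF (-k))
        * ContinuousLinearMap.adjoint (pairCreateRaw kF k))) hS0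
    (fun k hk hkS => by rw [hV k hk hkS]; simp), smul_apply, inner_smul_right, sum_apply,
    inner_sum]
  simp only [Complex.ofReal_mul, Complex.ofReal_sum, Complex.ofReal_add, Complex.ofReal_pow,
    Complex.ofReal_div, Complex.ofReal_one, Complex.ofReal_natCast]
  rw [show (1 / (2 * (particleNumber kF : ℂ))) = 1 / (particleNumber kF : ℂ) * (1 / 2) by
    rw [one_div_mul_one_div_rev, mul_comm], mul_assoc, Finset.mul_sum]
  congr 1
  refine Finset.sum_congr rfl fun k hk => ?_
  have h1 := pairCreateRaw_eq_smul (hpos k hk)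
  have h2 := pairCreateRaw_eq_smul (hpos _ (hneg k hk))
  rw [pairNorm_neg] at h2
  set n := pairNorm kF k
  have hstar : ∀ l, ContinuousLinearMap.adjoint ((n : ℂ) • star (bLow kF l))
      = (n : ℂ) • bLow kF l := by
    intro l
    rw [← ContinuousLinearMap.star_eq_adjoint, star_smul, star_star]
    simp
  rw [h1, h2, hstar, hstar]
  have e0 : ∀ (l : Momentum) (x y : Fock),
      inner ℂ x (star (bLow kF l) y) = inner ℂ (bLow kF l x) y := fun l x y => by
    rw [ContinuousLinearMap.star_eq_adjoint, ContinuousLinearMap.adjoint_inner_right]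
  have e0' : ∀ (l : Momentum) (x y : Fock),
      inner ℂ x (bLow kF l y) = inner ℂ (star (bLow kF l) x) y := fun l x y => by
    rw [ContinuousLinearMap.star_eq_adjoint, ContinuousLinearMap.adjoint_inner_left]
  simp only [smul_mul_smul_comm, smul_apply, add_apply, op_mul_apply, inner_smul_right,
    inner_add_right, e0 k]
  rw [e0' (-k) ψ, inner_self_eq_norm_sq_to_K,
    ← inner_conj_symm (bLow kF k ψ) (star (bLow kF (-k)) ψ)]
  have e1 := Complex.add_conj (inner ℂ (star (bLow kF (-k)) ψ) (bLow kF k ψ))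
  push_cast at e1
  linear_combination ((V k : ℂ) * n ^ 2 / 2) * e1

lemma conj_div_norm_mul_sinh_cosh (x : ℝ) :
    (starRingEnd ℂ (x : ℂ) / (‖(x : ℂ)‖ : ℂ))
      * ((Real.sinh ‖(x : ℂ)‖ * Real.cosh ‖(x : ℂ)‖ : ℝ) : ℂ)
      = ((Real.cosh x * Real.sinh x : ℝ) : ℂ) := by
  rw [Complex.conj_ofReal, Complex.norm_real, Real.norm_eq_abs, Real.cosh_abs]
  rcases lt_trichotomy x 0 with hx | hx | hx
  · have hx' : (x : ℂ) ≠ 0 := by exact_mod_cast hx.ne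
    rw [abs_of_neg hx, Real.sinh_neg, Complex.ofReal_neg, div_neg, div_self hx']
    push_cast
    ring
  · simp [hx]
  · have hx' : (x : ℂ) ≠ 0 := by exact_mod_cast hx.ne'
    rw [abs_of_pos hx, div_self hx']
    push_cast
    ring

lemma interactionMain_eq {kF : ℝ} {S : Finset Momentum} {V ξ : Momentum → ℝ} {Ξ : Momentum → ℂ}
    (hS0 : (0 : Momentum) ∉ S) (hV : ∀ k, k ≠ 0 → k ∉ S → V k = 0) (hΞ : ∀ k, Ξ k = ξ k) :
    interactionMain V kF Ξ = (1 / (particleNumber kF : ℝ)) * ∑ k ∈ S, V k * pairNorm kF k ^ 2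
        * (Real.sinh (ξ k) ^ 2 + Real.cosh (ξ k) * Real.sinh (ξ k)) := by
  rw [interactionMain]
  congr 1
  rw [tsum_nzMomentum (fun k => ((V k * pairNorm kF k ^ 2 : ℝ) : ℂ) *
      (((Real.sinh ‖Ξ k‖ ^ 2 : ℝ) : ℂ)
        + (starRingEnd ℂ (Ξ k) / (‖Ξ k‖ : ℂ))
          * ((Real.sinh ‖Ξ k‖ * Real.cosh ‖Ξ k‖ : ℝ) : ℂ))) hS0
      (fun k hk hkS => by rw [hV k hk hkS]; simp), Complex.re_sum]
  refine Finset.sum_congr rfl fun k _ => ?_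
  have h1 : Real.sinh ‖(ξ k : ℂ)‖ ^ 2 = Real.sinh (ξ k) ^ 2 := by
    rw [Complex.norm_real, Real.norm_eq_abs, ← Real.abs_sinh, sq_abs]
  rw [hΞ, conj_div_norm_mul_sinh_cosh, h1, ← Complex.ofReal_add, ← Complex.ofReal_mul,
    Complex.ofReal_re]

lemma klen_sq (k : Momentum) : klen k ^ 2 = ∑ i, (k i : ℝ) ^ 2 :=
  Real.sq_sqrt (Finset.sum_nonneg fun _ _ => sq_nonneg _)

lemma klen_add_sq_sub (h k : Momentum) :
    klen (h + k) ^ 2 - klen h ^ 2 = ∑ i, (k i : ℝ) * (((h + k) i : ℝ) + (h i : ℝ)) := by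
  rw [klen_sq, klen_sq, ← Finset.sum_sub_distrib]
  refine Finset.sum_congr rfl fun i _ => ?_
  rw [Pi.add_apply]
  push_cast
  ring

lemma excitationEnergy_add {kF : ℝ} {k h : Momentum} (hh : h ∈ pairHoles kF k) :
    excitationEnergy kF (h + k) + excitationEnergy kF h
      = hbar kF ^ 2 * (klen (h + k) ^ 2 - klen h ^ 2) := by
  rw [mem_pairHoles] at hh
  rw [excitationEnergy, excitationEnergy, if_neg hh.2, if_pos hh.1]
  ring

lemma kDotF_eq (kF : ℝ) (k : Momentum) :
    kDotF kF k = (pairNorm kF k ^ 2)⁻¹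
      * ∑ h ∈ pairHoles kF k, (klen (h + k) ^ 2 - klen h ^ 2) := by
  simp only [kDotF, fVec, klen_add_sq_sub]
  rw [Finset.sum_comm, Finset.mul_sum]
  refine Finset.sum_congr rfl fun i _ => ?_
  rw [← Finset.mul_sum]
  ring

lemma meanGap_excitationEnergy (kF : ℝ) (k : Momentum) :
    meanGap kF (excitationEnergy kF) k = hbar kF ^ 2 * kDotF kF k := by
  rw [meanGap, kDotF_eq, Finset.sum_congr rfl fun h hh => excitationEnergy_add hh,
    ← Finset.mul_sum]
  ring

lemma kineticMain_eq {kF : ℝ} {S : Finset Momentum} {ξ : Momentum → ℝ} {Ξ : Momentum → ℂ}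
    (hS0 : (0 : Momentum) ∉ S) (hΞ : ∀ k, Ξ k = ξ k) (hξ : ∀ k, k ≠ 0 → k ∉ S → ξ k = 0) :
    kineticMain kF Ξ
      = ∑ k ∈ S, meanGap kF (excitationEnergy kF) k * Real.sinh (ξ k) ^ 2 := by
  rw [kineticMain, tsum_nzMomentum
    (fun k => hbar kF ^ 2 * kDotF kF k * Real.sinh ‖Ξ k‖ ^ 2) hS0
    (fun k hk hkS => by rw [hΞ, hξ k hk hkS]; simp)]
  refine Finset.sum_congr rfl fun k _ => ?_
  rw [meanGap_excitationEnergy, hΞ, Complex.norm_real, Real.norm_eq_abs, ← Real.abs_sinh, sq_abs]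

/-- The total error in terms of the bounds on the kernel, on the normalization constants `n_k` and
on the excitation energies. -/
lemma BogData.norm_eps_le {kF : ℝ} {S P : Finset Momentum} {ξ : Momentum → ℝ} {X ν : ℝ}
    (h : BogData kF S P ξ X ν) {V : Momentum → ℝ} {Ξ : Momentum → ℂ} {κ G : ℝ}
    (hS0 : (0 : Momentum) ∉ S) (hV : ∀ k, k ≠ 0 → k ∉ S → V k = 0) (hΞ : ∀ k, Ξ k = ξ k)
    (hξ : ∀ k, k ≠ 0 → k ∉ S → ξ k = 0)
    (hκ : ∀ l ∈ S, |meanGap kF (excitationEnergy kF) l| ≤ κ) (hκ0 : 0 ≤ κ) (hν : 0 ≤ ν)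
    (hG0 : 0 ≤ G)
    (hG : ∀ l ∈ S, ∀ p ∈ pairHoles kF l,
      |(pairNorm kF l)⁻¹ * (excitationEnergy kF (p + l) + excitationEnergy kF p)
        - meanGap kF (excitationEnergy kF) l * (pairNorm kF l)⁻¹| ≤ G) :
    ‖eps1 V kF Ξ + ((2 * (eps2 kF Ξ).re : ℝ) : ℂ)‖
      ≤ (1 / (particleNumber kF : ℝ)) * (∑ k ∈ S, |V k| * pairNorm kF k ^ 2)
          * (6 * Real.exp (108 * X) * dynErr X ν) + X * kinErr X ν κ G := by
  refine (norm_add_le _ _).trans (add_le_add ?_ ?_)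
  · rw [eps1, trialState_eq_flow hS0 hΞ hξ, inner_interactionOp hS0 h.neg_mem h.pos hV,
      interactionMain_eq hS0 hV hΞ, ← Complex.ofReal_sub, Complex.norm_real, Real.norm_eq_abs,
      ← mul_sub, ← Finset.sum_sub_distrib, abs_mul, abs_of_nonneg (by positivity), mul_assoc]
    refine mul_le_mul_of_nonneg_left ?_ (by positivity)
    rw [Finset.sum_mul]
    refine (Finset.abs_sum_le_sum_abs _ _).trans (Finset.sum_le_sum fun k hk => ?_)
    rw [← mul_sub, abs_mul, abs_mul, abs_of_nonneg (sq_nonneg (pairNorm kF k))]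
    refine mul_le_mul_of_nonneg_left ?_ (by positivity)
    have e1 := h.abs_norm_bLow_sq_sub_le hk zero_le_one le_rfl
    have e2 := h.abs_re_inner_star_bLow_bLow_sub_le hk zero_le_one le_rfl
    rw [one_mul] at e1 e2
    rw [add_sub_add_comm]
    refine (abs_add_le _ _).trans ((add_le_add e1 e2).trans (le_of_eq (by ring)))
  · have e1 := h.abs_kinetic_sub_le hκ hκ0 hν hG0 hG
    rw [← h.dGammaExpectation_flow, ← trialState_eq_flow hS0 hΞ hξ, ← kineticMain_eq hS0 hΞ hξ] at e1
    rw [eps2, Complex.ofReal_re, mul_div_cancel₀ _ two_ne_zero, Complex.norm_real,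
      Real.norm_eq_abs]
    exact e1

/-! ### Lattice point counts -/

lemma klen_eq_norm (k : Momentum) :
    klen k = ‖(WithLp.toLp 2 (fun i => (k i : ℝ)) : EuclideanSpace ℝ (Fin 3))‖ := by
  rw [EuclideanSpace.norm_eq, klen]
  simp

lemma klen_nonneg (k : Momentum) : 0 ≤ klen k := Real.sqrt_nonneg _

lemma klen_neg (k : Momentum) : klen (-k) = klen k := by simp [klen]

lemma klen_add_le (h k : Momentum) : klen (h + k) ≤ klen h + klen k := by
  rw [klen_eq_norm, klen_eq_norm, klen_eq_norm]
  refine le_trans (le_of_eq ?_) (norm_add_le _ _)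
  congr 1
  ext i
  simp

lemma klen_nsmul (n : ℕ) (k : Momentum) : klen (n • k) = n * klen k := by
  rw [klen_eq_norm, klen_eq_norm, ← Real.norm_natCast, ← norm_smul]
  congr 1
  ext i
  simp

lemma abs_apply_le_klen (k : Momentum) (i : Fin 3) : |(k i : ℝ)| ≤ klen k := by
  rw [klen, ← Real.sqrt_sq_eq_abs]
  exact Real.sqrt_le_sqrt (Finset.single_le_sum (f := fun j => (k j : ℝ) ^ 2)
    (fun j _ => sq_nonneg _) (Finset.mem_univ i))

lemma one_le_klen {k : Momentum} (hk : k ≠ 0) : 1 ≤ klen k := by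
  obtain ⟨i, hi⟩ := Function.ne_iff.1 hk
  refine le_trans ?_ (abs_apply_le_klen k i)
  have : 1 ≤ |k i| := Int.one_le_abs hi
  exact_mod_cast this

lemma klen_sub_le (h k : Momentum) : klen k ≤ klen (h + k) + klen h := by
  have := klen_add_le (h + k) (-h)
  rwa [klen_neg, add_neg_cancel_comm] at this

/-- The cube root of the particle number, which is comparable to the Fermi momentum. -/
def rootN (kF : ℝ) : ℝ := (particleNumber kF : ℝ) ^ (1 / 3 : ℝ)

lemma particleNumber_pos {kF : ℝ} (h : 0 ≤ kF) : 0 < particleNumber kF := by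
  refine Finset.card_pos.2 ⟨0, ?_⟩
  rw [mem_fermiBall]
  simpa [klen] using h

lemma rootN_pow_three (kF : ℝ) : rootN kF ^ 3 = particleNumber kF := by
  rw [rootN, ← Real.rpow_natCast, ← Real.rpow_mul (Nat.cast_nonneg _)]
  norm_num

lemma rootN_pos {kF : ℝ} (h : 0 ≤ kF) : 0 < rootN kF :=
  Real.rpow_pos_of_pos (by exact_mod_cast particleNumber_pos h) _

lemma hbar_eq (kF : ℝ) : hbar kF = (rootN kF)⁻¹ := by
  rw [hbar, rootN, Real.rpow_neg (Nat.cast_nonneg _)]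

/-- The Fermi ball contains a cube of side length comparable to the Fermi momentum. -/
lemma fermi_le_rootN {kF : ℝ} (h : 0 ≤ kF) : kF + 1 ≤ 3 * rootN kF := by
  set m : ℤ := ⌊kF / 2⌋ with hm
  have hm0 : 0 ≤ m := Int.floor_nonneg.2 (by linarith)
  have hm1 : (m : ℝ) ≤ kF / 2 := Int.floor_le _
  have hm2 : kF / 2 < m + 1 := Int.lt_floor_add_one _
  have hm0' : (0 : ℝ) ≤ m := by exact_mod_cast hm0
  have hsub : (Fintype.piFinset fun _ : Fin 3 => Finset.Icc (-m) m) ⊆ fermiBall kF := by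
    intro p hp
    rw [mem_fermiBall, klen]
    rw [Fintype.mem_piFinset] at hp
    have hb : ∀ i, (p i : ℝ) ^ 2 ≤ (m : ℝ) ^ 2 := fun i => by
      have := Finset.mem_Icc.1 (hp i)
      have h1 : (-(m : ℝ)) ≤ p i := by exact_mod_cast this.1
      have h2 : (p i : ℝ) ≤ m := by exact_mod_cast this.2
      exact sq_le_sq' h1 h2
    refine Real.sqrt_le_iff.2 ⟨h, ?_⟩
    rw [Fin.sum_univ_three]
    nlinarith [hb 0, hb 1, hb 2]
  have hcard := Finset.card_le_card hsub
  rw [Fintype.card_piFinset_const, Int.card_Icc] at hcard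
  have h3 : (((m + 1 - -m).toNat : ℕ) : ℝ) = 2 * m + 1 := by
    have : (((m + 1 - -m).toNat : ℕ) : ℤ) = 2 * m + 1 := by
      rw [Int.toNat_of_nonneg (by linarith)]; ring
    exact_mod_cast this
  have hcard' : (2 * (m : ℝ) + 1) ^ 3 ≤ rootN kF ^ 3 := by
    rw [rootN_pow_three, ← h3]
    exact_mod_cast hcard
  have := le_of_pow_le_pow_left₀ (by norm_num) (rootN_pos h).le hcard'
  linarith

/-- Every lattice line in direction `k` that meets the Fermi ball leaves it once, and contains at
most `2 k_F + 1` points of it. -/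
lemma particleNumber_le {kF : ℝ} (hkF : 0 ≤ kF) {k : Momentum} (hk : k ≠ 0) :
    (particleNumber kF : ℝ) ≤ pairNorm kF k ^ 2 * (2 * kF + 1) := by
  have hbound : ∀ h ∈ fermiBall kF, ∀ j : ℕ, h + j • k ∈ fermiBall kF → (j : ℝ) ≤ 2 * kF := by
    intro h hh j hj
    rw [mem_fermiBall] at hh hj
    have h1 := klen_sub_le h (j • k)
    rw [klen_nsmul] at h1
    have h2 := one_le_klen hk
    have : (j : ℝ) * 1 ≤ j * klen k := mul_le_mul_of_nonneg_left h2 (Nat.cast_nonneg _)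
    linarith
  have hsub : fermiBall kF ⊆ ((pairHoles kF k) ×ˢ Finset.range (⌊2 * kF⌋₊ + 1)).image
      (fun x => x.1 - x.2 • k) := by
    intro h hh
    have hex : ∃ j : ℕ, h + (j + 1) • k ∉ fermiBall kF := by
      by_contra! hcon
      have := hbound h hh _ (hcon ⌊2 * kF⌋₊)
      push_cast at this
      linarith [Nat.lt_floor_add_one (2 * kF)]
    classical
    have hmem : h + Nat.find hex • k ∈ fermiBall kF := by
      rcases hj : Nat.find hex with _ | j
      · simpa using hh
      · have := Nat.find_min hex (m := j) (by omega)
        rwa [not_not] at this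
    refine Finset.mem_image.2 ⟨(h + Nat.find hex • k, Nat.find hex), Finset.mem_product.2
      ⟨mem_pairHoles.2 ⟨hmem, ?_⟩, Finset.mem_range.2 (Nat.lt_succ_of_le
        (Nat.le_floor (hbound h hh _ hmem)))⟩, by simp⟩
    have := Nat.find_spec hex
    rwa [succ_nsmul, ← add_assoc] at this
  have hcard := (Finset.card_le_card hsub).trans Finset.card_image_le
  rw [Finset.card_product, Finset.card_range] at hcard
  rw [pairNorm_sq]
  calc (particleNumber kF : ℝ) ≤ ((pairHoles kF k).card : ℝ) * (⌊2 * kF⌋₊ + 1) := by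
        exact_mod_cast hcard
    _ ≤ _ := mul_le_mul_of_nonneg_left
        (by linarith [Nat.floor_le (show 0 ≤ 2 * kF by linarith)]) (Nat.cast_nonneg _)

lemma rootN_sq_le {kF : ℝ} (hkF : 0 ≤ kF) {k : Momentum} (hk : k ≠ 0) :
    rootN kF ^ 2 ≤ 6 * pairNorm kF k ^ 2 := by
  have h1 := particleNumber_le hkF hk
  rw [← rootN_pow_three] at h1
  have h2 := fermi_le_rootN hkF
  have h3 := rootN_pos hkF
  have h4 : pairNorm kF k ^ 2 * (2 * kF + 1) ≤ pairNorm kF k ^ 2 * (6 * rootN kF) :=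
    mul_le_mul_of_nonneg_left (by linarith) (sq_nonneg _)
  refine le_of_mul_le_mul_left ?_ h3
  nlinarith

lemma pairNorm_pos {kF : ℝ} (hkF : 0 ≤ kF) {k : Momentum} (hk : k ≠ 0) : 0 < pairNorm kF k := by
  have h1 := rootN_sq_le hkF hk
  have h2 := rootN_pos hkF
  have h3 : 0 ≤ pairNorm kF k := norm_nonneg _
  refine lt_of_le_of_ne h3 fun h => ?_
  rw [← h] at h1
  nlinarith

lemma inv_pairNorm_le {kF : ℝ} (hkF : 0 ≤ kF) {k : Momentum} (hk : k ≠ 0) :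
    (pairNorm kF k)⁻¹ ≤ 3 / rootN kF := by
  have h1 := rootN_sq_le hkF hk
  have h2 := rootN_pos hkF
  have h3 := pairNorm_pos hkF hk
  rw [inv_le_comm₀ h3 (by positivity), inv_div, div_le_iff₀ (by norm_num)]
  nlinarith

lemma card_pairHoles_neg (kF : ℝ) (k : Momentum) :
    (pairHoles kF (-k)).card = (pairHoles kF k).card := by
  rw [pairHoles_neg, Finset.card_image_of_injective _ neg_injective]

lemma card_pairHoles_add_le (kF : ℝ) (k l : Momentum) :
    (pairHoles kF (k + l)).card ≤ (pairHoles kF k).card + (pairHoles kF l).card := by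
  have hsub : pairHoles kF (k + l) ⊆ pairHoles kF k ∪ (pairHoles kF l).image (fun h => h - k) := by
    intro h hh
    rw [mem_pairHoles] at hh
    by_cases h1 : h + k ∈ fermiBall kF
    · refine Finset.mem_union_right _ (Finset.mem_image.2 ⟨h + k, mem_pairHoles.2 ⟨h1, ?_⟩, by simp⟩)
      rw [add_assoc]; exact hh.2
    · exact Finset.mem_union_left _ (mem_pairHoles.2 ⟨hh.1, h1⟩)
  exact (Finset.card_le_card hsub).trans ((Finset.card_union_le _ _).trans
    (Nat.add_le_add_left Finset.card_image_le _))

lemma card_pairHoles_nsmul_le (kF : ℝ) (n : ℕ) (k : Momentum) :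
    (pairHoles kF (n • k)).card ≤ n * (pairHoles kF k).card := by
  induction n with
  | zero =>
    have : pairHoles kF 0 = ∅ := by
      ext h; rw [mem_pairHoles]; simp
    simp [this]
  | succ n ih =>
    rw [succ_nsmul, add_mul, one_mul]
    exact (card_pairHoles_add_le kF _ _).trans (Nat.add_le_add_right ih _)

lemma card_pairHoles_zsmul_le (kF : ℝ) (n : ℤ) (k : Momentum) :
    (pairHoles kF (n • k)).card ≤ n.natAbs * (pairHoles kF k).card := by
  rcases Int.natAbs_eq n with h | h
  · rw [h, natCast_zsmul, Int.natAbs_natCast]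
    exact card_pairHoles_nsmul_le kF _ k
  · rw [h, neg_zsmul, natCast_zsmul, card_pairHoles_neg, Int.natAbs_neg, Int.natAbs_natCast]
    exact card_pairHoles_nsmul_le kF _ k

lemma klen_sq_cyclic (k : Momentum) (i : Fin 3) :
    klen k ^ 2 = (k i : ℝ) ^ 2 + ((k (i + 1) : ℝ) ^ 2 + (k (i + 2) : ℝ) ^ 2) := by
  rw [klen_sq, Fin.sum_univ_three]
  fin_cases i <;> simp <;> ring

/-- A line in a coordinate direction leaves the Fermi ball at most once, so that the exit points
are determined by the two other coordinates. -/
lemma card_pairHoles_single_le {kF : ℝ} (hkF : 0 ≤ kF) (i : Fin 3) :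
    ((pairHoles kF (Pi.single i 1)).card : ℝ) ≤ 36 * rootN kF ^ 2 := by
  set I : Finset ℤ := Finset.Icc (-⌊kF⌋) ⌊kF⌋ with hI
  have hmem : ∀ h ∈ fermiBall kF, ∀ j, h j ∈ I := by
    intro h hh j
    rw [fermiBall, Finset.mem_filter, Fintype.mem_piFinset] at hh
    exact hh.1 j
  have hstep : ∀ h ∈ pairHoles kF (Pi.single i 1), ∀ h' ∈ pairHoles kF (Pi.single i 1),
      h (i + 1) = h' (i + 1) → h (i + 2) = h' (i + 2) → ¬ h i < h' i := by
    intro h hh h' hh' e1 e2 hlt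
    rw [mem_pairHoles, mem_fermiBall, mem_fermiBall] at hh hh'
    have hne1 : i + 1 ≠ i := by fin_cases i <;> simp
    have hne2 : i + 2 ≠ i := by fin_cases i <;> simp
    have a1 : klen h ^ 2 ≤ kF ^ 2 := pow_le_pow_left₀ (klen_nonneg _) hh.1 2
    have a2 : klen h' ^ 2 ≤ kF ^ 2 := pow_le_pow_left₀ (klen_nonneg _) hh'.1 2
    have a3 : kF ^ 2 < klen (h + Pi.single i 1) ^ 2 :=
      pow_lt_pow_left₀ (not_le.1 hh.2) hkF two_ne_zero
    rw [klen_sq_cyclic _ i] at a1 a2 a3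
    rw [← e1, ← e2] at a2
    simp only [Pi.add_apply, Pi.single_eq_same, Pi.single_eq_of_ne hne1,
      Pi.single_eq_of_ne hne2, add_zero] at a3
    have b1 : h i ^ 2 < (h i + 1) ^ 2 := by
      have : (h i : ℝ) ^ 2 < ((h i + 1 : ℤ) : ℝ) ^ 2 := by linarith
      exact_mod_cast this
    have b2 : h' i ^ 2 < (h i + 1) ^ 2 := by
      have : (h' i : ℝ) ^ 2 < ((h i + 1 : ℤ) : ℝ) ^ 2 := by linarith
      exact_mod_cast this
    have b3 : 0 ≤ h i := by nlinarith
    nlinarith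
  have hcard : (pairHoles kF (Pi.single i 1)).card ≤ (I ×ˢ I).card := by
    refine Finset.card_le_card_of_injOn (fun h => (h (i + 1), h (i + 2))) (fun h hh => ?_) ?_
    · have := (mem_pairHoles.1 hh).1
      exact Finset.mem_product.2 ⟨hmem h this _, hmem h this _⟩
    · intro h hh h' hh' heq
      have e1 : h (i + 1) = h' (i + 1) := congrArg Prod.fst heq
      have e2 : h (i + 2) = h' (i + 2) := congrArg Prod.snd heq
      have e0 : h i = h' i := le_antisymm
        (not_lt.1 (hstep h' hh' h hh e1.symm e2.symm)) (not_lt.1 (hstep h hh h' hh' e1 e2))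
      ext j
      fin_cases i <;> fin_cases j <;> first | exact e0 | exact e1 | exact e2
  have h0 : (0 : ℤ) ≤ ⌊kF⌋ := Int.floor_nonneg.2 hkF
  have hIc : ((I.card : ℕ) : ℝ) = 2 * (⌊kF⌋ : ℝ) + 1 := by
    rw [hI, Int.card_Icc]
    have : (((⌊kF⌋ + 1 - -⌊kF⌋).toNat : ℕ) : ℤ) = 2 * ⌊kF⌋ + 1 := by
      rw [Int.toNat_of_nonneg (by linarith)]; ring
    exact_mod_cast this
  have h1 : ((pairHoles kF (Pi.single i 1)).card : ℝ) ≤ (I.card : ℝ) * I.card := by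
    rw [Finset.card_product] at hcard
    exact_mod_cast hcard
  have h2 := fermi_le_rootN hkF
  have h3 : (⌊kF⌋ : ℝ) ≤ kF := Int.floor_le _
  have h4 : (0 : ℝ) ≤ (⌊kF⌋ : ℝ) := by exact_mod_cast h0
  have h5 : (I.card : ℝ) ≤ 6 * rootN kF := by rw [hIc]; linarith
  calc _ ≤ (I.card : ℝ) * I.card := h1
    _ ≤ (6 * rootN kF) * (6 * rootN kF) :=
        mul_le_mul h5 h5 (Nat.cast_nonneg _) (by linarith [rootN_pos hkF])
    _ = _ := by ring

lemma pairNorm_sq_le {kF : ℝ} (hkF : 0 ≤ kF) (k : Momentum) :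
    pairNorm kF k ^ 2 ≤ 108 * klen k * rootN kF ^ 2 := by
  have hk : k = k 0 • (Pi.single 0 1 : Momentum) + k 1 • (Pi.single 1 1 : Momentum)
      + k 2 • (Pi.single 2 1 : Momentum) := by
    ext j
    fin_cases j <;> simp
  have hterm : ∀ i, ((pairHoles kF (k i • (Pi.single i 1 : Momentum))).card : ℝ)
      ≤ klen k * (36 * rootN kF ^ 2) := by
    intro i
    have h1 : ((pairHoles kF (k i • (Pi.single i 1 : Momentum))).card : ℝ)
        ≤ ((k i).natAbs : ℝ) * (pairHoles kF (Pi.single i 1)).card := by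
      exact_mod_cast card_pairHoles_zsmul_le kF (k i) _
    refine h1.trans (mul_le_mul ?_ (card_pairHoles_single_le hkF i) (Nat.cast_nonneg _)
      (klen_nonneg _))
    rw [Nat.cast_natAbs, Int.cast_abs]
    exact abs_apply_le_klen k i
  have hsum : ((pairHoles kF k).card : ℝ)
      ≤ (pairHoles kF (k 0 • (Pi.single 0 1 : Momentum))).card
        + (pairHoles kF (k 1 • (Pi.single 1 1 : Momentum))).card
        + (pairHoles kF (k 2 • (Pi.single 2 1 : Momentum))).card := by
    have h1 := card_pairHoles_add_le kF (k 0 • (Pi.single 0 1 : Momentum)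
      + k 1 • (Pi.single 1 1 : Momentum)) (k 2 • (Pi.single 2 1 : Momentum))
    rw [← hk] at h1
    have h2 := card_pairHoles_add_le kF (k 0 • (Pi.single 0 1 : Momentum))
      (k 1 • (Pi.single 1 1 : Momentum))
    exact_mod_cast h1.trans (Nat.add_le_add_right h2 _)
  rw [pairNorm_sq]
  linarith [hterm 0, hterm 1, hterm 2]

/-- By telescoping along the lattice lines in direction `k`, the sum of the excitation energies
over all pairs with momentum `k` is `N |k|²`. -/
lemma sum_klen_sq_sub (kF : ℝ) (k : Momentum) :
    ∑ h ∈ pairHoles kF k, (klen (h + k) ^ 2 - klen h ^ 2) = particleNumber kF * klen k ^ 2 := by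
  set g : Momentum → ℝ := fun p => ∑ i, (k i : ℝ) * (p i : ℝ) with hg
  have hgadd : ∀ p, g (p + k) = g p + klen k ^ 2 := fun p => by
    rw [klen_sq, hg, ← Finset.sum_add_distrib]
    refine Finset.sum_congr rfl fun i _ => ?_
    rw [Pi.add_apply]; push_cast; ring
  have hgneg : ∀ p, g (-p) = - g p := fun p => by
    simp [hg]
  have e1 : ∑ h ∈ fermiBall kF, g (h + k)
      = ∑ h ∈ (fermiBall kF).filter (fun h => h + k ∈ fermiBall kF), g (h + k)
        + ∑ h ∈ pairHoles kF k, g (h + k) :=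
    (Finset.sum_filter_add_sum_filter_not _ _ _).symm
  have e2 : ∑ h ∈ fermiBall kF, g h
      = ∑ h ∈ (fermiBall kF).filter (fun h => h + -k ∈ fermiBall kF), g h
        + ∑ h ∈ pairHoles kF (-k), g h :=
    (Finset.sum_filter_add_sum_filter_not _ _ _).symm
  have e3 : ∑ h ∈ (fermiBall kF).filter (fun h => h + k ∈ fermiBall kF), g (h + k)
      = ∑ h ∈ (fermiBall kF).filter (fun h => h + -k ∈ fermiBall kF), g h := by
    refine Finset.sum_nbij' (fun h => h + k) (fun h => h + -k) ?_ ?_ ?_ ?_ ?_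
    · intro h hh
      rw [Finset.mem_filter] at hh ⊢
      exact ⟨hh.2, by rw [add_neg_cancel_right]; exact hh.1⟩
    · intro h hh
      rw [Finset.mem_filter] at hh ⊢
      exact ⟨hh.2, by rw [neg_add_cancel_right]; exact hh.1⟩
    · intro h _; exact add_neg_cancel_right h k
    · intro h _; exact neg_add_cancel_right h k
    · intro h _; rfl
  have e4 : ∑ h ∈ pairHoles kF (-k), g h = - ∑ h ∈ pairHoles kF k, g h := by
    rw [pairHoles_neg, Finset.sum_image fun a _ b _ h => neg_injective h, ← Finset.sum_neg_distrib]
    exact Finset.sum_congr rfl fun h _ => hgneg h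
  have e5 : ∑ h ∈ fermiBall kF, g (h + k)
      = ∑ h ∈ fermiBall kF, g h + particleNumber kF * klen k ^ 2 := by
    rw [Finset.sum_congr rfl fun h _ => hgadd h, Finset.sum_add_distrib, Finset.sum_const,
      nsmul_eq_mul]
    rfl
  have e6 : ∑ h ∈ pairHoles kF k, (klen (h + k) ^ 2 - klen h ^ 2)
      = ∑ h ∈ pairHoles kF k, g (h + k) + ∑ h ∈ pairHoles kF k, g h := by
    rw [← Finset.sum_add_distrib]
    refine Finset.sum_congr rfl fun h _ => ?_
    rw [klen_add_sq_sub, hg, ← Finset.sum_add_distrib]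
    refine Finset.sum_congr rfl fun i _ => by ring
  linarith

lemma kDotF_eq_div (kF : ℝ) (k : Momentum) :
    kDotF kF k = particleNumber kF * klen k ^ 2 / pairNorm kF k ^ 2 := by
  rw [kDotF_eq, sum_klen_sq_sub, div_eq_inv_mul]

/-- The mean excitation energy is `ħ² k · f(k) = N^{1/3} |k|² / n_k²`. -/
lemma hbar_sq_mul_kDotF {kF : ℝ} (hkF : 0 ≤ kF) (k : Momentum) :
    hbar kF ^ 2 * kDotF kF k = rootN kF * klen k ^ 2 / pairNorm kF k ^ 2 := by
  have := rootN_pos hkF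
  rw [kDotF_eq_div, hbar_eq, ← rootN_pow_three]
  field_simp

lemma abs_meanGap_le {kF : ℝ} (hkF : 0 ≤ kF) {k : Momentum} (hk : k ≠ 0) :
    |meanGap kF (excitationEnergy kF) k| ≤ 6 * klen k ^ 2 / rootN kF := by
  have h1 := rootN_sq_le hkF hk
  have h2 := rootN_pos hkF
  have h3 := pairNorm_pos hkF hk
  rw [meanGap_excitationEnergy, hbar_sq_mul_kDotF hkF, abs_of_nonneg (by positivity),
    div_le_div_iff₀ (by positivity) h2]
  have := mul_le_mul_of_nonneg_left h1 (sq_nonneg (klen k))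
  nlinarith

lemma abs_excitationEnergy_add_le {kF : ℝ} (hkF : 0 ≤ kF) {k h : Momentum} (hk : k ≠ 0)
    (hh : h ∈ pairHoles kF k) :
    |excitationEnergy kF (h + k) + excitationEnergy kF h| ≤ 6 * klen k ^ 2 / rootN kF := by
  have h2 := rootN_pos hkF
  have h3 := fermi_le_rootN hkF
  have h4 := one_le_klen hk
  have h5 := klen_add_le h k
  rw [excitationEnergy_add hh]
  rw [mem_pairHoles, mem_fermiBall, mem_fermiBall, not_le] at hh
  have h6 := klen_nonneg h
  have h7 : 0 ≤ klen (h + k) ^ 2 - klen h ^ 2 := by nlinarith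
  have h8 : klen (h + k) ^ 2 - klen h ^ 2 ≤ klen k ^ 2 * (6 * rootN kF) := by
    have a1 : klen (h + k) ^ 2 ≤ (klen h + klen k) ^ 2 :=
      pow_le_pow_left₀ (klen_nonneg _) h5 2
    have a2 : klen k * klen h ≤ klen k * kF := mul_le_mul_of_nonneg_left hh.1 (by linarith)
    have a3 : klen k * kF ≤ klen k ^ 2 * kF :=
      mul_le_mul_of_nonneg_right (le_self_pow₀ h4 two_ne_zero) hkF
    have a4 : klen k ^ 2 * (kF + 1) ≤ klen k ^ 2 * (3 * rootN kF) :=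
      mul_le_mul_of_nonneg_left h3 (sq_nonneg _)
    nlinarith
  rw [abs_of_nonneg (by positivity), hbar_eq, inv_pow, inv_mul_eq_div, div_le_div_iff₀
    (by positivity) h2]
  nlinarith

/-! ### The optimal kernel -/

lemma abs_artanh_div_le {b c : ℝ} (hb : 0 ≤ b) (hc : 0 < c) :
    |Real.artanh (b / (c + b))| ≤ b / c := by
  have hcb : 0 < c + b := by linarith
  have h0 : 0 ≤ b / (c + b) := by positivity
  have h1 : b / (c + b) < 1 := (div_lt_one hcb).2 (by linarith)
  have h2 : (1 + b / (c + b)) / (1 - b / (c + b)) = 1 + 2 * (b / c) := by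
    have : 1 - b / (c + b) = c / (c + b) := by field_simp; ring
    rw [this]
    field_simp
    ring
  have h3 : 0 ≤ b / c := by positivity
  rw [Real.artanh_eq_half_log ⟨by linarith, h1.le⟩, h2,
    abs_of_nonneg (mul_nonneg (by norm_num) (Real.log_nonneg (by linarith)))]
  have := Real.log_le_sub_one_of_pos (show 0 < 1 + 2 * (b / c) by linarith)
  linarith

/-- A constant that bounds `β_k / (α_k - β_k)` in units of `V̂(k)`, for the exact coefficients and
for their leading orders. -/
def ratioConst : ℝ :=
  108 ^ 2 + ((3 / 4) * √Real.pi) ^ (2 / 3 : ℝ) / (4 / (3 * √Real.pi)) ^ (2 / 3 : ℝ)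

lemma ratioConst_nonneg : 0 ≤ ratioConst := by
  unfold ratioConst; positivity

/-- The kernels in both versions are real, even, supported in the support of `V̂` and bounded by a
multiple of `V̂`, uniformly in the Fermi momentum. -/
lemma exists_real_kernel {V : Momentum → ℝ} (hV : ∀ k, V (-k) = V k) (hV0 : ∀ k, k ≠ 0 → 0 ≤ V k)
    {kF : ℝ} (hkF : 0 ≤ kF) {Ξ : Momentum → ℂ}
    (hΞ : Ξ = xiZero (alpha V kF) (beta V kF) ∨ Ξ = xiZero (alphaLead V kF) (betaLead V kF)) :
    ∃ ξ : Momentum → ℝ, (∀ k, Ξ k = ξ k) ∧ (∀ k, ξ (-k) = ξ k) ∧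
      ∀ k, k ≠ 0 → |ξ k| ≤ ratioConst * V k := by
  have hr := rootN_pos hkF
  have hc2 : 0 ≤ ((3 / 4) * √Real.pi) ^ (2 / 3 : ℝ) / (4 / (3 * √Real.pi)) ^ (2 / 3 : ℝ) := by
    positivity
  have hhalf : ∀ x : ℝ, |-(1 / 2) * x| ≤ |x| := fun x => by
    rw [abs_mul, abs_neg, abs_of_pos (by norm_num : (0 : ℝ) < 1 / 2)]
    linarith [abs_nonneg x]
  rcases hΞ with rfl | rfl
  · refine ⟨fun k => -(1 / 2) * Real.artanh (beta V kF k / alpha V kF k), fun _ => rfl,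
      fun k => ?_, fun k hk => (hhalf _).trans ?_⟩
    · simp only [alpha, beta, kDotF_eq_div, pairNorm_neg, klen_neg, hV]
    · have hn := pairNorm_pos hkF hk
      have hl := one_le_klen hk
      have hVk := hV0 k hk
      have hN : (0 : ℝ) < particleNumber kF := by exact_mod_cast particleNumber_pos hkF
      have hb : 0 ≤ beta V kF k := by unfold beta; positivity
      have hg : hbar kF ^ 2 * kDotF kF k = rootN kF * klen k ^ 2 / pairNorm kF k ^ 2 :=
        hbar_sq_mul_kDotF hkF k
      have hg0 : 0 < rootN kF * klen k ^ 2 / pairNorm kF k ^ 2 := by positivity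
      rw [alpha, hg]
      refine (abs_artanh_div_le hb hg0).trans ?_
      have hle := pairNorm_sq_le hkF k
      have hle2 : (pairNorm kF k ^ 2) ^ 2 ≤ (108 * klen k * rootN kF ^ 2) ^ 2 :=
        pow_le_pow_left₀ (sq_nonneg _) hle 2
      have heq : beta V kF k / (rootN kF * klen k ^ 2 / pairNorm kF k ^ 2)
          = V k * ((pairNorm kF k ^ 2) ^ 2 / (klen k * rootN kF ^ 2) ^ 2) := by
        rw [beta, ← rootN_pow_three]
        field_simp
      rw [heq, mul_comm]
      refine mul_le_mul_of_nonneg_right ?_ hVk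
      refine le_trans ?_ (le_add_of_nonneg_right hc2)
      rw [div_le_iff₀ (by positivity)]
      exact hle2.trans (le_of_eq (by ring))
  · refine ⟨fun k => -(1 / 2) * Real.artanh (betaLead V kF k / alphaLead V kF k), fun _ => rfl,
      fun k => ?_, fun k hk => (hhalf _).trans ?_⟩
    · simp only [alphaLead, betaLead, klen_neg, hV]
    · have hl := one_le_klen hk
      have hVk := hV0 k hk
      have hh : 0 < hbar kF := by rw [hbar_eq]; positivity
      have hb : 0 ≤ betaLead V kF k := by unfold betaLead; positivity
      have hg0 : 0 < hbar kF * klen k * (4 / (3 * √Real.pi)) ^ (2 / 3 : ℝ) := by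
        have := Real.pi_pos
        positivity
      rw [alphaLead]
      refine (abs_artanh_div_le hb hg0).trans ?_
      have heq : betaLead V kF k / (hbar kF * klen k * (4 / (3 * √Real.pi)) ^ (2 / 3 : ℝ))
          = ((3 / 4) * √Real.pi) ^ (2 / 3 : ℝ) / (4 / (3 * √Real.pi)) ^ (2 / 3 : ℝ) * V k := by
        have hk0 : klen k ≠ 0 := by linarith
        have hx : (4 / (3 * √Real.pi)) ^ (2 / 3 : ℝ) ≠ 0 := by
          have := Real.pi_pos
          positivity
        rw [betaLead]
        generalize (4 / (3 * √Real.pi)) ^ (2 / 3 : ℝ) = x at *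
        field_simp
      rw [heq]
      refine mul_le_mul_of_nonneg_right ?_ hVk
      exact le_add_of_nonneg_left (by norm_num)

/-! ### The support of the potential -/

lemma cConst_nonneg : 0 ≤ cConst := by unfold cConst; positivity

/-- On the support of `V̂`, each term of `A₅` is at least one. Hence the support is finite. -/
lemma exists_support {V : Momentum → ℝ} (hV : ∀ k, V (-k) = V k) (hV0 : ∀ k, k ≠ 0 → 0 ≤ V k)
    (hA : ∀ i, Summable (aTerm V i)) :
    ∃ S : Finset Momentum, (0 : Momentum) ∉ S ∧ (∀ k ∈ S, -k ∈ S) ∧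
      (∀ k, k ≠ 0 → k ∉ S → V k = 0) ∧ (∀ k ∈ S, klen k ≤ aSum V 4 ^ 2) ∧
      ∑ k ∈ S, V k ≤ aSum V 1 := by
  have hc := cConst_nonneg
  have hterm : ∀ k : NzMomentum, V k ≠ 0 → √(klen k) ≤ aTerm V 4 k := by
    intro k hk
    simp only [aTerm, if_neg hk]
    refine le_mul_of_one_le_left (Real.sqrt_nonneg _) (Real.one_le_rpow ?_ (by norm_num))
    have := mul_nonneg hc (hV0 k k.2)
    linarith
  have hpos : ∀ k : NzMomentum, 0 ≤ aTerm V 4 k := by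
    intro k
    by_cases hk : V k = 0
    · simp [aTerm, hk]
    · exact (Real.sqrt_nonneg _).trans (hterm k hk)
  -- a summable family has only finitely many terms that are at least one
  have hfin : {k : NzMomentum | V k ≠ 0}.Finite := by
    have h1 := (hA 4).tendsto_cofinite_zero.eventually (gt_mem_nhds (zero_lt_one' ℝ))
    rw [Filter.eventually_cofinite] at h1
    refine h1.subset fun k hk => ?_
    have h2 := hterm k hk
    have h3 : 1 ≤ √(klen k) := Real.one_le_sqrt.2 (one_le_klen k.2)
    exact not_lt.2 (h3.trans h2)
  refine ⟨hfin.toFinset.map (Function.Embedding.subtype _), ?_, ?_, ?_, ?_, ?_⟩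
  · simp
  · intro k hk
    simp only [Finset.mem_map, Set.Finite.mem_toFinset, Set.mem_ofPred_eq,
      Function.Embedding.subtype_apply] at hk ⊢
    obtain ⟨l, hl, rfl⟩ := hk
    exact ⟨⟨-l, neg_ne_zero.2 l.2⟩, by rw [hV]; exact hl, rfl⟩
  · intro k hk hkS
    by_contra hVk
    refine hkS (Finset.mem_map.2 ⟨⟨k, hk⟩, ?_, rfl⟩)
    simpa using hVk
  · intro k hk
    obtain ⟨l, hl, rfl⟩ := Finset.mem_map.1 hk
    have h1 := hterm l (by simpa using hl)
    have h2 : aTerm V 4 l ≤ aSum V 4 := (hA 4).le_tsum l fun k _ => hpos k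
    have h3 : √(klen l) ≤ aSum V 4 := h1.trans h2
    calc klen l = √(klen l) ^ 2 := (Real.sq_sqrt (klen_nonneg _)).symm
      _ ≤ aSum V 4 ^ 2 := pow_le_pow_left₀ (Real.sqrt_nonneg _) h3 2
  · rw [Finset.sum_map]
    refine (Finset.sum_le_sum fun k _ => ?_).trans
      ((hA 1).sum_le_tsum _ fun k _ => mul_nonneg (abs_nonneg _) (Real.sqrt_nonneg _))
    have h1 := hV0 k k.2
    rw [Function.Embedding.subtype_apply]
    simp only [aTerm]
    rw [abs_of_nonneg h1]
    refine le_mul_of_one_le_right h1 (Real.one_le_sqrt.2 ?_)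
    have := mul_nonneg hc h1
    linarith

/-- The total error is at most `errBound X R v / N` if `X` bounds `∑ |ξ|`, and `R` and `v` bound
`|k|` on the support of the potential and the sum of the potential. -/
def errBound (X R v : ℝ) : ℝ :=
  (v * (108 * R)) * (6 * Real.exp (108 * X)
      * (Real.exp (2 * X) * (180 * X * Real.exp (108 * X))))
    + X * (2 * (6 * R ^ 2 * (3 * Real.exp (108 * X)
        * (Real.exp (2 * X) * (180 * X * Real.exp (108 * X))))
      + 2 * Real.exp (108 * X) * (1080 * R ^ 2 * X * Real.exp (108 * X))))

/-- The powers of `N` cancel: the interaction error is of order `N⁻¹ · N^{2/3} · N^{-2/3}` and the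
kinetic error of order `N^{-1/3} · N^{-2/3}`. -/
lemma norm_eps_le_errBound {V : Momentum → ℝ} {kF : ℝ} (hkF : 0 ≤ kF) {Ξ : Momentum → ℂ}
    {ξ : Momentum → ℝ} {S : Finset Momentum} {X R v : ℝ} (hΞ : ∀ k, Ξ k = ξ k)
    (hξe : ∀ k, ξ (-k) = ξ k) (hS0 : (0 : Momentum) ∉ S) (hneg : ∀ k ∈ S, -k ∈ S)
    (hV0 : ∀ k ∈ S, 0 ≤ V k) (hVS : ∀ k, k ≠ 0 → k ∉ S → V k = 0)
    (hξS : ∀ k, k ≠ 0 → k ∉ S → ξ k = 0) (hX : ∑ k ∈ S, |ξ k| ≤ X) (hR0 : 0 ≤ R)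
    (hR : ∀ k ∈ S, klen k ≤ R) (hv : ∑ k ∈ S, V k ≤ v) :
    ‖eps1 V kF Ξ + ((2 * (eps2 kF Ξ).re : ℝ) : ℂ)‖ ≤ errBound X R v / particleNumber kF := by
  have hr := rootN_pos hkF
  have hne : ∀ k ∈ S, k ≠ 0 := fun k hk h => hS0 (h ▸ hk)
  set P : Finset Momentum :=
    fermiBall kF ∪ S.biUnion fun k => (fermiBall kF).image fun h => h + k with hP
  have hdata : BogData kF S P ξ X (3 / rootN kF) := by
    refine ⟨hneg, hξe, fun k hk h hh => ?_, hX, fun k hk => pairNorm_pos hkF (hne k hk),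
      fun k hk => inv_pairNorm_le hkF (hne k hk)⟩
    have := (mem_pairHoles.1 hh).1
    exact ⟨Finset.mem_union_left _ this, Finset.mem_union_right _
      (Finset.mem_biUnion.2 ⟨k, hk, Finset.mem_image_of_mem _ this⟩)⟩
  have hmono : ∀ k ∈ S, 6 * klen k ^ 2 / rootN kF ≤ 6 * R ^ 2 / rootN kF := fun k hk => by
    have := pow_le_pow_left₀ (klen_nonneg k) (hR k hk) 2
    gcongr
  have hκ : ∀ l ∈ S, |meanGap kF (excitationEnergy kF) l| ≤ 6 * R ^ 2 / rootN kF := fun l hl =>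
    (abs_meanGap_le hkF (hne l hl)).trans (hmono l hl)
  have hG : ∀ l ∈ S, ∀ p ∈ pairHoles kF l,
      |(pairNorm kF l)⁻¹ * (excitationEnergy kF (p + l) + excitationEnergy kF p)
        - meanGap kF (excitationEnergy kF) l * (pairNorm kF l)⁻¹| ≤ 36 * R ^ 2 / rootN kF ^ 2 := by
    intro l hl p hp
    have h1 := (abs_excitationEnergy_add_le hkF (hne l hl) hp).trans (hmono l hl)
    have h2 := hκ l hl
    have h3 := inv_pairNorm_le hkF (hne l hl)
    rw [mul_comm (meanGap _ _ _), ← mul_sub, abs_mul, abs_inv_pairNorm]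
    calc _ ≤ 3 / rootN kF * (6 * R ^ 2 / rootN kF + 6 * R ^ 2 / rootN kF) :=
          mul_le_mul h3 ((abs_sub _ _).trans (add_le_add h1 h2)) (abs_nonneg _) (by positivity)
      _ = _ := by field_simp; ring
  have key := hdata.norm_eps_le hS0 hVS hΞ hξS hκ (by positivity) (by positivity) (by positivity) hG
  refine key.trans ?_
  have hX0 := hdata.X_nonneg
  have hsum : ∑ k ∈ S, |V k| * pairNorm kF k ^ 2 ≤ v * (108 * R) * rootN kF ^ 2 := by
    calc ∑ k ∈ S, |V k| * pairNorm kF k ^ 2 ≤ ∑ k ∈ S, V k * (108 * R * rootN kF ^ 2) := by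
          refine Finset.sum_le_sum fun k hk => ?_
          rw [abs_of_nonneg (hV0 k hk)]
          refine mul_le_mul_of_nonneg_left ((pairNorm_sq_le hkF k).trans ?_) (hV0 k hk)
          have := hR k hk
          gcongr
      _ ≤ v * (108 * R * rootN kF ^ 2) := by
          rw [← Finset.sum_mul]
          exact mul_le_mul_of_nonneg_right hv (by positivity)
      _ = _ := by ring
  have hd := hdata.dynErr_nonneg
  calc _ ≤ (1 / (particleNumber kF : ℝ)) * (v * (108 * R) * rootN kF ^ 2)
          * (6 * Real.exp (108 * X) * dynErr X (3 / rootN kF))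
          + X * kinErr X (3 / rootN kF) (6 * R ^ 2 / rootN kF) (36 * R ^ 2 / rootN kF ^ 2) := by
        gcongr
    _ = errBound X R v / particleNumber kF := by
        rw [← rootN_pow_three, errBound, kinErr, dynErr]
        field_simp
        ring

end RPA

end

theorem mainTheorem7 :
    ∃ C : (Fin 5 → ℝ) → ℝ, (∀ A : Fin 5 → ℝ, 0 < C A) ∧
      ∀ (V : RPA.Momentum → ℝ),
        (∀ k : RPA.Momentum, V (-k) = V k) →
        (∀ k : RPA.Momentum, k ≠ 0 → 0 ≤ V k) →
        (∀ i : Fin 5, Summable (RPA.aTerm V i)) →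
        ∀ (kF : ℝ), 0 ≤ kF →
          ∀ Ξ : RPA.Momentum → ℂ,
            (Ξ = RPA.xiZero (RPA.alpha V kF) (RPA.beta V kF) ∨
              Ξ = RPA.xiZero (RPA.alphaLead V kF) (RPA.betaLead V kF)) →
            ‖RPA.eps1 V kF Ξ + ((2 * (RPA.eps2 kF Ξ).re : ℝ) : ℂ)‖
              ≤ C (RPA.aSum V) / (RPA.particleNumber kF : ℝ) := by
  refine ⟨fun A => |RPA.errBound (RPA.ratioConst * A 1) (A 4 ^ 2) (A 1)| + 1,
    fun A => by positivity, fun V hV hV0 hA kF hkF Ξ hΞ => ?_⟩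
  obtain ⟨ξ, hξ, hξe, hξV⟩ := RPA.exists_real_kernel hV hV0 hkF hΞ
  obtain ⟨S, hS0, hneg, hVS, hR, hv⟩ := RPA.exists_support hV hV0 hA
  have hne : ∀ k ∈ S, k ≠ 0 := fun k hk h => hS0 (h ▸ hk)
  have hX : ∑ k ∈ S, |ξ k| ≤ RPA.ratioConst * RPA.aSum V 1 :=
    calc ∑ k ∈ S, |ξ k| ≤ ∑ k ∈ S, RPA.ratioConst * V k :=
          Finset.sum_le_sum fun k hk => hξV k (hne k hk)
      _ ≤ _ := by
          rw [← Finset.mul_sum]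
          exact mul_le_mul_of_nonneg_left hv RPA.ratioConst_nonneg
  refine (RPA.norm_eps_le_errBound hkF hξ hξe hS0 hneg (fun k hk => hV0 k (hne k hk)) hVS
    (fun k hk hkS => ?_) hX (sq_nonneg _) hR hv).trans ?_
  · have := hξV k hk
    rw [hVS k hk hkS, mul_zero] at this
    exact abs_nonpos_iff.1 this
  · gcongr
    exact (le_abs_self _).trans (le_add_of_nonneg_right zero_le_one)
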